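/- Let $m,n\ge 1$ and let $\mathfrak g=\mathfrak g_0\oplus\mathfrak g_1$ be one of the complex Lie superalgebras $\mathfrak{gl}(m|n)$ (type $A(m-1,n-1)$), $\mathfrak{osp}(2m+1|2n)$ (type $B(m,n)$), $\mathfrak{osp}(2m|2n)$ (type $D(m,n)$; for $m=1$ this is $C(n+1)$). Let $\mathfrak h$ be its diagonal Cartan subalgebra (for the split realization of $\mathfrak{osp}$), $V=\mathfrak h^*_{\mathbb R}$ with standard basis $\varepsilon_1,\dots,\varepsilon_m,\delta_1,\dots,\delta_n$ and the form $(\varepsilon_i,\varepsilon_j)=-(\delta_i,\delta_j)=\delta_{ij}$, $(\varepsilon_i,\delta_j)=0$, and let $\Delta_0,\Delta_1\subset V$ be the sets of even and odd roots, i.e. the non-zero weights of $\mathfrak h$ on $\mathfrak g_0$ and $\mathfrak g_1$; $\Delta=\Delta_0\cup\Delta_1$. Let $f:V\to\mathbb R$ be a linear functional that vanishes on no root, and put $\Delta_{+,i}=\{\alpha\in\Delta_i : f(\alpha)>0\}$, $\Delta_+=\Delta_{+,0}\cup\Delta_{+,1}$, $$\rho=\tfrac12\sum_{\alpha\in\Delta_{+,0}}\alpha-\tfrac12\sum_{\alpha\in\Delta_{+,1}}\alpha,\qquad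 R=\frac{\prod_{\alpha\in\Delta_{+,0}}(1-e^{-\alpha})}{\prod_{\alpha\in\Delta_{+,1}}(1+e^{-\alpha})}.$$ Let $\Pi$ be the set of simple roots of $\Delta_+$ (a linearly independent subset of $\Delta_+$ with $\Delta_+\subset\sum_{\alpha\in\Pi}\mathbb Z_{\ge0}\alpha$), and let $S\subset\Pi$ be a maximal isotropic set, i.e. a set of roots that is a basis of a maximal totally isotropic subspace of $V$ (so that $|S|=\min(m,n)$ is the defect of $\mathfrak g$). Let $\Delta^{\#}$ be the "largest" of the two parts $\{\alpha\in\Delta_0:(\alpha,\alpha)>0\}$ (of type $A_{m-1}$, $B_m$, $D_m$, respectively) and $\{\alpha\in\Delta_0:(\alpha,\alpha)<0\}$ (of type $A_{n-1}$, $C_n$, $C_n$, respectively) of $\Delta_0$: the first one if $m>n$, the second one if $m<n$; if $m=n$, either of them for $\mathfrak{gl}(n|n)$ and $B(n,n)$, and the second one for $D(n,n)$. Let $W^{\#}\subset GL(V)$ be the group generated by the reflections in the roots of $\Delta^{\#}$, and $\operatorname{sgn}(w)=\det w=\pm1$. Then, in the field of fractions of the group algebra $\mathbb Q[e^\nu,\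 \nu\in V]$, on which $W^{\#}$ acts by $w(e^\nu)=e^{w\nu}$, $$R\,e^{\rho}=\sum_{w\in W^{\#}}\operatorname{sgn}(w)\,w\Bigl(\frac{e^{\rho}}{\prod_{\beta\in S}(1+e^{-\beta})}\Bigr).$$ -/

import Mathlib

namespace WeylDenominator

open Matrix

noncomputable section

/-- The three series: `A` stands for `gl(m|n)` (type `A(m-1,n-1)`), `B` for `osp(2m+1|2n)`
(type `B(m,n)`) and `D` for `osp(2m|2n)` (type `D(m,n)`; for `m = 1` this is `C(n+1)`). -/
inductive SuperType
  | A
  | B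
  | D

/-! ### The Lie superalgebras `gl(I|J)` and `osp(K)` as `ℤ/2`-graded spaces of complex matrices -/

section Matrices

variable {I J : Type} [Fintype I] [Fintype J] [DecidableEq I] [DecidableEq J]

/-- The even part of `gl(I|J)`: the block diagonal matrices. -/
def glEven (I J : Type) : Submodule ℂ (Matrix (I ⊕ J) (I ⊕ J) ℂ) where
  carrier := {x | ∀ i j, x (Sum.inl i) (Sum.inr j) = 0 ∧ x (Sum.inr j) (Sum.inl i) = 0}
  zero_mem' := fun _ _ => ⟨rfl, rfl⟩
  add_mem' := fun {x y} hx hy i j => by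
    simp [(hx i j).1, (hx i j).2, (hy i j).1, (hy i j).2]
  smul_mem' := fun c x hx i j => by simp [(hx i j).1, (hx i j).2]

/-- The odd part of `gl(I|J)`: the block off-diagonal matrices. -/
def glOdd (I J : Type) : Submodule ℂ (Matrix (I ⊕ J) (I ⊕ J) ℂ) where
  carrier := {x | (∀ i i', x (Sum.inl i) (Sum.inl i') = 0) ∧
    ∀ j j', x (Sum.inr j) (Sum.inr j') = 0}
  zero_mem' := ⟨fun _ _ => rfl, fun _ _ => rfl⟩
  add_mem' := fun {x y} hx hy =>
    ⟨fun i i' => by simp [hx.1 i i', hy.1 i i'], fun j j' => by simp [hx.2 j j', hy.2 j j']⟩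
  smul_mem' := fun c x hx =>
    ⟨fun i i' => by simp [hx.1 i i'], fun j j' => by simp [hx.2 j j']⟩

/-- The matrix of the parity automorphism `v ↦ (-1)^|v| v`. -/
def parityMatrix (I J : Type) [DecidableEq I] [DecidableEq J] :
    Matrix (I ⊕ J) (I ⊕ J) ℂ :=
  Matrix.fromBlocks 1 0 0 (-1)

/-- The even part of the orthosymplectic Lie superalgebra of the even supersymmetric form
`⟨v, w⟩ = vᵀ K w`: even `x` with `⟨x v, w⟩ + ⟨v, x w⟩ = 0`. -/
def ospEven (K : Matrix (I ⊕ J) (I ⊕ J) ℂ) : Submodule ℂ (Matrix (I ⊕ J) (I ⊕ J) ℂ) where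
  carrier := {x | x ∈ glEven I J ∧ xᵀ * K + K * x = 0}
  zero_mem' := ⟨zero_mem _, by simp⟩
  add_mem' := by
    rintro x y ⟨hx, hx'⟩ ⟨hy, hy'⟩
    refine ⟨add_mem hx hy, ?_⟩
    rw [transpose_add, add_mul, mul_add, add_add_add_comm, hx', hy', add_zero]
  smul_mem' := by
    rintro c x ⟨hx, hx'⟩
    refine ⟨Submodule.smul_mem _ c hx, ?_⟩
    rw [transpose_smul, Matrix.smul_mul, Matrix.mul_smul, ← smul_add, hx', smul_zero]

/-- The odd part of the orthosymplectic Lie superalgebra of the even supersymmetric form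
`⟨v, w⟩ = vᵀ K w`: odd `x` with `⟨x v, w⟩ + (-1)^|v| ⟨v, x w⟩ = 0` for homogeneous `v`. -/
def ospOdd (K : Matrix (I ⊕ J) (I ⊕ J) ℂ) : Submodule ℂ (Matrix (I ⊕ J) (I ⊕ J) ℂ) where
  carrier := {x | x ∈ glOdd I J ∧ xᵀ * K + parityMatrix I J * K * x = 0}
  zero_mem' := ⟨zero_mem _, by simp⟩
  add_mem' := by
    rintro x y ⟨hx, hx'⟩ ⟨hy, hy'⟩
    refine ⟨add_mem hx hy, ?_⟩
    rw [transpose_add, add_mul, mul_add, add_add_add_comm, hx', hy', add_zero]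
  smul_mem' := by
    rintro c x ⟨hx, hx'⟩
    refine ⟨Submodule.smul_mem _ c hx, ?_⟩
    rw [transpose_smul, Matrix.smul_mul, Matrix.mul_smul, ← smul_add, hx', smul_zero]

end Matrices

/-- Split symmetric form on the even part, split symplectic form on the odd part of
`ℂ^(2m+1|2n)`. -/
def formB (m n : ℕ) : Matrix ((Unit ⊕ (Fin m ⊕ Fin m)) ⊕ (Fin n ⊕ Fin n))
    ((Unit ⊕ (Fin m ⊕ Fin m)) ⊕ (Fin n ⊕ Fin n)) ℂ :=
  Matrix.fromBlocks (LieAlgebra.Orthogonal.JB (Fin m) ℂ) 0 0 (Matrix.J (Fin n) ℂ)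

/-- Split symmetric form on the even part, split symplectic form on the odd part of
`ℂ^(2m|2n)`. -/
def formD (m n : ℕ) : Matrix ((Fin m ⊕ Fin m) ⊕ (Fin n ⊕ Fin n))
    ((Fin m ⊕ Fin m) ⊕ (Fin n ⊕ Fin n)) ℂ :=
  Matrix.fromBlocks (LieAlgebra.Orthogonal.JD (Fin m) ℂ) 0 0 (Matrix.J (Fin n) ℂ)

/-! ### The space `V = 𝔥*_ℝ`, weights and roots -/

/-- `V = 𝔥*_ℝ` in the coordinates of the standard basis `ε_1, …, ε_m, δ_1, …, δ_n`. The Cartan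
subalgebra `𝔥` (the diagonal matrices of the superalgebra) is parametrized by `t ∈ ℂ^(m+n)`,
with `ε_i`, `δ_j` the coordinate functions of `t`. -/
abbrev V (m n : ℕ) : Type := Fin m ⊕ Fin n → ℝ

/-- The basis vector `ε_i`. -/
def eps {m n : ℕ} (i : Fin m) : V m n := Pi.single (Sum.inl i) 1

/-- The basis vector `δ_j`. -/
def del {m n : ℕ} (j : Fin n) : V m n := Pi.single (Sum.inr j) 1

/-- Weights of the standard basis of `ℂ^(m|n)`. -/
def weightA (m n : ℕ) : Fin m ⊕ Fin n → V m n := Sum.elim eps del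

/-- Weights of the standard basis of `ℂ^(2m+1|2n)`. -/
def weightB (m n : ℕ) : (Unit ⊕ (Fin m ⊕ Fin m)) ⊕ (Fin n ⊕ Fin n) → V m n :=
  Sum.elim (Sum.elim (fun _ => 0) (Sum.elim eps (fun i => -eps i)))
    (Sum.elim del (fun j => -del j))

/-- Weights of the standard basis of `ℂ^(2m|2n)`. -/
def weightD (m n : ℕ) : (Fin m ⊕ Fin m) ⊕ (Fin n ⊕ Fin n) → V m n :=
  Sum.elim (Sum.elim eps (fun i => -eps i)) (Sum.elim del (fun j => -del j))

/-- The value `⟨α, t⟩` of `α ∈ 𝔥*_ℝ` on the element of `𝔥` with coordinates `t`. -/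
def pairing {m n : ℕ} (α : V m n) (t : Fin m ⊕ Fin n → ℂ) : ℂ := ∑ k, (α k : ℂ) * t k

/-- The element of `𝔥` with coordinates `t`: the diagonal matrix that acts on the basis vector
`p` of the standard representation by the value at `t` of its weight. -/
def cartan {m n : ℕ} {P : Type} [DecidableEq P] (wt : P → V m n) (t : Fin m ⊕ Fin n → ℂ) :
    Matrix P P ℂ :=
  Matrix.diagonal fun p => pairing (wt p) t

/-- The non-zero weights of the adjoint action of `𝔥` on a graded piece `L` of the superalgebra
(elements of `𝔥` are even, so their superbracket with anything is the commutator). -/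
def rootsOf {m n : ℕ} {P : Type} [Fintype P] [DecidableEq P] (wt : P → V m n)
    (L : Submodule ℂ (Matrix P P ℂ)) : Set (V m n) :=
  {α | α ≠ 0 ∧ ∃ x ∈ L, x ≠ 0 ∧
    ∀ t, cartan wt t * x - x * cartan wt t = pairing α t • x}

/-- The set `Δ₀` of even roots. -/
def evenRoots (T : SuperType) (m n : ℕ) : Set (V m n) :=
  match T with
  | .A => rootsOf (weightA m n) (glEven (Fin m) (Fin n))
  | .B => rootsOf (weightB m n) (ospEven (formB m n))
  | .D => rootsOf (weightD m n) (ospEven (formD m n))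

/-- The set `Δ₁` of odd roots. -/
def oddRoots (T : SuperType) (m n : ℕ) : Set (V m n) :=
  match T with
  | .A => rootsOf (weightA m n) (glOdd (Fin m) (Fin n))
  | .B => rootsOf (weightB m n) (ospOdd (formB m n))
  | .D => rootsOf (weightD m n) (ospOdd (formD m n))

/-- The set `Δ = Δ₀ ∪ Δ₁` of roots. -/
def roots (T : SuperType) (m n : ℕ) : Set (V m n) := evenRoots T m n ∪ oddRoots T m n

/-- The form on `V` induced by the (suitably scaled) supertrace form:
`(ε_i, ε_j) = -(δ_i, δ_j) = δ_{ij}`, `(ε_i, δ_j) = 0`. -/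
def form {m n : ℕ} (x y : V m n) : ℝ :=
  ∑ i : Fin m, x (Sum.inl i) * y (Sum.inl i) - ∑ j : Fin n, x (Sum.inr j) * y (Sum.inr j)

/-! ### Positive roots, simple roots, maximal isotropic sets -/

/-- `Δ_{+,0}(f)`, as a set. -/
def posEvenSet (T : SuperType) {m n : ℕ} (f : Module.Dual ℝ (V m n)) : Set (V m n) :=
  {α | α ∈ evenRoots T m n ∧ 0 < f α}

/-- `Δ_{+,1}(f)`, as a set. -/
def posOddSet (T : SuperType) {m n : ℕ} (f : Module.Dual ℝ (V m n)) : Set (V m n) :=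
  {α | α ∈ oddRoots T m n ∧ 0 < f α}

/-- `Π` is a set of simple roots of `Δ_+(f)`. -/
def IsSimpleSystem (T : SuperType) {m n : ℕ} (f : Module.Dual ℝ (V m n))
    (P : Set (V m n)) : Prop :=
  P ⊆ posEvenSet T f ∪ posOddSet T f ∧
  LinearIndependent ℝ (Subtype.val : P → V m n) ∧
  ∀ α ∈ posEvenSet T f ∪ posOddSet T f, α ∈ AddSubmonoid.closure P

/-- `S` is a set of roots that is a basis of a maximal (totally) isotropic subspace of `V`. -/
def IsMaximalIsotropic (T : SuperType) {m n : ℕ} (S : Set (V m n)) : Prop :=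
  S ⊆ roots T m n ∧
  LinearIndependent ℝ (Subtype.val : S → V m n) ∧
  Maximal (fun U : Submodule ℝ (V m n) => ∀ x ∈ U, ∀ y ∈ U, form x y = 0)
    (Submodule.span ℝ S)

/-! ### The component `Δ^#` and its Weyl group -/

/-- The two components of `Δ₀`. -/
inductive Side
  | eps
  | del

/-- The component of `Δ₀` of type `A_{m-1}`, `B_m`, `D_m` (in the span of the `ε_i`), resp. of
type `A_{n-1}`, `C_n`, `C_n` (in the span of the `δ_j`). -/
def component (T : SuperType) (m n : ℕ) (s : Side) : Set (V m n) :=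
  match s with
  | .eps => {α | α ∈ evenRoots T m n ∧ 0 < form α α}
  | .del => {α | α ∈ evenRoots T m n ∧ form α α < 0}

/-- The component `s` is an admissible choice of the "largest" component `Δ^#`: the one of larger
rank; for equal ranks either one in types `A` and `B`, and `C_n` in type `D`. -/
def IsLargest (T : SuperType) (m n : ℕ) (s : Side) : Prop :=
  match T, s with
  | .A, .eps => n ≤ m
  | .A, .del => m ≤ n
  | .B, .eps => n ≤ m
  | .B, .del => m ≤ n
  | .D, .eps => n < m
  | .D, .del => m ≤ n

/-- The subgroup of `GL(V)` generated by the reflections in the roots of a component. -/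
def weylGroup (T : SuperType) (m n : ℕ) (s : Side) : Subgroup (V m n ≃ₗ[ℝ] V m n) :=
  Subgroup.closure {w | ∃ α ∈ component T m n s,
    ∀ v, w v = v - (2 * form v α / form α α) • α}

/-- `sgn(w)`: the sign of the determinant, so `-1` on each reflection. -/
def sgn {m n : ℕ} (w : V m n ≃ₗ[ℝ] V m n) : ℤ :=
  SignType.sign (LinearMap.det (w : V m n →ₗ[ℝ] V m n))

/-! ### Rational functions in the `e^ν` -/

/-- The field of rational functions in `e^ν`, `ν ∈ V`: the fraction field of the group algebra
`ℚ[e^ν, ν ∈ V]`. -/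
abbrev RatFun (m n : ℕ) : Type := FractionRing (AddMonoidAlgebra ℚ (V m n))

/-- The element `e^ν`. -/
def e {m n : ℕ} (ν : V m n) : RatFun m n :=
  algebraMap (AddMonoidAlgebra ℚ (V m n)) (RatFun m n) (AddMonoidAlgebra.single ν 1)

/-- The automorphism of the field of rational functions that maps `e^ν` to `e^{wν}`. -/
def act {m n : ℕ} (w : V m n ≃ₗ[ℝ] V m n) : RatFun m n ≃+* RatFun m n :=
  IsFractionRing.ringEquivOfRingEquiv
    (AddMonoidAlgebra.domCongr ℚ ℚ w.toAddEquiv).toRingEquiv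

theorem act_e {m n : ℕ} (w : V m n ≃ₗ[ℝ] V m n) (ν : V m n) : act w (e ν) = e (w ν) := by
  simp [act, e]

/-! ### Finiteness of the root system and of the Weyl group -/

theorem pairing_single {m n : ℕ} (α : V m n) (k : Fin m ⊕ Fin n) :
    pairing α (Pi.single k 1) = (α k : ℂ) := by
  simp [pairing, Pi.single_apply]

theorem exists_weights {m n : ℕ} {P : Type} [Fintype P] [DecidableEq P] {wt : P → V m n}
    {L : Submodule ℂ (Matrix P P ℂ)} {α : V m n} (hα : α ∈ rootsOf wt L) :
    ∃ x ∈ L, ∃ p q, x p q ≠ 0 ∧ α = wt p - wt q := by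
  obtain ⟨-, x, hx, hx0, h⟩ := hα
  obtain ⟨p, q, hpq⟩ : ∃ p q, x p q ≠ 0 := by
    by_contra! hc
    exact hx0 (by ext p q; simpa using hc p q)
  refine ⟨x, hx, p, q, hpq, ?_⟩
  funext k
  have h1 := congrFun (congrFun (h (Pi.single k 1)) p) q
  simp only [cartan, Matrix.sub_apply, Matrix.diagonal_mul, Matrix.mul_diagonal,
    Matrix.smul_apply, pairing_single, smul_eq_mul] at h1
  have h2 : ((wt p k - wt q k : ℝ) : ℂ) = (α k : ℂ) :=
    mul_right_cancel₀ hpq (by push_cast; linear_combination h1)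
  simpa using (Complex.ofReal_injective h2).symm

theorem rootsOf_finite {m n : ℕ} {P : Type} [Fintype P] [DecidableEq P] (wt : P → V m n)
    (L : Submodule ℂ (Matrix P P ℂ)) : (rootsOf wt L).Finite := by
  refine (Set.finite_range fun pq : P × P => wt pq.1 - wt pq.2).subset ?_
  intro α hα
  obtain ⟨-, -, p, q, -, h⟩ := exists_weights hα
  exact ⟨(p, q), h.symm⟩

theorem evenRoots_finite (T : SuperType) (m n : ℕ) : (evenRoots T m n).Finite := by
  cases T <;> exact rootsOf_finite _ _

theorem oddRoots_finite (T : SuperType) (m n : ℕ) : (oddRoots T m n).Finite := by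
  cases T <;> exact rootsOf_finite _ _

theorem mem_glEven {I J : Type} {x : Matrix (I ⊕ J) (I ⊕ J) ℂ} (hx : x ∈ glEven I J)
    {p q : I ⊕ J} (h : x p q ≠ 0) : p.isLeft = q.isLeft := by
  rcases p with i | j <;> rcases q with i' | j'
  · rfl
  · exact absurd (hx i j').1 h
  · exact absurd (hx i' j).2 h
  · rfl

/-- `v` is `0` or `± ε_i` (for `b = true`), resp. `0` or `± δ_j` (for `b = false`). -/
def IsUnitLike {m n : ℕ} (b : Bool) (v : V m n) : Prop :=
  v = 0 ∨ ∃ k : Fin m ⊕ Fin n, k.isLeft = b ∧ ∃ a : ℝ, (a = 1 ∨ a = -1) ∧ v = Pi.single k a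

theorem isUnitLike_weightA {m n : ℕ} (p) : IsUnitLike p.isLeft (weightA m n p) := by
  rcases p with i | j
  · exact Or.inr ⟨.inl i, rfl, 1, Or.inl rfl, rfl⟩
  · exact Or.inr ⟨.inr j, rfl, 1, Or.inl rfl, rfl⟩

theorem isUnitLike_weightD {m n : ℕ} (p) : IsUnitLike p.isLeft (weightD m n p) := by
  rcases p with (i | i) | (j | j)
  · exact Or.inr ⟨.inl i, rfl, 1, Or.inl rfl, rfl⟩
  · exact Or.inr ⟨.inl i, rfl, -1, Or.inr rfl, by simp [weightD, eps, Pi.single_neg]⟩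
  · exact Or.inr ⟨.inr j, rfl, 1, Or.inl rfl, rfl⟩
  · exact Or.inr ⟨.inr j, rfl, -1, Or.inr rfl, by simp [weightD, del, Pi.single_neg]⟩

theorem isUnitLike_weightB {m n : ℕ} (p) : IsUnitLike p.isLeft (weightB m n p) := by
  rcases p with (u | i | i) | (j | j)
  · exact Or.inl rfl
  · exact Or.inr ⟨.inl i, rfl, 1, Or.inl rfl, rfl⟩
  · exact Or.inr ⟨.inl i, rfl, -1, Or.inr rfl, by simp [weightB, eps, Pi.single_neg]⟩
  · exact Or.inr ⟨.inr j, rfl, 1, Or.inl rfl, rfl⟩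
  · exact Or.inr ⟨.inr j, rfl, -1, Or.inr rfl, by simp [weightB, del, Pi.single_neg]⟩

theorem evenRoots_eq_sub {T : SuperType} {m n : ℕ} {α : V m n} (hα : α ∈ evenRoots T m n) :
    ∃ b u v, IsUnitLike b u ∧ IsUnitLike b v ∧ α = u - v := by
  cases T
  · obtain ⟨x, hx, p, q, h, rfl⟩ := exists_weights hα
    exact ⟨_, _, _, isUnitLike_weightA p, mem_glEven hx h ▸ isUnitLike_weightA q, rfl⟩
  · obtain ⟨x, hx, p, q, h, rfl⟩ := exists_weights hα
    exact ⟨_, _, _, isUnitLike_weightB p, mem_glEven hx.1 h ▸ isUnitLike_weightB q, rfl⟩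
  · obtain ⟨x, hx, p, q, h, rfl⟩ := exists_weights hα
    exact ⟨_, _, _, isUnitLike_weightD p, mem_glEven hx.1 h ▸ isUnitLike_weightD q, rfl⟩

theorem evenRoots_cases {T : SuperType} {m n : ℕ} {α : V m n} (hα : α ∈ evenRoots T m n) :
    (∃ i a, α = Pi.single i a) ∨ ∃ i j, i ≠ j ∧ i.isLeft = j.isLeft ∧
      ∃ a b : ℝ, (a = 1 ∨ a = -1) ∧ (b = 1 ∨ b = -1) ∧ α = Pi.single i a + Pi.single j b := by
  have h0 : α ≠ 0 := by cases T <;> exact hα.1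
  obtain ⟨c, u, v, hu, hv, rfl⟩ := evenRoots_eq_sub hα
  rcases hu with rfl | ⟨i, hi, a, ha, rfl⟩ <;> rcases hv with rfl | ⟨j, hj, b, hb, rfl⟩
  · simp at h0
  · exact Or.inl ⟨j, -b, by simp [Pi.single_neg]⟩
  · exact Or.inl ⟨i, a, by simp⟩
  · by_cases hij : i = j
    · subst hij
      exact Or.inl ⟨i, a - b, by rw [Pi.single_sub]⟩
    · refine Or.inr ⟨i, j, hij, hi.trans hj.symm, a, -b, ha, ?_, ?_⟩
      · rcases hb with rfl | rfl <;> simp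
      · rw [Pi.single_neg, sub_eq_add_neg]

theorem form_eq_sum {m n : ℕ} (x y : V m n) :
    form x y = ∑ k, (if k.isLeft then 1 else -1) * (x k * y k) := by
  simp [form, Fintype.sum_sum_type, sub_eq_add_neg]

/-- The finite set `{± ε_i, ± δ_j}`. -/
def unitVectors (m n : ℕ) : Set (V m n) := {v | ∃ k, v = Pi.single k 1 ∨ v = -Pi.single k 1}

theorem unitVectors_finite (m n : ℕ) : (unitVectors m n).Finite := by
  refine ((Set.finite_range fun k => (Pi.single k 1 : V m n)).union
    (Set.finite_range fun k => (-Pi.single k 1 : V m n))).subset ?_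
  rintro v ⟨k, rfl | rfl⟩
  · exact Or.inl ⟨k, rfl⟩
  · exact Or.inr ⟨k, rfl⟩

theorem reflection_mapsTo {T : SuperType} {m n : ℕ} {α : V m n} (hα : α ∈ evenRoots T m n)
    (hαα : form α α ≠ 0) (w : V m n ≃ₗ[ℝ] V m n)
    (hw : ∀ v, w v = v - (2 * form v α / form α α) • α) :
    Set.MapsTo w (unitVectors m n) (unitVectors m n) := by
  suffices h : ∀ k, w (Pi.single k 1) ∈ unitVectors m n by
    rintro v ⟨k, rfl | rfl⟩
    · exact h k
    · obtain ⟨l, hl | hl⟩ := h k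
      · exact ⟨l, Or.inr (by rw [map_neg, hl])⟩
      · exact ⟨l, Or.inl (by rw [map_neg, hl, neg_neg])⟩
  intro k
  have hk : form (Pi.single k 1) α = (if k.isLeft then 1 else -1) * α k := by
    rw [form_eq_sum, Finset.sum_eq_single k] <;> simp +contextual
  rw [hw, hk]
  rcases evenRoots_cases hα with ⟨i, a, rfl⟩ | ⟨i, j, hij, hs, a, b, ha, hb, rfl⟩
  · have h1 : form (Pi.single i a : V m n) (Pi.single i a) =
        (if i.isLeft then 1 else -1) * (a * a) := by
      rw [form_eq_sum, Finset.sum_eq_single i] <;> simp +contextual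
    rw [h1] at hαα ⊢
    have ha : a ≠ 0 := by rintro rfl; simp at hαα
    by_cases hki : k = i
    · subst hki
      refine ⟨k, Or.inr ?_⟩
      funext l
      by_cases hl : l = k
      · subst hl
        rcases l with l | l <;> simp <;> field_simp <;> norm_num
      · simp [hl]
    · exact ⟨k, Or.inl (by simp [hki])⟩
  · have h1 : form (Pi.single i a + Pi.single j b : V m n) (Pi.single i a + Pi.single j b) =
        (if i.isLeft then 1 else -1) * (a * a + b * b) := by
      rw [form_eq_sum, Finset.sum_eq_add i j hij]
      · simp only [hs]; split_ifs <;> (simp [hij, hij.symm]; try ring)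
      · rintro c - ⟨h, h'⟩
        simp [h, h']
      · simp
      · simp
    rw [h1]
    by_cases hki : k = i
    · subst hki
      have : (Pi.single k 1 : V m n) - (2 * ((if k.isLeft then 1 else -1) *
          (Pi.single k a + Pi.single j b : V m n) k) /
          ((if k.isLeft then 1 else -1) * (a * a + b * b))) •
          (Pi.single k a + Pi.single j b : V m n) = (-(a * b)) • Pi.single j 1 := by
        funext l
        rcases ha with rfl | rfl <;> rcases hb with rfl | rfl <;>
        by_cases hl : l = k <;> by_cases hl' : l = j <;> cases k <;>
        simp_all <;> norm_num
      rw [this]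
      rcases ha with rfl | rfl <;> rcases hb with rfl | rfl <;> refine ⟨j, ?_⟩ <;> simp
    · by_cases hkj : k = j
      · subst hkj
        have : (Pi.single k 1 : V m n) - (2 * ((if k.isLeft then 1 else -1) *
            (Pi.single i a + Pi.single k b : V m n) k) /
            ((if i.isLeft then 1 else -1) * (a * a + b * b))) •
            (Pi.single i a + Pi.single k b : V m n) = (-(a * b)) • Pi.single i 1 := by
          rw [hs]
          funext l
          rcases ha with rfl | rfl <;> rcases hb with rfl | rfl <;>
          by_cases hl : l = k <;> by_cases hl' : l = i <;> cases k <;>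
          simp_all <;> norm_num
        rw [this]
        rcases ha with rfl | rfl <;> rcases hb with rfl | rfl <;> refine ⟨i, ?_⟩ <;> simp
      · exact ⟨k, Or.inl (by simp [hki, hkj])⟩

theorem weylGroup_mapsTo {T : SuperType} {m n : ℕ} {s : Side} {w : V m n ≃ₗ[ℝ] V m n}
    (hw : w ∈ weylGroup T m n s) : Set.MapsTo w (unitVectors m n) (unitVectors m n) := by
  induction hw using Subgroup.closure_induction with
  | mem w h =>
    obtain ⟨α, hα, h⟩ := h
    cases s
    · exact reflection_mapsTo hα.1 hα.2.ne' w h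
    · exact reflection_mapsTo hα.1 hα.2.ne w h
  | one => exact fun v hv => hv
  | mul x y _ _ hx hy => exact fun v hv => hx (hy hv)
  | inv x _ hx =>
    intro v hv
    have h : x '' unitVectors m n = unitVectors m n :=
      Set.eq_of_subset_of_ncard_le hx.image_subset
        (Set.ncard_image_of_injective _ x.injective).ge (unitVectors_finite m n)
    obtain ⟨u, hu, rfl⟩ := h ▸ hv
    simpa using hu

instance weylGroup_finite (T : SuperType) (m n : ℕ) (s : Side) : Finite (weylGroup T m n s) := by
  have := (unitVectors_finite m n).to_subtype
  refine Finite.of_injective (β := Fin m ⊕ Fin n → unitVectors m n)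
    (fun w k => ⟨w.1 (Pi.single k 1), weylGroup_mapsTo w.2 ⟨k, Or.inl rfl⟩⟩) ?_
  intro w w' h
  apply Subtype.ext
  apply LinearEquiv.toLinearMap_injective
  refine (Pi.basisFun ℝ (Fin m ⊕ Fin n)).ext fun k => ?_
  simpa using congrArg Subtype.val (congrFun h k)

instance weylGroup_fintype (T : SuperType) (m n : ℕ) (s : Side) :
    Fintype (weylGroup T m n s) := Fintype.ofFinite _

/-! ### `ρ` and the Weyl denominator -/

/-- `Δ_{+,0}(f)`. -/
def posEven (T : SuperType) {m n : ℕ} (f : Module.Dual ℝ (V m n)) : Finset (V m n) :=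
  ((evenRoots_finite T m n).subset fun _ h => h.1 : (posEvenSet T f).Finite).toFinset

/-- `Δ_{+,1}(f)`. -/
def posOdd (T : SuperType) {m n : ℕ} (f : Module.Dual ℝ (V m n)) : Finset (V m n) :=
  ((oddRoots_finite T m n).subset fun _ h => h.1 : (posOddSet T f).Finite).toFinset

/-- `ρ = ρ₀ - ρ₁`. -/
def rho (T : SuperType) {m n : ℕ} (f : Module.Dual ℝ (V m n)) : V m n :=
  (2⁻¹ : ℝ) • ∑ α ∈ posEven T f, α - (2⁻¹ : ℝ) • ∑ α ∈ posOdd T f, α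

/-- The Weyl denominator `R`. -/
def weylDenominator (T : SuperType) {m n : ℕ} (f : Module.Dual ℝ (V m n)) : RatFun m n :=
  (∏ α ∈ posEven T f, (1 - e (-α))) / ∏ α ∈ posOdd T f, (1 + e (-α))

end

end WeylDenominator

open WeylDenominator

namespace WeylDenominator

open Matrix Polynomial

/-! ### Determinants of Cauchy–Vandermonde type -/

section Determinants

variable {K : Type*} [Field K]

/-- The product of the differences `z j - z i` over the pairs with `h i < h j`. -/
noncomputable def orderedDiff {ι R : Type*} [Fintype ι] [CommRing R] (h : ι → ℝ) (z : ι → R) : R :=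
  ∏ i, ∏ j, if h i < h j then z j - z i else 1

/-- The number of indices whose value under `h` is below `t`. -/
noncomputable def below {ι : Type*} [Fintype ι] (h : ι → ℝ) (t : ℝ) : ℕ :=
  (Finset.univ.filter fun j => h j < t).card

theorem exists_orderEquiv {ι : Type*} [Fintype ι] (h : ι → ℝ) (hh : Function.Injective h) :
    ∃ ε : ι ≃ Fin (Fintype.card ι), ∀ i j, ε i < ε j ↔ h i < h j := by
  classical
  have hc : (Finset.univ.image h).card = Fintype.card ι := by
    rw [Finset.card_image_of_injective _ hh, Finset.card_univ]
  let o := (Finset.univ.image h).orderIsoOfFin hc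
  let g : ι ≃ (Finset.univ.image h) := Equiv.ofBijective
    (fun i => ⟨h i, Finset.mem_image_of_mem _ (Finset.mem_univ i)⟩)
    ⟨fun i j hij => hh (congrArg Subtype.val hij), by
      rintro ⟨t, ht⟩
      obtain ⟨i, -, rfl⟩ := Finset.mem_image.1 ht
      exact ⟨i, rfl⟩⟩
  refine ⟨g.trans o.symm.toEquiv, fun i j => ?_⟩
  change o.symm (g i) < o.symm (g j) ↔ _
  rw [o.symm.lt_iff_lt]
  rfl

theorem below_orderEquiv {ι : Type*} [Fintype ι] {h : ι → ℝ}
    {ε : ι ≃ Fin (Fintype.card ι)} (hε : ∀ i j, ε i < ε j ↔ h i < h j) (i : ι) :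
    below h (h i) = ε i := by
  rw [below, ← Fin.card_Iio (ε i)]
  refine Finset.card_bij (fun j _ => ε j) ?_ (fun _ _ _ _ => fun h => ε.injective h) ?_
  · intro j hj
    simpa [hε] using hj
  · intro j hj
    exact ⟨ε.symm j, by simpa [← hε] using hj, by simp⟩

theorem orderedDiff_eq_vandermonde {ι : Type*} [Fintype ι] {h : ι → ℝ}
    {ε : ι ≃ Fin (Fintype.card ι)} (hε : ∀ i j, ε i < ε j ↔ h i < h j) (z : ι → K) :
    orderedDiff h z = (vandermonde (z ∘ ε.symm)).det := by
  rw [det_vandermonde, orderedDiff, ← ε.symm.prod_comp]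
  refine Finset.prod_congr rfl fun i _ => ?_
  rw [← ε.symm.prod_comp, Finset.prod_ite, Finset.prod_const_one, mul_one]
  refine Finset.prod_congr ?_ fun _ _ => rfl
  ext j
  simp [← hε]

/-- The determinant of the values of polynomials of small degree is a multiple of the
Vandermonde determinant. -/
theorem det_eval_eq {ι : Type*} [Fintype ι] [DecidableEq ι] {h : ι → ℝ}
    {ε : ι ≃ Fin (Fintype.card ι)} (hε : ∀ i j, ε i < ε j ↔ h i < h j)
    (q : ι → K[X]) (hq : ∀ i, (q i).natDegree < Fintype.card ι) (z : ι → K) :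
    (of fun i j => (q i).eval (z j)).det =
      (of fun i j => (q i).coeff (ε j)).det * orderedDiff h z := by
  rw [orderedDiff_eq_vandermonde hε, ← det_transpose (vandermonde _),
    ← det_submatrix_equiv_self ε (vandermonde _)ᵀ, ← det_mul]
  congr 1
  ext i j
  rw [mul_apply, of_apply, eval_eq_sum_range' (hq i), Finset.sum_range, ← ε.sum_comp]
  simp [vandermonde_apply]

theorem orderedDiff_ne_zero {ι : Type*} [Fintype ι] (h : ι → ℝ) {z : ι → K}
    (hz : Function.Injective z) : orderedDiff h z ≠ 0 := by
  refine Finset.prod_ne_zero_iff.2 fun i _ => Finset.prod_ne_zero_iff.2 fun j _ => ?_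
  split_ifs with hij
  · exact sub_ne_zero.2 fun he => hij.ne (by rw [hz he])
  · exact one_ne_zero

/-- The determinant of the values of polynomials whose degrees are the ranks of their indices. -/
theorem det_eval_triangular {ι : Type*} [Fintype ι] [DecidableEq ι] {h : ι → ℝ}
    (hh : Function.Injective h) (q : ι → K[X]) (hq : ∀ i, (q i).natDegree ≤ below h (h i))
    (z : ι → K) :
    (of fun i j => (q i).eval (z j)).det =
      (∏ i, (q i).coeff (below h (h i))) * orderedDiff h z := by
  obtain ⟨ε, hε⟩ := exists_orderEquiv h hh
  rw [det_eval_eq hε q fun i => (hq i).trans_lt (by rw [below_orderEquiv hε]; exact (ε i).2)]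
  congr 1
  rw [← det_submatrix_equiv_self ε.symm, det_of_isLowerTriangular, ← ε.symm.prod_comp]
  · refine Finset.prod_congr rfl fun i _ => ?_
    simp [below_orderEquiv hε]
  · intro i j hij
    rw [submatrix_apply, of_apply]
    refine coeff_eq_zero_of_natDegree_lt ((hq _).trans_lt ?_)
    rw [below_orderEquiv hε]
    simpa using hij

variable {κ μ : Type*} [Fintype κ] [Fintype μ]

theorem orderedDiff_sum (h : κ ⊕ μ → ℝ) (hh : Function.Injective h) (u : κ → K) (t : μ → K) :
    orderedDiff h (Sum.elim (fun b => -u b) t) =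
      orderedDiff (fun b => -h (.inl b)) u * orderedDiff (fun j => h (.inr j)) t *
      (∏ b, (-1) ^ below (fun j => h (.inr j)) (h (.inl b))) * ∏ b, ∏ j, (t j + u b) := by
  have h1 : ∀ b j, ((if h (.inl b) < h (.inr j) then t j + u b else 1) *
      (if h (.inr j) < h (.inl b) then -u b - t j else 1)) =
      (if h (.inr j) < h (.inl b) then -1 else 1) * (t j + u b) := by
    intro b j
    have : h (.inl b) ≠ h (.inr j) := fun he => Sum.inl_ne_inr (hh he)
    rcases this.lt_or_gt with hlt | hlt
    · simp [hlt, hlt.not_gt]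
    · simp only [hlt.not_gt, hlt, if_true, if_false]; ring
  have h2 : ∀ b, (∏ j, if h (.inr j) < h (.inl b) then (-1 : K) else 1) =
      (-1) ^ below (fun j => h (.inr j)) (h (.inl b)) := by
    intro b
    rw [Finset.prod_ite, Finset.prod_const_one, mul_one, Finset.prod_const, below]
  simp only [orderedDiff, Fintype.prod_sum_type, Sum.elim_inl, Sum.elim_inr,
    Finset.prod_mul_distrib]
  have h3 : (∏ b, ∏ j, if h (.inl b) < h (.inr j) then t j - -u b else 1) *
      (∏ j, ∏ b, if h (.inr j) < h (.inl b) then -u b - t j else 1) =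
      (∏ b, (-1) ^ below (fun j => h (.inr j)) (h (.inl b))) * ∏ b, ∏ j, (t j + u b) := by
    rw [Finset.prod_comm (s := (Finset.univ : Finset μ))]
    simp only [sub_neg_eq_add, ← Finset.prod_mul_distrib, h1, ← h2]
  have h4 : (∏ b, ∏ b', if h (.inl b) < h (.inl b') then -u b' - -u b else 1) =
      ∏ b, ∏ b', if -h (.inl b) < -h (.inl b') then u b' - u b else 1 := by
    rw [Finset.prod_comm]
    refine Finset.prod_congr rfl fun b _ => Finset.prod_congr rfl fun b' _ => ?_
    simp only [neg_lt_neg_iff]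
    congr 1
    ring
  rw [h4]
  linear_combination (∏ b, ∏ b', if -h (.inl b) < -h (.inl b') then u b' - u b else 1) *
    (∏ j, ∏ j', if h (.inr j) < h (.inr j') then t j' - t j else 1) * h3

theorem prod_erase_sub [DecidableEq κ] (h : κ → ℝ) (hh : Function.Injective h) (u : κ → K) :
    ∏ b, ∏ c ∈ Finset.univ.erase b, (u c - u b) =
      orderedDiff h u * orderedDiff (fun b => -h b) u := by
  have : ∀ b, ∏ c ∈ Finset.univ.erase b, (u c - u b) = (∏ c, if h b < h c then u c - u b else 1) *
      ∏ c, if -h b < -h c then u c - u b else 1 := by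
    intro b
    rw [← Finset.mul_prod_erase _ _ (Finset.mem_univ b),
      ← Finset.mul_prod_erase _ (fun c => if -h b < -h c then _ else _) (Finset.mem_univ b)]
    simp only [lt_irrefl, if_false, one_mul, ← Finset.prod_mul_distrib]
    refine Finset.prod_congr rfl fun c hc => ?_
    have : h b ≠ h c := fun he => (Finset.ne_of_mem_erase hc) (hh he).symm
    rcases this.lt_or_gt with hlt | hlt <;> simp [hlt, hlt.not_gt]
  simp only [this, Finset.prod_mul_distrib, orderedDiff]

/-- The Cauchy–Vandermonde determinant. -/
theorem det_cauchy_vandermonde [DecidableEq κ] [DecidableEq μ] (h : κ ⊕ μ → ℝ)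
    (hh : Function.Injective h)
    (z : κ ⊕ μ → K) (hz : Function.Injective z) (u : κ → K) (hu : Function.Injective u)
    (hzu : ∀ i b, z i + u b ≠ 0)
    (p : κ → K[X]) (hp : ∀ b, (p b).natDegree ≤ Fintype.card μ)
    (q : μ → K[X]) (hq : ∀ j, (q j).natDegree ≤ below (fun j => h (.inr j)) (h (.inr j))) :
    (of fun i c => Sum.elim (fun b => (p b).eval (z c) / (z c + u b))
      (fun j => (q j).eval (z c)) i).det =
    orderedDiff h z * orderedDiff (fun b => h (.inl b)) u *
      (∏ b, (-1) ^ below (fun j => h (.inr j)) (h (.inl b)) * (p b).eval (-u b)) *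
      (∏ j, (q j).coeff (below (fun j => h (.inr j)) (h (.inr j)))) /
      ∏ c, ∏ b, (z c + u b) := by
  obtain ⟨ε, hε⟩ := exists_orderEquiv h hh
  have hinl : Function.Injective fun b => h (.inl b) := hh.comp Sum.inl_injective
  have hinr : Function.Injective fun b => h (.inr b) := hh.comp Sum.inr_injective
  have hcard : Fintype.card (κ ⊕ μ) = Fintype.card κ + Fintype.card μ := Fintype.card_sum
  let Q : κ ⊕ μ → K[X] := Sum.elim
    (fun b => p b * ∏ c ∈ Finset.univ.erase b, (X + C (u c))) (fun j => q j * ∏ c, (X + C (u c)))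
  have hdeg : ∀ s : Finset κ, (∏ c ∈ s, (X + C (u c))).natDegree = s.card := by
    intro s
    rw [natDegree_prod_of_monic _ _ fun c _ => monic_X_add_C _]
    simp
  have hQ : ∀ i, (Q i).natDegree < Fintype.card (κ ⊕ μ) := by
    rintro (b | j)
    · refine natDegree_mul_le.trans_lt ?_
      rw [hdeg, Finset.card_erase_of_mem (Finset.mem_univ b), Finset.card_univ]
      have := hp b
      have : 0 < Fintype.card κ := Fintype.card_pos_iff.2 ⟨b⟩
      omega
    · refine natDegree_mul_le.trans_lt ?_
      rw [hdeg, Finset.card_univ]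
      have h1 := hq j
      obtain ⟨ε', hε'⟩ := exists_orderEquiv _ hinr
      rw [below_orderEquiv hε'] at h1
      have := (ε' j).2
      omega
  have hden : ∀ c, ∏ b, (z c + u b) ≠ 0 := fun c => Finset.prod_ne_zero_iff.2 fun b _ => hzu c b
  have hclear : (of fun i c => (Q i).eval (z c)).det = (∏ c, ∏ b, (z c + u b)) *
      (of fun i c => Sum.elim (fun b => (p b).eval (z c) / (z c + u b))
        (fun j => (q j).eval (z c)) i).det := by
    rw [← det_mul_row]
    congr 1
    ext i c
    rcases i with b | j
    · simp only [of_apply, Q, Sum.elim_inl, eval_mul, eval_prod, eval_add, eval_X, eval_C]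
      rw [← Finset.mul_prod_erase _ _ (Finset.mem_univ b)]
      field_simp [hzu c b]
    · simp only [of_apply, Q, Sum.elim_inr, eval_mul, eval_prod, eval_add, eval_X, eval_C]
      ring
  let w : κ ⊕ μ → K := Sum.elim (fun b => -u b) fun j => z (.inr j)
  have hblock : (of fun i c => (Q i).eval (w c)).det =
      (∏ b, (p b).eval (-u b) * ∏ c ∈ Finset.univ.erase b, (u c - u b)) *
      ((∏ j, ∏ b, (z (.inr j) + u b)) *
      ((∏ j, (q j).coeff (below (fun j => h (.inr j)) (h (.inr j)))) *
        orderedDiff (fun j => h (.inr j)) fun j => z (.inr j))) := by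
    rw [← det_eval_triangular hinr q hq, ← det_mul_row, ← det_diagonal]
    rw [show (of fun i c => (Q i).eval (w c)) = fromBlocks
      (diagonal fun b => (p b).eval (-u b) * ∏ c ∈ Finset.univ.erase b, (u c - u b))
      (of fun b j => (Q (.inl b)).eval (z (.inr j))) 0
      (of fun i j => (∏ b, (z (.inr j) + u b)) *
        (of fun i j => (q i).eval (z (.inr j)) : Matrix μ μ K) i j) from ?_,
      det_fromBlocks_zero₂₁]
    ext i c
    rcases i with b | j <;> rcases c with c | c
    · by_cases hbc : b = c
      · subst hbc
        simp [Q, w, eval_prod, neg_add_eq_sub]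
      · simp only [of_apply, Q, Sum.elim_inl, w, fromBlocks_apply₁₁, diagonal_apply_ne _ hbc]
        rw [eval_mul, eval_prod, Finset.prod_eq_zero (i := c) (by simp [Ne.symm hbc]) (by simp),
          mul_zero]
    · simp [w]
    · simp only [of_apply, Q, Sum.elim_inr, Sum.elim_inl, w, fromBlocks_apply₂₁]
      rw [eval_mul, eval_prod, Finset.prod_eq_zero (i := c) (by simp) (by simp), mul_zero]
      rfl
    · simp [Q, w, eval_prod, mul_comm]
  have hw : orderedDiff h w ≠ 0 := by
    rw [orderedDiff_sum h hh]
    refine mul_ne_zero (mul_ne_zero (mul_ne_zero (orderedDiff_ne_zero _ hu)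
      (orderedDiff_ne_zero _ (hz.comp Sum.inr_injective))) ?_) ?_
    · exact Finset.prod_ne_zero_iff.2 fun b _ => pow_ne_zero _ (neg_ne_zero.2 one_ne_zero)
    · exact Finset.prod_ne_zero_iff.2 fun b _ => Finset.prod_ne_zero_iff.2 fun j _ => hzu _ _
  have hcompare : (of fun i c => (Q i).eval (z c)).det * orderedDiff h w =
      (of fun i c => (Q i).eval (w c)).det * orderedDiff h z := by
    rw [det_eval_eq hε Q hQ, det_eval_eq hε Q hQ]
    ring
  rw [eq_div_iff (Finset.prod_ne_zero_iff.2 fun c _ => hden c), mul_comm, ← hclear]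
  refine mul_right_cancel₀ hw (hcompare.trans ?_)
  rw [hblock, orderedDiff_sum h hh, Finset.prod_mul_distrib, prod_erase_sub _ hinl,
    Finset.prod_mul_distrib, Finset.prod_comm (s := (Finset.univ : Finset κ))]
  have hsq : (∏ b, (-1 : K) ^ below (fun j => h (.inr j)) (h (.inl b))) *
      (∏ b, (-1) ^ below (fun j => h (.inr j)) (h (.inl b))) = 1 := by
    rw [← Finset.prod_mul_distrib]
    refine Finset.prod_eq_one fun b _ => ?_
    rw [← mul_pow]
    simp
  linear_combination (-(orderedDiff h z * orderedDiff (fun b => h (.inl b)) u *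
    (∏ b, (p b).eval (-u b)) * (∏ j, (q j).coeff (below (fun j => h (.inr j)) (h (.inr j)))) *
    orderedDiff (fun b => -h (.inl b)) u * (orderedDiff (fun j => h (.inr j)) fun j => z (.inr j)) *
    ∏ j, ∏ b, (z (.inr j) + u b))) * hsq

end Determinants

/-! ### The exponentials `e ν` -/

section Exponentials

variable {m n : ℕ}

theorem e_zero : e (0 : V m n) = 1 := by
  rw [e, ← AddMonoidAlgebra.one_def, map_one]

theorem e_add (a b : V m n) : e (a + b) = e a * e b := by
  rw [e, e, e, ← map_mul, AddMonoidAlgebra.single_mul_single, mul_one]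

theorem e_mul_neg (a : V m n) : e a * e (-a) = 1 := by
  rw [← e_add, add_neg_cancel, e_zero]

theorem e_ne_zero (a : V m n) : e a ≠ 0 := left_ne_zero_of_mul_eq_one (e_mul_neg a)

theorem e_neg (a : V m n) : e (-a) = (e a)⁻¹ := eq_inv_of_mul_eq_one_right (e_mul_neg a)

theorem e_sub (a b : V m n) : e (a - b) = e a / e b := by
  rw [sub_eq_add_neg, e_add, e_neg, div_eq_mul_inv]

theorem e_natCast_smul (k : ℕ) (v : V m n) : e ((k : ℝ) • v) = e v ^ k := by
  induction k with
  | zero => simp [e_zero]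
  | succ k ih => rw [Nat.cast_succ, add_smul, one_smul, e_add, ih, pow_succ]

theorem e_sum {ι : Type*} (s : Finset ι) (v : ι → V m n) : e (∑ i ∈ s, v i) = ∏ i ∈ s, e (v i) := by
  classical
  induction s using Finset.induction_on with
  | empty => simp [e_zero]
  | insert a s ha ih => rw [Finset.sum_insert ha, Finset.prod_insert ha, e_add, ih]

theorem e_half_mul_self (v : V m n) : e ((2⁻¹ : ℝ) • v) * e ((2⁻¹ : ℝ) • v) = e v := by
  rw [← e_add, ← add_smul]
  norm_num

theorem e_injective : Function.Injective (e : V m n → RatFun m n) := by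
  intro a b h
  exact AddMonoidAlgebra.of_injective (R := ℚ)
    (IsFractionRing.injective (AddMonoidAlgebra ℚ (V m n)) (RatFun m n) h)

theorem e_add_e_ne_zero (a b : V m n) : e a + e b ≠ 0 := by
  intro h
  rw [e, e, ← map_add, ← map_zero (algebraMap (AddMonoidAlgebra ℚ (V m n)) (RatFun m n))] at h
  have h1 := IsFractionRing.injective (AddMonoidAlgebra ℚ (V m n)) (RatFun m n) h
  have h2 := congrArg (fun p : AddMonoidAlgebra ℚ (V m n) => p.coeff a) h1
  by_cases hab : b = a
  · subst hab
    simp at h2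
  · simp [hab] at h2

theorem one_add_e_ne_zero (a : V m n) : 1 + e a ≠ 0 := by
  rw [← e_zero]
  exact e_add_e_ne_zero 0 a

/-- `e^v + e^{-v}`. -/
noncomputable def ecosh (v : V m n) : RatFun m n := e v + e (-v)

theorem ecosh_sub (v w : V m n) : ecosh v - ecosh w =
    (e ((2⁻¹ : ℝ) • (v - w)) - e (-((2⁻¹ : ℝ) • (v - w)))) *
      (e ((2⁻¹ : ℝ) • (v + w)) - e (-((2⁻¹ : ℝ) • (v + w)))) := by
  rw [ecosh, ecosh, smul_sub, smul_add, neg_add, neg_sub, e_sub, e_sub, e_add, e_add, e_neg v,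
    e_neg w, e_neg, e_neg, ← e_half_mul_self v, ← e_half_mul_self w]
  field_simp [e_ne_zero]
  ring

theorem ecosh_add (v w : V m n) : ecosh v + ecosh w =
    (e ((2⁻¹ : ℝ) • (v - w)) + e (-((2⁻¹ : ℝ) • (v - w)))) *
      (e ((2⁻¹ : ℝ) • (v + w)) + e (-((2⁻¹ : ℝ) • (v + w)))) := by
  rw [ecosh, ecosh, smul_sub, smul_add, neg_add, neg_sub, e_sub, e_sub, e_add, e_add, e_neg v,
    e_neg w, e_neg, e_neg, ← e_half_mul_self v, ← e_half_mul_self w]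
  field_simp [e_ne_zero]
  ring

theorem ecosh_add_ne_zero (v w : V m n) : ecosh v + ecosh w ≠ 0 := by
  rw [ecosh_add]
  exact mul_ne_zero (e_add_e_ne_zero _ _) (e_add_e_ne_zero _ _)

theorem e_half_sub_ne_zero {v : V m n} (hv : v ≠ 0) :
    e ((2⁻¹ : ℝ) • v) - e (-((2⁻¹ : ℝ) • v)) ≠ 0 := by
  refine sub_ne_zero.2 fun h => hv ?_
  have := e_injective h
  have h2 : v = (2⁻¹ : ℝ) • v + (2⁻¹ : ℝ) • v := by rw [← add_smul]; norm_num
  rw [h2]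
  nth_rw 2 [this]
  simp

theorem ecosh_inj {v w : V m n} (h : ecosh v = ecosh w) : v = w ∨ v = -w := by
  by_contra! hc
  refine mul_ne_zero (e_half_sub_ne_zero (sub_ne_zero.2 hc.1))
    (e_half_sub_ne_zero (v := v + w) fun h' => hc.2 (eq_neg_of_add_eq_zero_left h')) ?_
  rw [← ecosh_sub, h, sub_self]

end Exponentials

/-! ### Antisymmetrization of products of functions of one letter -/

section Antisymmetrization

variable {m n : ℕ} {κ μ : Type*} [Fintype κ] [Fintype μ] [DecidableEq κ] [DecidableEq μ]

/-- The exponent of the letter `i`: the number of unmatched letters below it, shifted by `s`. -/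
noncomputable def exponent (h : κ ⊕ μ → ℝ) (s : ℝ) (i : κ ⊕ μ) : ℝ :=
  below (fun j => h (.inr j)) (h i) + s

/-- The factor that belongs to the letter `i` as a function of this letter; the letter `inl b` is
matched with `y b`, the letter `inr j` is not matched. -/
noncomputable def letterFactor (h : κ ⊕ μ → ℝ) (s : ℝ) (y : κ → V m n) (i : κ ⊕ μ) (v : V m n) :
    RatFun m n :=
  Sum.elim (fun b => e (exponent h s i • (v - y b)) / (1 + e (v - y b)))
    (fun _ => e (exponent h s i • v)) i

theorem below_le_card {ι : Type*} [Fintype ι] (h : ι → ℝ) (t : ℝ) : below h t ≤ Fintype.card ι :=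
  Finset.card_le_univ _

theorem sum_perm_letterFactor (h : κ ⊕ μ → ℝ) (hh : Function.Injective h) (s : ℝ)
    (x : κ ⊕ μ → V m n) (hx : Function.Injective x) (y : κ → V m n) (hy : Function.Injective y) :
    ∑ σ : Equiv.Perm (κ ⊕ μ), ((Equiv.Perm.sign σ : ℤ) : RatFun m n) *
        ∏ i, letterFactor h s y i (x (σ i)) =
      (∏ i, e (s • x i)) * (∏ b, e ((1 - s) • y b)) *
        (orderedDiff h (fun i => e (x i)) * orderedDiff (fun b => h (.inl b)) (fun b => e (y b)) /
          ∏ i, ∏ b, (e (x i) + e (y b))) := by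
  let k : κ ⊕ μ → ℕ := fun i => below (fun j => h (.inr j)) (h i)
  have hdet := det_cauchy_vandermonde h hh (fun i => e (x i)) (e_injective.comp hx)
    (fun b => e (y b)) (e_injective.comp hy) (fun i b => e_add_e_ne_zero _ _)
    (fun b => X ^ k (.inl b)) (fun b => by simpa using below_le_card _ _)
    (fun j => X ^ k (.inr j)) (fun j => by simp [k])
  have hsum : ∑ σ : Equiv.Perm (κ ⊕ μ), ((Equiv.Perm.sign σ : ℤ) : RatFun m n) *
      ∏ i, letterFactor h s y i (x (σ i)) =
      (of fun i c => letterFactor h s y i (x c)).det := by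
    rw [← det_transpose, det_apply']
    rfl
  have hrow : (of fun i c => letterFactor h s y i (x c)) = of fun i c => e (s • x c) *
      (of fun i c => Sum.elim (fun b => e ((1 - s - k (.inl b)) • y b)) (fun _ => 1) i *
        (of fun i c => Sum.elim
          (fun b => ((X : (RatFun m n)[X]) ^ k (.inl b)).eval (e (x c)) / (e (x c) + e (y b)))
          (fun j => ((X : (RatFun m n)[X]) ^ k (.inr j)).eval (e (x c))) i : Matrix _ _ _) i c :
          Matrix (κ ⊕ μ) (κ ⊕ μ) (RatFun m n)) i c := by
    ext i c
    rcases i with b | j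
    · simp only [of_apply, Sum.elim_inl, letterFactor, exponent, eval_pow, eval_X]
      have h1 := e_add_e_ne_zero (x c) (y b)
      have h2 : e (((k (.inl b) : ℝ) + s) • (x c - y b)) =
          e (s • x c) * e ((1 - s - k (.inl b)) • y b) * e (x c) ^ k (.inl b) / e (y b) := by
        rw [← e_natCast_smul, ← e_add, ← e_add, ← e_sub]
        congr 1
        module
      change e (((k (.inl b) : ℝ) + s) • (x c - y b)) / _ = _
      rw [h2, e_sub]
      have h3 : 1 + e (x c) / e (y b) ≠ 0 := by
        rw [← e_sub]
        exact one_add_e_ne_zero _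
      have h4 : e (y b) + e (x c) ≠ 0 := e_add_e_ne_zero _ _
      field_simp [e_ne_zero]
      ring
    · simp only [of_apply, Sum.elim_inr, letterFactor, exponent, eval_pow, eval_X, one_mul]
      rw [← e_natCast_smul, ← e_add, ← add_smul, add_comm]
  rw [hsum, hrow, det_mul_row, det_mul_column, hdet, Fintype.prod_sum_type
    (f := Sum.elim (fun b => e ((1 - s - k (.inl b)) • y b)) fun _ => 1)]
  have h5 : ∏ b, e ((1 - s) • y b) = (∏ b, e ((1 - s - k (.inl b)) • y b)) *
      ∏ b, ((-1) ^ k (.inl b) * ((X : (RatFun m n)[X]) ^ k (.inl b)).eval (-e (y b))) := by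
    rw [← Finset.prod_mul_distrib]
    refine Finset.prod_congr rfl fun b _ => ?_
    rw [eval_pow, eval_X, ← mul_pow, neg_one_mul, neg_neg, ← e_natCast_smul, ← e_add, ← add_smul]
    congr 2
    ring
  rw [h5]
  simp only [Sum.elim_inl, Sum.elim_inr, Finset.prod_const_one, coeff_X_pow, mul_one, k, if_true]
  ring

/-- Polynomials in `e^v + e^{-v}` that satisfy the recursion of the Chebyshev polynomials. -/
noncomputable def chebyshevLike {R : Type*} [CommRing R] (a b : R[X]) : ℕ → R[X]
  | 0 => b
  | 1 => a
  | k + 2 => X * chebyshevLike a b (k + 1) - chebyshevLike a b k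

theorem natDegree_chebyshevLike {R : Type*} [CommRing R] (a : R) (b : R[X]) (hb : b.natDegree ≤ 1)
    (k : ℕ) : (chebyshevLike (C a) b (k + 1)).natDegree ≤ k := by
  have hX : ∀ p : R[X], (X * p).natDegree ≤ p.natDegree + 1 := fun p => by
    refine natDegree_mul_le.trans ?_
    have := natDegree_X_le (R := R)
    omega
  have hsub := fun p q : R[X] => natDegree_sub_le p q
  induction k using Nat.strong_induction_on with
  | _ k ih =>
    match k with
    | 0 => simp [chebyshevLike]
    | 1 =>
      refine (hsub _ _).trans (max_le ((hX _).trans ?_) hb)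
      simp [chebyshevLike]
    | k + 2 =>
      refine (hsub _ _).trans (max_le ((hX _).trans ?_) ?_)
      · have := ih (k + 1) (by omega)
        omega
      · have := ih k (by omega)
        omega

theorem eval_neg_chebyshevLike {F : Type*} [Field F] (a b : F[X]) {t : F} (ht : t ≠ 0) (k : ℕ) :
    t * (chebyshevLike a b (k + 1)).eval (-(t + t⁻¹)) + (chebyshevLike a b k).eval (-(t + t⁻¹)) =
      (-t) ^ k * (t * a.eval (-(t + t⁻¹)) + b.eval (-(t + t⁻¹))) := by
  induction k with
  | zero => simp [chebyshevLike]
  | succ k ih =>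
    rw [pow_succ', mul_assoc, ← ih, chebyshevLike]
    simp only [eval_sub, eval_mul, eval_X]
    field_simp
    ring

theorem eval_ecosh_chebyshevLike (a b : (RatFun m n)[X]) (s : ℝ) (c : RatFun m n) (v : V m n)
    (τ : RatFun m n) (ha : e (s • v) + c * e (-(s • v)) = τ * a.eval (ecosh v))
    (hb : e ((s - 1) • v) + c * e (-((s - 1) • v)) = τ * b.eval (ecosh v)) (k : ℕ) :
    e ((k + s - 1) • v) + c * e (-((k + s - 1) • v)) =
        τ * (chebyshevLike a b k).eval (ecosh v) ∧
      e ((k + s) • v) + c * e (-((k + s) • v)) =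
        τ * (chebyshevLike a b (k + 1)).eval (ecosh v) := by
  induction k with
  | zero => simpa [chebyshevLike] using ⟨hb, ha⟩
  | succ k ih =>
    obtain ⟨h1, h2⟩ := ih
    rw [show ((k + 1 : ℕ) : ℝ) + s - 1 = k + s by push_cast; ring]
    refine ⟨h2, ?_⟩
    rw [chebyshevLike, eval_sub, eval_mul, eval_X, mul_sub, mul_left_comm, ← h1, ← h2,
      show (((k + 1 : ℕ) : ℝ) + s) • v = (k + s) • v + v by push_cast; module,
      show ((k : ℝ) + s - 1) • v = (k + s) • v - v by module]
    simp only [ecosh, e_neg, e_add, e_sub]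
    field_simp [e_ne_zero]
    ring

theorem matched_identity {F : Type*} [Field F] {x y p q : F} (hx : x ≠ 0) (hy : y ≠ 0) (hp : p ≠ 0)
    (hq : q ≠ 0) (hxy : x + y ≠ 0) (hxy' : x * y + 1 ≠ 0) (c : F) :
    p / q / (1 + x / y) + c * (p⁻¹ / q / (1 + x⁻¹ / y)) =
      q⁻¹ * (y * (p + c * p⁻¹) + (p / x + c * (x / p))) / (x + x⁻¹ + (y + y⁻¹)) := by
  have h1 : x + x⁻¹ + (y + y⁻¹) = (x + y) * (x * y + 1) / (x * y) := by field_simp; ring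
  have h2 : 1 + x / y = (x + y) / y := by field_simp; ring
  have h3 : 1 + x⁻¹ / y = (x * y + 1) / (x * y) := by field_simp
  rw [h1, h2, h3]
  field_simp
  ring

theorem sum_intUnits {M : Type*} [AddCommMonoid M] (F : ℤˣ → M) : ∑ η, F η = F 1 + F (-1) := by
  rw [show (Finset.univ : Finset ℤˣ) = {1, -1} from rfl, Finset.sum_pair (by decide)]

/-- The sum over all sign changes and permutations of the letters `x i`; a sign change of one
letter contributes the factor `c`. -/
theorem sum_signedPerm_letterFactor (h : κ ⊕ μ → ℝ) (hh : Function.Injective h) (s : ℝ)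
    (x : κ ⊕ μ → V m n) (hx : Function.Injective x) (hx' : ∀ i j, i ≠ j → x i ≠ -x j)
    (y : κ → V m n) (hy : Function.Injective y) (hy' : ∀ i j, i ≠ j → y i ≠ -y j)
    (c : RatFun m n) (a : RatFun m n) (b : (RatFun m n)[X]) (hb : b.natDegree ≤ 1)
    (hbμ : b.natDegree ≤ Fintype.card μ)
    (τ : V m n → RatFun m n)
    (hτ : ∀ v, e (s • v) + c * e (-(s • v)) = τ v * a)
    (hτ' : ∀ v, e ((s - 1) • v) + c * e (-((s - 1) • v)) = τ v * b.eval (ecosh v)) :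
    ∑ σ : Equiv.Perm (κ ⊕ μ), ((Equiv.Perm.sign σ : ℤ) : RatFun m n) *
        ∑ η : κ ⊕ μ → ℤˣ, ∏ i, (if η i = 1 then 1 else c) *
          letterFactor h s y i (((η i : ℤ) : ℝ) • x (σ i)) =
      (∏ i, τ (x i)) * (∏ l, e (-(s • y l)) * (e (y l) * a + b.eval (-ecosh (y l)))) *
        (∏ j : μ, (chebyshevLike (C a) b
          (below (fun j => h (.inr j)) (h (.inr j)) + 1)).coeff
            (below (fun j => h (.inr j)) (h (.inr j)))) *
        (orderedDiff h (fun i => ecosh (x i)) *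
          orderedDiff (fun l => h (.inl l)) (fun l => ecosh (y l)) /
          ∏ i, ∏ l, (ecosh (x i) + ecosh (y l))) := by
  let k : κ ⊕ μ → ℕ := fun i => below (fun j => h (.inr j)) (h i)
  let Q : ℕ → (RatFun m n)[X] := chebyshevLike (C a) b
  have hQ : ∀ k, (Q (k + 1)).natDegree ≤ k := natDegree_chebyshevLike a b hb
  have hdet := det_cauchy_vandermonde h hh (fun i => ecosh (x i))
    (fun i j hij => by
      by_contra hne
      rcases ecosh_inj hij with h' | h'
      · exact hne (hx h')
      · exact hx' i j hne h')
    (fun l => ecosh (y l))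
    (fun i j hij => by
      by_contra hne
      rcases ecosh_inj hij with h' | h'
      · exact hne (hy h')
      · exact hy' i j hne h')
    (fun i l => ecosh_add_ne_zero _ _)
    (fun l => C (e (y l)) * Q (k (.inl l) + 1) + Q (k (.inl l)))
    (fun l => by
      have hk : k (.inl l) ≤ Fintype.card μ := below_le_card _ _
      refine (natDegree_add_le _ _).trans (max_le ((natDegree_C_mul_le _ _).trans
        ((hQ _).trans hk)) ?_)
      rcases hk' : k (.inl l) with _ | k'
      · exact hbμ
      · exact (hQ k').trans (by omega))
    (fun j => Q (k (.inr j) + 1)) (fun j => hQ _)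
  have hsum : ∑ σ : Equiv.Perm (κ ⊕ μ), ((Equiv.Perm.sign σ : ℤ) : RatFun m n) *
      ∑ η : κ ⊕ μ → ℤˣ, ∏ i, (if η i = 1 then 1 else c) *
        letterFactor h s y i (((η i : ℤ) : ℝ) • x (σ i)) =
      (of fun i j => letterFactor h s y i (x j) + c * letterFactor h s y i (-x j)).det := by
    rw [← det_transpose, det_apply']
    refine Finset.sum_congr rfl fun σ _ => ?_
    congr 1
    rw [← Fintype.piFinset_univ, ← Finset.prod_univ_sum (fun _ => (Finset.univ : Finset ℤˣ))
      (fun i η => (if η = 1 then 1 else c) * letterFactor h s y i (((η : ℤ) : ℝ) • x (σ i)))]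
    refine Finset.prod_congr rfl fun i _ => ?_
    rw [sum_intUnits]
    simp [show (-1 : ℤˣ) ≠ 1 by decide]
  have hrow : (of fun i j => letterFactor h s y i (x j) + c * letterFactor h s y i (-x j)) =
      of fun i j => τ (x j) *
      (of fun i j => Sum.elim (fun l => e (-((k (.inl l) + s) • y l))) (fun _ => 1) i *
        (of fun i j => Sum.elim
          (fun l => (C (e (y l)) * Q (k (.inl l) + 1) + Q (k (.inl l))).eval (ecosh (x j)) /
            (ecosh (x j) + ecosh (y l)))
          (fun l => (Q (k (.inr l) + 1)).eval (ecosh (x j))) i : Matrix _ _ _) i j :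
          Matrix (κ ⊕ μ) (κ ⊕ μ) (RatFun m n)) i j := by
    ext i j
    have hcheb := eval_ecosh_chebyshevLike (C a) b s c (x j) (τ (x j)) (by simp [hτ])
      (hτ' _) (k i)
    rcases i with l | l
    · simp only [of_apply, Sum.elim_inl, letterFactor, exponent, eval_add, eval_mul, eval_C]
      have h1 : τ (x j) * (e (-((k (.inl l) + s) • y l)) *
          ((e (y l) * (Q (k (.inl l) + 1)).eval (ecosh (x j)) +
            (Q (k (.inl l))).eval (ecosh (x j))) / (ecosh (x j) + ecosh (y l)))) =
          e (-((k (.inl l) + s) • y l)) *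
          (e (y l) * (τ (x j) * (Q (k (.inl l) + 1)).eval (ecosh (x j))) +
            τ (x j) * (Q (k (.inl l))).eval (ecosh (x j))) / (ecosh (x j) + ecosh (y l)) := by
        ring
      rw [h1, ← hcheb.1, ← hcheb.2]
      change e (((k (.inl l) : ℝ) + s) • (x j - y l)) / _ +
        c * (e (((k (.inl l) : ℝ) + s) • (-x j - y l)) / _) = _
      have h2 : e (x j) * e (y l) + 1 ≠ 0 := by
        rw [← e_add, ← e_zero]
        exact e_add_e_ne_zero _ _
      rw [sub_smul, one_smul, smul_sub, smul_sub, smul_neg]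
      simp only [neg_sub, e_sub, e_neg, ecosh]
      exact matched_identity (e_ne_zero _) (e_ne_zero _) (e_ne_zero _) (e_ne_zero _)
        (e_add_e_ne_zero _ _) h2 c
    · simp only [of_apply, Sum.elim_inr, letterFactor, exponent, one_mul]
      rw [← hcheb.2, smul_neg]
  rw [hsum, hrow, det_mul_row, det_mul_column, hdet, Fintype.prod_sum_type
    (f := Sum.elim (fun l => e (-((k (.inl l) + s) • y l))) fun _ => 1)]
  have h5 : ∏ l, e (-(s • y l)) * (e (y l) * a + b.eval (-ecosh (y l))) =
      (∏ l, e (-((k (.inl l) + s) • y l))) * ∏ l, ((-1) ^ k (.inl l) *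
        (C (e (y l)) * Q (k (.inl l) + 1) + Q (k (.inl l))).eval (-ecosh (y l))) := by
    rw [← Finset.prod_mul_distrib]
    refine Finset.prod_congr rfl fun l _ => ?_
    have h6 := eval_neg_chebyshevLike (C a) b (e_ne_zero (y l)) (k (.inl l))
    rw [← e_neg] at h6
    change _ = _ * (_ * eval (-(e (y l) + e (-y l))) _)
    rw [eval_add, eval_mul, eval_C, h6, neg_pow, eval_C,
      show -((k (.inl l) + s) • y l) = -(s • y l) - (k (.inl l) : ℝ) • y l by module, e_sub,
      e_natCast_smul, ecosh]
    have h7 : ((-1) ^ k (.inl l) * (-1) ^ k (.inl l) : RatFun m n) = 1 := by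
      rw [← mul_pow]
      simp
    have h8 : e (y l) ^ k (.inl l) ≠ 0 := pow_ne_zero _ (e_ne_zero _)
    field_simp
    linear_combination (-(e (y l) ^ k (.inl l) * e (-(s • y l)) *
      (e (y l) * a + eval (-(e (y l) + e (-y l))) b))) * h7
  rw [h5]
  simp only [Sum.elim_inl, Sum.elim_inr, Finset.prod_const_one, mul_one, k, Q]
  ring

end Antisymmetrization

/-! ### Explicit description of the roots -/

section Roots

variable {m n : ℕ}

/-- The basis vector of `V` with index `k`, that is, `ε_i` or `δ_j`. -/
noncomputable def letter (k : Fin m ⊕ Fin n) : V m n := Pi.single k 1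

/-- The positive multiple of `ε_i` (for `left = true`), resp. of `δ_j`, that is an even (for
`even = true`), resp. odd root; `0` if there is none. -/
def singleCoeff (T : SuperType) (even left : Bool) : ℝ :=
  match T, even, left with
  | .B, true, true => 1
  | .B, true, false => 2
  | .B, false, false => 1
  | .D, true, false => 2
  | _, _, _ => 0

/-- `α` is one of the vectors `letter k - letter l`, `±(letter k + letter l)` or a multiple of
`letter k` that are even, resp. odd roots. -/
def RootShape (T : SuperType) (even : Bool) (α : V m n) : Prop :=
  (∃ k l, k ≠ l ∧ (k.isLeft == l.isLeft) = even ∧ (α = letter k - letter l ∨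
    T ≠ .A ∧ (α = letter k + letter l ∨ α = -(letter k + letter l)))) ∨
  ∃ k, singleCoeff T even k.isLeft ≠ 0 ∧
    (α = singleCoeff T even k.isLeft • letter k ∨ α = -(singleCoeff T even k.isLeft • letter k))

theorem mem_rootsOf_of_entries {P : Type} [Fintype P] [DecidableEq P] {wt : P → V m n}
    {L : Submodule ℂ (Matrix P P ℂ)} {α : V m n} (hα : α ≠ 0) {x : Matrix P P ℂ} (hx : x ∈ L)
    (hx0 : x ≠ 0) (h : ∀ p q, x p q ≠ 0 → wt p - wt q = α) : α ∈ rootsOf wt L := by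
  refine ⟨hα, x, hx, hx0, fun t => ?_⟩
  ext p q
  simp only [cartan, Matrix.sub_apply, Matrix.diagonal_mul, Matrix.mul_diagonal,
    Matrix.smul_apply, smul_eq_mul]
  by_cases hpq : x p q = 0
  · simp [hpq]
  · rw [← h p q hpq]
    simp only [pairing, Pi.sub_apply, Complex.ofReal_sub, sub_mul, Finset.sum_sub_distrib]
    ring

theorem letter_ne_zero (k : Fin m ⊕ Fin n) : (letter k : V m n) ≠ 0 := by
  intro h
  simpa [letter] using congrFun h k

theorem letter_injective : Function.Injective (letter : Fin m ⊕ Fin n → V m n) := by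
  intro k l h
  by_contra hkl
  simpa [letter, hkl] using congrFun h k

theorem letter_ne_neg (k l : Fin m ⊕ Fin n) : (letter k : V m n) ≠ -letter l := by
  intro h
  have := congrFun h k
  by_cases hkl : k = l
  · subst hkl
    simp [letter] at this
    norm_num at this
  · simp [letter, hkl] at this

theorem mem_glOdd {I J : Type} {x : Matrix (I ⊕ J) (I ⊕ J) ℂ} (hx : x ∈ glOdd I J)
    {p q : I ⊕ J} (h : x p q ≠ 0) : p.isLeft ≠ q.isLeft := by
  rcases p with i | j <;> rcases q with i' | j'
  · exact absurd (hx.1 i i') h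
  · simp
  · simp
  · exact absurd (hx.2 j j') h

theorem glEven_of_entries {I J : Type} {x : Matrix (I ⊕ J) (I ⊕ J) ℂ}
    (h : ∀ p q, x p q ≠ 0 → p.isLeft = q.isLeft) : x ∈ glEven I J := by
  intro i j
  constructor <;> by_contra hc <;> simpa using h _ _ hc

theorem glOdd_of_entries {I J : Type} {x : Matrix (I ⊕ J) (I ⊕ J) ℂ}
    (h : ∀ p q, x p q ≠ 0 → p.isLeft ≠ q.isLeft) : x ∈ glOdd I J := by
  constructor <;> intro i j <;> by_contra hc <;> simpa using h _ _ hc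

theorem weightA_eq_letter (k : Fin m ⊕ Fin n) : weightA m n k = letter k := by
  rcases k with k | k <;> rfl

theorem mem_evenRoots_A {α : V m n} : α ∈ evenRoots .A m n ↔ RootShape .A true α := by
  constructor
  · intro hα
    obtain ⟨x, hx, p, q, hpq, rfl⟩ := exists_weights hα
    rw [weightA_eq_letter, weightA_eq_letter]
    refine Or.inl ⟨p, q, ?_, by simpa using mem_glEven hx hpq, Or.inl rfl⟩
    rintro rfl
    exact hα.1 (sub_self _)
  · rintro (⟨k, l, hkl, hs, rfl | ⟨h, -⟩⟩ | ⟨k, hk, -⟩)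
    · refine mem_rootsOf_of_entries (sub_ne_zero.2 fun h => hkl (letter_injective h))
        (x := Matrix.single k l 1) (glEven_of_entries fun p q h => ?_) ?_ fun p q h => ?_
      · rw [Matrix.single_apply] at h
        obtain ⟨rfl, rfl⟩ : k = p ∧ l = q := by_contra fun hc => h (if_neg hc)
        simpa using hs
      · intro h
        simpa using congrFun (congrFun h k) l
      · rw [Matrix.single_apply] at h
        obtain ⟨rfl, rfl⟩ : k = p ∧ l = q := by_contra fun hc => h (if_neg hc)
        rw [weightA_eq_letter, weightA_eq_letter]
    · exact absurd rfl h
    · exact absurd rfl hk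

theorem mem_oddRoots_A {α : V m n} : α ∈ oddRoots .A m n ↔ RootShape .A false α := by
  constructor
  · intro hα
    obtain ⟨x, hx, p, q, hpq, rfl⟩ := exists_weights hα
    rw [weightA_eq_letter, weightA_eq_letter]
    refine Or.inl ⟨p, q, ?_, by simpa using mem_glOdd hx hpq, Or.inl rfl⟩
    rintro rfl
    exact hα.1 (sub_self _)
  · rintro (⟨k, l, hkl, hs, rfl | ⟨h, -⟩⟩ | ⟨k, hk, -⟩)
    · refine mem_rootsOf_of_entries (sub_ne_zero.2 fun h => hkl (letter_injective h))
        (x := Matrix.single k l 1) (glOdd_of_entries fun p q h => ?_) ?_ fun p q h => ?_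
      · rw [Matrix.single_apply] at h
        obtain ⟨rfl, rfl⟩ : k = p ∧ l = q := by_contra fun hc => h (if_neg hc)
        simpa using hs
      · intro h
        simpa using congrFun (congrFun h k) l
      · rw [Matrix.single_apply] at h
        obtain ⟨rfl, rfl⟩ : k = p ∧ l = q := by_contra fun hc => h (if_neg hc)
        rw [weightA_eq_letter, weightA_eq_letter]
    · exact absurd rfl h
    · exact absurd rfl hk

/-- A monomial supersymmetric form `K` on a graded space with a basis of weights `0` (the indices
in `zeros`) and `± letter k` (the indices `enc k true` and `enc k false`); `bar` is the index of
the dual basis vector. -/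
structure SplitForm {I J : Type} (wt : I ⊕ J → V m n) (K : Matrix (I ⊕ J) (I ⊕ J) ℂ) where
  bar : I ⊕ J → I ⊕ J
  coeff : I ⊕ J → ℂ
  enc : Fin m ⊕ Fin n → Bool → I ⊕ J
  zeros : Set (I ⊕ J)
  bar_bar : ∀ p, bar (bar p) = p
  isLeft_bar : ∀ p, (bar p).isLeft = p.isLeft
  coeff_ne_zero : ∀ p, coeff p ≠ 0
  coeff_bar : ∀ p, coeff (bar p) = (if p.isLeft then 1 else -1) * coeff p
  apply_bar : ∀ p, K p (bar p) = coeff p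
  apply_ne : ∀ p q, q ≠ bar p → K p q = 0
  bar_enc : ∀ k b, bar (enc k b) = enc k !b
  wt_enc : ∀ k b, wt (enc k b) = if b then letter k else -letter k
  isLeft_enc : ∀ k b, (enc k b).isLeft = k.isLeft
  wt_zeros : ∀ p ∈ zeros, wt p = 0
  isLeft_zeros : ∀ p ∈ zeros, p.isLeft = true
  bar_zeros : ∀ p ∈ zeros, bar p = p
  cover : ∀ p, p ∈ zeros ∨ ∃ k b, p = enc k b

namespace SplitForm

variable {I J : Type} {wt : I ⊕ J → V m n} {K : Matrix (I ⊕ J) (I ⊕ J) ℂ}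

theorem bar_injective (d : SplitForm wt K) : Function.Injective d.bar :=
  Function.LeftInverse.injective d.bar_bar

theorem wt_bar (d : SplitForm wt K) (p : I ⊕ J) : wt (d.bar p) = -wt p := by
  rcases d.cover p with hp | ⟨k, b, rfl⟩
  · simp [d.bar_zeros p hp, d.wt_zeros p hp]
  · cases b <;> simp [d.bar_enc, d.wt_enc]

theorem bar_eq_iff (d : SplitForm wt K) {p q : I ⊕ J} : d.bar p = q ↔ p = d.bar q :=
  ⟨fun h => by rw [← h, d.bar_bar], fun h => by rw [h, d.bar_bar]⟩

theorem sub_enc (d : SplitForm wt K) (k l : Fin m ⊕ Fin n) (b c : Bool) :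
    wt (d.enc k b) - wt (d.enc l c) = letter k - letter l ∨
    wt (d.enc k b) - wt (d.enc l c) = letter l - letter k ∨
    wt (d.enc k b) - wt (d.enc l c) = letter k + letter l ∨
    wt (d.enc k b) - wt (d.enc l c) = -(letter k + letter l) := by
  rw [d.wt_enc, d.wt_enc]
  cases b <;> cases c <;> simp [sub_eq_add_neg, add_comm]

theorem exists_zeros_sub_enc (d : SplitForm wt K) {p : I ⊕ J} (hp : p ∈ d.zeros)
    (k : Fin m ⊕ Fin n) (b : Bool) : (wt p - wt (d.enc k b) = letter k ∨
      wt p - wt (d.enc k b) = -letter k) ∧ (wt (d.enc k b) - wt p = letter k ∨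
      wt (d.enc k b) - wt p = -letter k) := by
  rw [d.wt_zeros p hp, d.wt_enc]
  cases b <;> simp

/-- The matrix `c E_{pq} - c' E_{q̄p̄}`. -/
def rootVector [DecidableEq I] [DecidableEq J] (d : SplitForm wt K) (p q : I ⊕ J)
    (c c' : ℂ) : Matrix (I ⊕ J) (I ⊕ J) ℂ :=
  of fun a b => (if b = q ∧ a = p then c else 0) - (if b = d.bar p ∧ a = d.bar q then c' else 0)

theorem rootVector_ne_zero [DecidableEq I] [DecidableEq J] (d : SplitForm wt K)
    {p q : I ⊕ J} {c c' : ℂ} {a b : I ⊕ J}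
    (h : d.rootVector p q c c' a b ≠ 0) : (a = p ∧ b = q) ∨ (a = d.bar q ∧ b = d.bar p) := by
  by_contra! hc
  refine h ?_
  rw [rootVector, of_apply, if_neg fun h => hc.1 h.2 h.1, if_neg fun h => hc.2 h.2 h.1, sub_zero]

theorem wt_rootVector [DecidableEq I] [DecidableEq J] (d : SplitForm wt K)
    {p q : I ⊕ J} {c c' : ℂ} {a b : I ⊕ J}
    (h : d.rootVector p q c c' a b ≠ 0) : wt a - wt b = wt p - wt q := by
  rcases d.rootVector_ne_zero h with ⟨rfl, rfl⟩ | ⟨rfl, rfl⟩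
  · rfl
  · rw [d.wt_bar, d.wt_bar]
    abel

theorem isLeft_rootVector [DecidableEq I] [DecidableEq J] (d : SplitForm wt K)
    {p q : I ⊕ J} {c c' : ℂ} {a b : I ⊕ J}
    (h : d.rootVector p q c c' a b ≠ 0) : a.isLeft = b.isLeft ↔ p.isLeft = q.isLeft := by
  rcases d.rootVector_ne_zero h with ⟨rfl, rfl⟩ | ⟨rfl, rfl⟩
  · rfl
  · rw [d.isLeft_bar, d.isLeft_bar, eq_comm]

variable [Fintype I] [Fintype J]

theorem transpose_mul_apply (d : SplitForm wt K) (x : Matrix (I ⊕ J) (I ⊕ J) ℂ) (a b : I ⊕ J) :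
    (xᵀ * K) a b = d.coeff (d.bar b) * x (d.bar b) a := by
  rw [Matrix.mul_apply, Finset.sum_eq_single (d.bar b), transpose_apply]
  · have := d.apply_bar (d.bar b)
    rw [d.bar_bar] at this
    rw [this, mul_comm]
  · intro c _ hc
    rw [d.apply_ne c b, mul_zero]
    rintro rfl
    exact hc (d.bar_bar c).symm
  · simp

theorem mul_apply (d : SplitForm wt K) (x : Matrix (I ⊕ J) (I ⊕ J) ℂ) (a b : I ⊕ J) :
    (K * x) a b = d.coeff a * x (d.bar a) b := by
  rw [Matrix.mul_apply, Finset.sum_eq_single (d.bar a), d.apply_bar]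
  · intro c _ hc
    rw [d.apply_ne a c hc, zero_mul]
  · simp

variable [DecidableEq I] [DecidableEq J]

theorem mem_ospEven (d : SplitForm wt K) (x : Matrix (I ⊕ J) (I ⊕ J) ℂ) : x ∈ ospEven K ↔
    x ∈ glEven I J ∧
      ∀ a b, d.coeff (d.bar b) * x (d.bar b) a + d.coeff a * x (d.bar a) b = 0 := by
  change _ ∧ _ ↔ _
  rw [← Matrix.ext_iff]
  simp only [Matrix.add_apply, d.transpose_mul_apply, d.mul_apply, Matrix.zero_apply]

theorem mem_ospOdd (d : SplitForm wt K) (x : Matrix (I ⊕ J) (I ⊕ J) ℂ) : x ∈ ospOdd K ↔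
    x ∈ glOdd I J ∧ ∀ a b, d.coeff (d.bar b) * x (d.bar b) a +
      (if a.isLeft then 1 else -1) * d.coeff a * x (d.bar a) b = 0 := by
  change _ ∧ _ ↔ _
  have hpar : parityMatrix I J = diagonal fun a => if a.isLeft then 1 else -1 := by
    ext a b
    rcases a with a | a <;> rcases b with b | b <;>
      simp [parityMatrix, Matrix.one_apply, diagonal_apply]
    split_ifs <;> simp
  rw [← Matrix.ext_iff, hpar]
  simp only [Matrix.add_apply, d.transpose_mul_apply, Matrix.diagonal_mul,
    d.mul_apply, Matrix.zero_apply, mul_assoc]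

theorem even_root (d : SplitForm wt K) {p q : I ⊕ J} (hpq : p.isLeft = q.isLeft)
    (h : p ≠ d.bar q ∨ p.isLeft = false) (h0 : wt p - wt q ≠ 0) :
    wt p - wt q ∈ rootsOf wt (ospEven K) := by
  refine mem_rootsOf_of_entries h0 (x := d.rootVector p q (d.coeff q) (d.coeff p))
    ((d.mem_ospEven _).2 ⟨glEven_of_entries fun a b hab => (d.isLeft_rootVector hab).2 hpq,
      fun a b => ?_⟩) (fun h' => ?_) fun a b hab => d.wt_rootVector hab
  · simp only [rootVector, of_apply, d.bar_injective.eq_iff, d.bar_eq_iff (q := p)]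
    have h1 : d.coeff (d.bar b) * (if a = q ∧ b = d.bar p then d.coeff q else 0) =
        d.coeff a * (if b = d.bar p ∧ a = q then d.coeff p else 0) := by
      by_cases h : b = d.bar p ∧ a = q
      · obtain ⟨rfl, rfl⟩ := h
        simp [d.bar_bar, mul_comm]
      · rw [if_neg h, if_neg fun h' => h h'.symm, mul_zero, mul_zero]
    have h2 : d.coeff (d.bar b) * (if a = d.bar p ∧ b = q then d.coeff p else 0) =
        d.coeff a * (if b = q ∧ a = d.bar p then d.coeff q else 0) := by
      by_cases h : b = q ∧ a = d.bar p
      · obtain ⟨rfl, rfl⟩ := h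
        simp only [d.coeff_bar, hpq, and_self, if_true]
        ring
      · rw [if_neg h, if_neg fun h' => h h'.symm, mul_zero, mul_zero]
    linear_combination h1 - h2
  · have h1 := congrFun (congrFun h' p) q
    simp only [rootVector, of_apply, and_self, if_true, Matrix.zero_apply] at h1
    by_cases hp : p = d.bar q
    · have hl : p.isLeft = false := h.resolve_left (not_not.2 hp)
      have hc : d.coeff p = -d.coeff q := by
        rw [hp, d.coeff_bar, ← hpq, hl]
        simp
      rw [if_pos ⟨by rw [hp, d.bar_bar], hp⟩, hc] at h1
      exact d.coeff_ne_zero q (by linear_combination h1 / 2)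
    · rw [if_neg fun h => hp h.2, sub_zero] at h1
      exact d.coeff_ne_zero q h1

theorem odd_root (d : SplitForm wt K) {p q : I ⊕ J} (hpq : p.isLeft ≠ q.isLeft)
    (h0 : wt p - wt q ≠ 0) : wt p - wt q ∈ rootsOf wt (ospOdd K) := by
  refine mem_rootsOf_of_entries h0 (x := d.rootVector p q (d.coeff q)
    ((if q.isLeft then 1 else -1) * d.coeff p))
    ((d.mem_ospOdd _).2 ⟨glOdd_of_entries fun a b hab => (d.isLeft_rootVector hab).not.2 hpq,
      fun a b => ?_⟩) (fun h' => ?_) fun a b hab => d.wt_rootVector hab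
  · simp only [rootVector, of_apply, d.bar_injective.eq_iff, d.bar_eq_iff (q := p)]
    have h1 : d.coeff (d.bar b) * (if a = q ∧ b = d.bar p then d.coeff q else 0) =
        (if a.isLeft then 1 else -1) * d.coeff a * (if b = d.bar p ∧ a = q then
          (if q.isLeft then 1 else -1) * d.coeff p else 0) := by
      by_cases h : b = d.bar p ∧ a = q
      · obtain ⟨rfl, rfl⟩ := h
        simp only [d.bar_bar, and_self, if_true]
        split_ifs <;> ring
      · rw [if_neg h, if_neg fun h' => h h'.symm, mul_zero, mul_zero]
    have h2 : d.coeff (d.bar b) * (if a = d.bar p ∧ b = q then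
          (if q.isLeft then 1 else -1) * d.coeff p else 0) =
        (if a.isLeft then 1 else -1) * d.coeff a *
          (if b = q ∧ a = d.bar p then d.coeff q else 0) := by
      by_cases h : b = q ∧ a = d.bar p
      · obtain ⟨rfl, rfl⟩ := h
        simp only [d.coeff_bar, d.isLeft_bar, and_self, if_true]
        split_ifs <;> ring
      · rw [if_neg h, if_neg fun h' => h h'.symm, mul_zero, mul_zero]
    linear_combination h1 - h2
  · have h1 := congrFun (congrFun h' p) q
    simp only [rootVector, of_apply, and_self, if_true, Matrix.zero_apply] at h1
    rw [if_neg fun h => hpq (by rw [h.2, d.isLeft_bar]), sub_zero] at h1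
    exact d.coeff_ne_zero q h1

/-- The even roots of the orthosymplectic superalgebra of a split form. -/
theorem mem_even_iff (d : SplitForm wt K) {α : V m n} : α ∈ rootsOf wt (ospEven K) ↔
    (∃ k l, k ≠ l ∧ k.isLeft = l.isLeft ∧ (α = letter k - letter l ∨
      α = letter k + letter l ∨ α = -(letter k + letter l))) ∨
    (∃ k, k.isLeft = false ∧ (α = (2 : ℝ) • letter k ∨ α = -((2 : ℝ) • letter k))) ∨
    (d.zeros.Nonempty ∧ ∃ k, k.isLeft = true ∧ (α = letter k ∨ α = -letter k)) := by
  constructor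
  · intro hα
    obtain ⟨x, hx, p, q, hpq, rfl⟩ := exists_weights hα
    have hside := mem_glEven hx.1 hpq
    have hbar : p = d.bar q → p.isLeft = false := by
      intro h
      by_contra hl
      rw [Bool.not_eq_false] at hl
      have h1 := ((d.mem_ospEven x).1 hx).2 q q
      rw [← h, h, d.coeff_bar, ← hside, hl, if_pos rfl, one_mul, ← h] at h1
      exact hpq ((mul_eq_zero.1 (show d.coeff q * x p q = 0 by
        linear_combination h1 / 2)).resolve_left (d.coeff_ne_zero q))
    rcases d.cover p with hp | ⟨k, b, rfl⟩ <;> rcases d.cover q with hq | ⟨l, c, rfl⟩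
    · exact absurd (by rw [d.wt_zeros p hp, d.wt_zeros q hq, sub_self]) hα.1
    · refine Or.inr (Or.inr ⟨⟨p, hp⟩, l, ?_, (d.exists_zeros_sub_enc hp l c).1⟩)
      rw [← d.isLeft_enc l c, ← hside, d.isLeft_zeros p hp]
    · refine Or.inr (Or.inr ⟨⟨q, hq⟩, k, ?_, (d.exists_zeros_sub_enc hq k b).2⟩)
      rw [← d.isLeft_enc k b, hside, d.isLeft_zeros q hq]
    · rw [d.isLeft_enc, d.isLeft_enc] at hside
      by_cases hkl : k = l
      · subst hkl
        by_cases hbc : b = c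
        · subst hbc
          exact absurd (sub_self _) hα.1
        · have hbc' : b = !c := Bool.eq_not_of_ne hbc
          have hl := hbar (by rw [d.bar_enc, hbc'])
          rw [d.isLeft_enc] at hl
          refine Or.inr (Or.inl ⟨k, hl, ?_⟩)
          rw [d.wt_enc, d.wt_enc, hbc', two_smul]
          cases c <;> simp [sub_eq_add_neg]
      · rcases d.sub_enc k l b c with h | h | h | h
        · exact Or.inl ⟨k, l, hkl, hside, Or.inl h⟩
        · exact Or.inl ⟨l, k, Ne.symm hkl, hside.symm, Or.inl h⟩
        · exact Or.inl ⟨k, l, hkl, hside, Or.inr (Or.inl h)⟩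
        · exact Or.inl ⟨k, l, hkl, hside, Or.inr (Or.inr h)⟩
  · have key : ∀ k l b c, k.isLeft = l.isLeft → (k ≠ l ∨ (k.isLeft = false ∧ b ≠ c)) →
        wt (d.enc k b) - wt (d.enc l c) ∈ rootsOf wt (ospEven K) := by
      intro k l b c hs hkl
      have h0 : wt (d.enc k b) - wt (d.enc l c) ≠ 0 := by
        rw [d.wt_enc, d.wt_enc, sub_ne_zero]
        have h1 := letter_ne_neg k l
        have h2 := letter_ne_neg l k
        rcases hkl with hkl | ⟨-, hbc⟩
        · have h3 : (letter k : V m n) ≠ letter l := fun h => hkl (letter_injective h)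
          cases b <;> cases c
          · simpa using h3
          · simpa using h2.symm
          · simpa using h1
          · simpa using h3
        · cases b <;> cases c
          · exact absurd rfl hbc
          · simpa using h2.symm
          · simpa using h1
          · exact absurd rfl hbc
      refine d.even_root (by rw [d.isLeft_enc, d.isLeft_enc, hs]) ?_ h0
      rcases hkl with hkl | ⟨hl, -⟩
      · left
        rw [d.bar_enc]
        intro h
        have h1 : letter k = letter l ∨ (letter k : V m n) = -letter l ∨
            letter l = -(letter k : V m n) := by
          have := congrArg wt h
          rw [d.wt_enc, d.wt_enc] at this
          cases b <;> cases c <;> simp_all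
        rcases h1 with h1 | h1 | h1
        · exact hkl (letter_injective h1)
        · exact letter_ne_neg _ _ h1
        · exact letter_ne_neg _ _ h1
      · right
        rw [d.isLeft_enc, hl]
    have key0 : ∀ p ∈ d.zeros, ∀ k b, k.isLeft = true →
        wt (d.enc k b) - wt p ∈ rootsOf wt (ospEven K) := by
      intro p hp k b hk
      have h0 : wt (d.enc k b) - wt p ≠ 0 := by
        rw [d.wt_enc, d.wt_zeros p hp]
        have := letter_ne_zero k
        cases b <;> simpa
      refine d.even_root (by rw [d.isLeft_enc, hk, d.isLeft_zeros p hp]) (Or.inl ?_) h0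
      rw [d.bar_zeros p hp]
      intro h
      rw [h, sub_self] at h0
      exact h0 rfl
    rintro (⟨k, l, hkl, hs, rfl | rfl | rfl⟩ | ⟨k, hk, rfl | rfl⟩ | ⟨⟨p, hp⟩, k, hk, rfl | rfl⟩)
    · simpa [d.wt_enc] using key k l true true hs (Or.inl hkl)
    · simpa [d.wt_enc] using key k l true false hs (Or.inl hkl)
    · have := key k l false true hs (Or.inl hkl)
      rw [d.wt_enc, d.wt_enc] at this
      convert this using 1
      simp
      abel
    · simpa [d.wt_enc, two_smul] using key k k true false rfl (Or.inr ⟨hk, by simp⟩)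
    · have := key k k false true rfl (Or.inr ⟨hk, by simp⟩)
      rw [d.wt_enc, d.wt_enc] at this
      convert this using 1
      simp [two_smul]
      abel
    · simpa [d.wt_enc, d.wt_zeros p hp] using key0 p hp k true hk
    · simpa [d.wt_enc, d.wt_zeros p hp] using key0 p hp k false hk

/-- The odd roots of the orthosymplectic superalgebra of a split form. -/
theorem mem_odd_iff (d : SplitForm wt K) {α : V m n} : α ∈ rootsOf wt (ospOdd K) ↔
    (∃ k l, k.isLeft ≠ l.isLeft ∧ (α = letter k - letter l ∨
      α = letter k + letter l ∨ α = -(letter k + letter l))) ∨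
    (d.zeros.Nonempty ∧ ∃ k, k.isLeft = false ∧ (α = letter k ∨ α = -letter k)) := by
  constructor
  · intro hα
    obtain ⟨x, hx, p, q, hpq, rfl⟩ := exists_weights hα
    have hside := mem_glOdd hx.1 hpq
    rcases d.cover p with hp | ⟨k, b, rfl⟩ <;> rcases d.cover q with hq | ⟨l, c, rfl⟩
    · exact absurd (by rw [d.wt_zeros p hp, d.wt_zeros q hq, sub_self]) hα.1
    · refine Or.inr ⟨⟨p, hp⟩, l, ?_, (d.exists_zeros_sub_enc hp l c).1⟩
      rw [d.isLeft_enc, d.isLeft_zeros p hp] at hside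
      simpa using hside.symm
    · refine Or.inr ⟨⟨q, hq⟩, k, ?_, (d.exists_zeros_sub_enc hq k b).2⟩
      rw [d.isLeft_enc, d.isLeft_zeros q hq] at hside
      simpa using hside
    · rw [d.isLeft_enc, d.isLeft_enc] at hside
      rcases d.sub_enc k l b c with h | h | h | h
      · exact Or.inl ⟨k, l, hside, Or.inl h⟩
      · exact Or.inl ⟨l, k, hside.symm, Or.inl h⟩
      · exact Or.inl ⟨k, l, hside, Or.inr (Or.inl h)⟩
      · exact Or.inl ⟨k, l, hside, Or.inr (Or.inr h)⟩
  · have key : ∀ k l b c, k.isLeft ≠ l.isLeft →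
        wt (d.enc k b) - wt (d.enc l c) ∈ rootsOf wt (ospOdd K) := by
      intro k l b c hs
      refine d.odd_root (by rwa [d.isLeft_enc, d.isLeft_enc]) ?_
      rw [d.wt_enc, d.wt_enc, sub_ne_zero]
      have h1 := letter_ne_neg k l
      have h2 := letter_ne_neg l k
      have h3 : (letter k : V m n) ≠ letter l := fun h => hs (by rw [letter_injective h])
      cases b <;> cases c
      · simpa using h3
      · simpa using h2.symm
      · simpa using h1
      · simpa using h3
    have key0 : ∀ p ∈ d.zeros, ∀ k b, k.isLeft = false →
        wt (d.enc k b) - wt p ∈ rootsOf wt (ospOdd K) := by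
      intro p hp k b hk
      refine d.odd_root (by rw [d.isLeft_enc, hk, d.isLeft_zeros p hp]; simp) ?_
      rw [d.wt_enc, d.wt_zeros p hp]
      have := letter_ne_zero k
      cases b <;> simpa
    rintro (⟨k, l, hs, rfl | rfl | rfl⟩ | ⟨⟨p, hp⟩, k, hk, rfl | rfl⟩)
    · simpa [d.wt_enc] using key k l true true hs
    · simpa [d.wt_enc] using key k l true false hs
    · have := key k l false true hs
      rw [d.wt_enc, d.wt_enc] at this
      convert this using 1
      simp
      abel
    · simpa [d.wt_enc, d.wt_zeros p hp] using key0 p hp k true hk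
    · simpa [d.wt_enc, d.wt_zeros p hp] using key0 p hp k false hk

end SplitForm

/-- The split form of `osp(2m|2n)`. -/
def splitFormD (m n : ℕ) : SplitForm (weightD m n) (formD m n) where
  bar := Sum.map Sum.swap Sum.swap
  coeff := Sum.elim (fun _ => 1) (Sum.elim (fun _ => -1) fun _ => 1)
  enc k b := match k, b with
    | .inl i, true => .inl (.inl i)
    | .inl i, false => .inl (.inr i)
    | .inr j, true => .inr (.inl j)
    | .inr j, false => .inr (.inr j)
  zeros := ∅
  bar_bar := by rintro ((i | i) | (j | j)) <;> rfl
  isLeft_bar := by rintro ((i | i) | (j | j)) <;> rfl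
  coeff_ne_zero := by rintro ((i | i) | (j | j)) <;> simp
  coeff_bar := by rintro ((i | i) | (j | j)) <;> simp
  apply_bar := by
    rintro ((i | i) | (j | j)) <;> simp [formD, LieAlgebra.Orthogonal.JD, Matrix.J]
  apply_ne := by
    rintro ((i | i) | (j | j)) ((i' | i') | (j' | j')) h <;>
      simp_all [formD, LieAlgebra.Orthogonal.JD, Matrix.J, eq_comm]
  bar_enc := by rintro (i | j) (_ | _) <;> rfl
  wt_enc := by rintro (i | j) (_ | _) <;> rfl
  isLeft_enc := by rintro (i | j) (_ | _) <;> rfl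
  wt_zeros := by simp
  isLeft_zeros := by simp
  bar_zeros := by simp
  cover := by
    rintro ((i | i) | (j | j))
    · exact Or.inr ⟨.inl i, true, rfl⟩
    · exact Or.inr ⟨.inl i, false, rfl⟩
    · exact Or.inr ⟨.inr j, true, rfl⟩
    · exact Or.inr ⟨.inr j, false, rfl⟩

/-- The split form of `osp(2m+1|2n)`. -/
def splitFormB (m n : ℕ) : SplitForm (weightB m n) (formB m n) where
  bar := Sum.map (Sum.map id Sum.swap) Sum.swap
  coeff := Sum.elim (Sum.elim (fun _ => 2) fun _ => 1) (Sum.elim (fun _ => -1) fun _ => 1)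
  enc k b := match k, b with
    | .inl i, true => .inl (.inr (.inl i))
    | .inl i, false => .inl (.inr (.inr i))
    | .inr j, true => .inr (.inl j)
    | .inr j, false => .inr (.inr j)
  zeros := {.inl (.inl ())}
  bar_bar := by rintro ((u | i | i) | (j | j)) <;> rfl
  isLeft_bar := by rintro ((u | i | i) | (j | j)) <;> rfl
  coeff_ne_zero := by rintro ((u | i | i) | (j | j)) <;> simp
  coeff_bar := by rintro ((u | i | i) | (j | j)) <;> simp
  apply_bar := by
    rintro ((u | i | i) | (j | j)) <;>
      simp [formB, LieAlgebra.Orthogonal.JB, LieAlgebra.Orthogonal.JD, Matrix.J]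
  apply_ne := by
    rintro ((u | i | i) | (j | j)) ((u' | i' | i') | (j' | j')) h <;>
      simp_all [formB, LieAlgebra.Orthogonal.JB, LieAlgebra.Orthogonal.JD, Matrix.J, eq_comm]
  bar_enc := by rintro (i | j) (_ | _) <;> rfl
  wt_enc := by rintro (i | j) (_ | _) <;> rfl
  isLeft_enc := by rintro (i | j) (_ | _) <;> rfl
  wt_zeros := by
    rintro p rfl
    rfl
  isLeft_zeros := by
    rintro p rfl
    rfl
  bar_zeros := by
    rintro p rfl
    rfl
  cover := by
    rintro ((u | i | i) | (j | j))
    · exact Or.inl rfl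
    · exact Or.inr ⟨.inl i, true, rfl⟩
    · exact Or.inr ⟨.inl i, false, rfl⟩
    · exact Or.inr ⟨.inr j, true, rfl⟩
    · exact Or.inr ⟨.inr j, false, rfl⟩

theorem mem_evenRoots_iff {T : SuperType} {α : V m n} :
    α ∈ evenRoots T m n ↔ RootShape T true α := by
  cases T
  · exact mem_evenRoots_A
  · refine (splitFormB m n).mem_even_iff.trans ?_
    simp [RootShape, singleCoeff, splitFormB,
      or_comm (a := ∃ b, α = (2 : ℝ) • letter (Sum.inr b) ∨ _)]
  · refine (splitFormD m n).mem_even_iff.trans ?_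
    simp [RootShape, singleCoeff, splitFormD]

theorem mem_oddRoots_iff {T : SuperType} {α : V m n} :
    α ∈ oddRoots T m n ↔ RootShape T false α := by
  cases T
  · exact mem_oddRoots_A
  · refine (splitFormB m n).mem_odd_iff.trans ?_
    simp [RootShape, singleCoeff, splitFormB]
  · refine (splitFormD m n).mem_odd_iff.trans ?_
    simp [RootShape, singleCoeff, splitFormD]

end Roots

/-! ### Signed permutations of the letters and the Weyl group of a component -/

section SignedPermutations

variable {m n : ℕ}

theorem letter_ext {w w' : V m n ≃ₗ[ℝ] V m n} (h : ∀ k, w (letter k) = w' (letter k)) : w = w' := by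
  apply LinearEquiv.toLinearMap_injective
  refine (Pi.basisFun ℝ (Fin m ⊕ Fin n)).ext fun k => ?_
  simpa [letter] using h k

theorem intUnits_mul_self (u : ℤˣ) : ((u : ℤ) : ℝ) * ((u : ℤ) : ℝ) = 1 := by
  rcases Int.units_eq_one_or u with rfl | rfl <;> simp

/-- The linear map `letter k ↦ η k • letter (τ k)`. -/
def signedPerm (τ : Equiv.Perm (Fin m ⊕ Fin n)) (η : Fin m ⊕ Fin n → ℤˣ) :
    V m n ≃ₗ[ℝ] V m n where
  toFun v k := ((η (τ.symm k) : ℤ) : ℝ) * v (τ.symm k)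
  invFun v k := ((η k : ℤ) : ℝ) * v (τ k)
  map_add' v w := by
    funext k
    simp [mul_add]
  map_smul' c v := by
    funext k
    simp [mul_left_comm]
  left_inv v := by
    funext k
    simp [← mul_assoc, intUnits_mul_self]
  right_inv v := by
    funext k
    simp [← mul_assoc, intUnits_mul_self]

theorem signedPerm_apply (τ : Equiv.Perm (Fin m ⊕ Fin n)) (η : Fin m ⊕ Fin n → ℤˣ) (v : V m n)
    (k : Fin m ⊕ Fin n) : signedPerm τ η v k = ((η (τ.symm k) : ℤ) : ℝ) * v (τ.symm k) := rfl

theorem signedPerm_letter (τ : Equiv.Perm (Fin m ⊕ Fin n)) (η : Fin m ⊕ Fin n → ℤˣ)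
    (k : Fin m ⊕ Fin n) : signedPerm τ η (letter k) = ((η k : ℤ) : ℝ) • letter (τ k) := by
  funext l
  rw [signedPerm_apply, Pi.smul_apply, smul_eq_mul, letter, letter, Pi.single_apply,
    Pi.single_apply]
  by_cases h : l = τ k
  · subst h
    simp
  · rw [if_neg h, if_neg fun h' => h (by rw [← h', Equiv.apply_symm_apply]), mul_zero, mul_zero]

theorem signedPerm_mul (τ τ' : Equiv.Perm (Fin m ⊕ Fin n)) (η η' : Fin m ⊕ Fin n → ℤˣ) :
    signedPerm τ η * signedPerm τ' η' = signedPerm (τ * τ') fun k => η (τ' k) * η' k := by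
  refine letter_ext fun k => ?_
  rw [LinearEquiv.mul_apply, signedPerm_letter, map_smul, signedPerm_letter, signedPerm_letter,
    smul_smul]
  push_cast
  rw [mul_comm]
  rfl

theorem signedPerm_one : signedPerm 1 1 = (1 : V m n ≃ₗ[ℝ] V m n) := by
  refine letter_ext fun k => ?_
  rw [signedPerm_letter]
  simp

theorem det_signedPerm (τ : Equiv.Perm (Fin m ⊕ Fin n)) (η : Fin m ⊕ Fin n → ℤˣ) :
    LinearMap.det (signedPerm τ η : V m n →ₗ[ℝ] V m n) =
      (((Equiv.Perm.sign τ * ∏ k, η k : ℤˣ) : ℤ) : ℝ) := by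
  rw [← LinearMap.det_toMatrix']
  have : LinearMap.toMatrix' (signedPerm τ η : V m n →ₗ[ℝ] V m n) =
      of fun k l => ((η l : ℤ) : ℝ) * (τ⁻¹.permMatrix ℝ) k l := by
    ext k l
    rw [LinearMap.toMatrix'_apply]
    change signedPerm τ η (Pi.single l 1) k = _
    rw [show (Pi.single l 1 : V m n) = letter l from rfl, signedPerm_letter, Pi.smul_apply,
      of_apply, Equiv.Perm.permMatrix, PEquiv.toMatrix_apply, letter, Pi.single_apply,
      smul_eq_mul]
    simp [Equiv.eq_symm_apply, eq_comm]
  rw [this, det_mul_row, det_permutation, Equiv.Perm.sign_inv]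
  push_cast
  rw [mul_comm]

theorem sgn_signedPerm (τ : Equiv.Perm (Fin m ⊕ Fin n)) (η : Fin m ⊕ Fin n → ℤˣ) :
    sgn (signedPerm τ η) = ((Equiv.Perm.sign τ * ∏ k, η k : ℤˣ) : ℤ) := by
  rw [sgn, det_signedPerm]
  rcases Int.units_eq_one_or (Equiv.Perm.sign τ * ∏ k, η k) with h | h <;> rw [h] <;> simp

theorem form_letter_right (v : V m n) (k : Fin m ⊕ Fin n) :
    form v (letter k) = (if k.isLeft then 1 else -1) * v k := by
  rw [form_eq_sum, Finset.sum_eq_single k] <;> simp +contextual [letter]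

theorem form_add_right (u v w : V m n) : form u (v + w) = form u v + form u w := by
  simp only [form_eq_sum, ← Finset.sum_add_distrib, Pi.add_apply]
  exact Finset.sum_congr rfl fun _ _ => by ring

theorem form_smul_right (c : ℝ) (u v : V m n) : form u (c • v) = c * form u v := by
  simp only [form_eq_sum, Finset.mul_sum, Pi.smul_apply, smul_eq_mul]
  exact Finset.sum_congr rfl fun _ _ => by ring

theorem form_comm (u v : V m n) : form u v = form v u := by
  simp only [form_eq_sum]
  exact Finset.sum_congr rfl fun _ _ => by ring

theorem form_neg_right (u v : V m n) : form u (-v) = -form u v := by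
  rw [← neg_one_smul ℝ, form_smul_right, neg_one_mul]

theorem form_sub_right (u v w : V m n) : form u (v - w) = form u v - form u w := by
  rw [sub_eq_add_neg, form_add_right, form_neg_right, sub_eq_add_neg]

theorem form_neg_left (u v : V m n) : form (-u) v = -form u v := by
  rw [form_comm, form_neg_right, form_comm]

/-- The reflection in `letter k - u • letter l`. -/
def pairReflection (k l : Fin m ⊕ Fin n) (u : ℤˣ) : V m n ≃ₗ[ℝ] V m n :=
  signedPerm (Equiv.swap k l) fun j => if j = k ∨ j = l then u else 1

/-- The reflection in `letter k`. -/
def letterReflection (k : Fin m ⊕ Fin n) : V m n ≃ₗ[ℝ] V m n :=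
  signedPerm 1 fun j => if j = k then -1 else 1

theorem pairReflection_apply {k l : Fin m ⊕ Fin n} (hkl : k ≠ l) (hs : k.isLeft = l.isLeft)
    (u : ℤˣ) {α : V m n} (hα : α = letter k - ((u : ℤ) : ℝ) • letter l) (v : V m n) :
    pairReflection k l u v = v - (2 * form v α / form α α) • α := by
  have h1 : form v α = (if k.isLeft then 1 else -1) * (v k - ((u : ℤ) : ℝ) * v l) := by
    rw [hα, form_sub_right, form_smul_right, form_letter_right, form_letter_right, hs]
    ring
  have hk : α k = 1 := by simp [hα, letter, hkl]
  have hl : α l = -((u : ℤ) : ℝ) := by simp [hα, letter, hkl.symm]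
  have h2 : form α α = (if k.isLeft then 1 else -1) * 2 := by
    have : form α α = (if k.isLeft then 1 else -1) * (α k - ((u : ℤ) : ℝ) * α l) := by
      nth_rw 2 [hα]
      rw [form_sub_right, form_smul_right, form_letter_right, form_letter_right, hs]
      ring
    rw [this, hk, hl]
    linear_combination (if k.isLeft then 1 else -1) * intUnits_mul_self u
  have h3 : 2 * form v α / form α α = v k - ((u : ℤ) : ℝ) * v l := by
    rw [h1, h2]
    split_ifs <;> field_simp
  rw [h3]
  funext j
  rw [pairReflection, signedPerm_apply, Equiv.symm_swap, Pi.sub_apply, Pi.smul_apply, smul_eq_mul]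
  by_cases hjk : j = k
  · subst hjk
    simp [hk]
  · by_cases hjl : j = l
    · subst hjl
      rw [Equiv.swap_apply_right, hl]
      simp only [true_or, if_true]
      linear_combination v j * intUnits_mul_self u
    · rw [Equiv.swap_apply_of_ne_of_ne hjk hjl]
      simp [hjk, hjl, hα, letter]

theorem letterReflection_apply {k : Fin m ⊕ Fin n} {c : ℝ} (hc : c ≠ 0) {α : V m n}
    (hα : α = c • letter k) (v : V m n) :
    letterReflection k v = v - (2 * form v α / form α α) • α := by
  have h1 : ∀ v : V m n, form v α = (if k.isLeft then 1 else -1) * (c * v k) := by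
    intro v
    rw [hα, form_smul_right, form_letter_right]
    ring
  have hk : α k = c := by simp [hα, letter]
  have h3 : (2 * form v α / form α α) • α = (2 * v k) • letter k := by
    rw [h1 α, h1 v, hk, hα, smul_smul]
    congr 1
    split_ifs <;> field_simp
  rw [h3]
  funext j
  rw [letterReflection, signedPerm_apply, Equiv.Perm.one_def, Equiv.refl_symm, Equiv.refl_apply,
    Pi.sub_apply, Pi.smul_apply, smul_eq_mul]
  by_cases hjk : j = k
  · subst hjk
    simp [letter]
    ring
  · simp [hjk, letter]

/-- `true` for the side of the `ε_i`. -/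
def sideBool : Side → Bool
  | .eps => true
  | .del => false

theorem mem_component_iff {T : SuperType} {s : Side} {α : V m n} : α ∈ component T m n s ↔
    α ∈ evenRoots T m n ∧ 0 < (if sideBool s then 1 else -1) * form α α := by
  cases s <;> simp [component, sideBool]

theorem mem_component_of_pair {T : SuperType} {s : Side} {k l : Fin m ⊕ Fin n} (hkl : k ≠ l)
    (hk : k.isLeft = sideBool s) (hl : l.isLeft = sideBool s) {u : ℤˣ} (hu : u = 1 ∨ T ≠ .A) :
    letter k - ((u : ℤ) : ℝ) • letter l ∈ component T m n s := by
  rw [mem_component_iff, mem_evenRoots_iff]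
  constructor
  · refine Or.inl ⟨k, l, hkl, by simp [hk, hl], ?_⟩
    rcases Int.units_eq_one_or u with rfl | rfl
    · left
      simp
    · right
      exact ⟨hu.resolve_left (by decide), Or.inl (by simp)⟩
  · rw [form_sub_right, form_smul_right, form_letter_right, form_letter_right, hk, hl]
    have := intUnits_mul_self u
    cases sideBool s <;> simp [letter, hkl, hkl.symm] <;> nlinarith

theorem mem_component_of_single {T : SuperType} {s : Side} {k : Fin m ⊕ Fin n}
    (hk : k.isLeft = sideBool s) (hc : singleCoeff T true (sideBool s) ≠ 0) :
    singleCoeff T true (sideBool s) • letter k ∈ component T m n s := by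
  rw [mem_component_iff, mem_evenRoots_iff]
  constructor
  · exact Or.inr ⟨k, by rwa [hk], Or.inl (by rw [hk])⟩
  · rw [form_smul_right, form_letter_right, hk]
    have := mul_self_pos.2 hc
    cases h : sideBool s <;> simp_all [letter]

theorem mem_component_cases {T : SuperType} {s : Side} {α : V m n} (hα : α ∈ component T m n s) :
    (∃ k l, k ≠ l ∧ k.isLeft = sideBool s ∧ l.isLeft = sideBool s ∧ ∃ u : ℤˣ, (u = 1 ∨ T ≠ .A) ∧
      (α = letter k - ((u : ℤ) : ℝ) • letter l ∨ -α = letter k - ((u : ℤ) : ℝ) • letter l)) ∨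
    ∃ k, k.isLeft = sideBool s ∧ singleCoeff T true (sideBool s) ≠ 0 ∧
      ∃ c : ℝ, c ≠ 0 ∧ α = c • letter k := by
  rw [mem_component_iff, mem_evenRoots_iff] at hα
  obtain ⟨h, hpos⟩ := hα
  have hpair : ∀ k l : Fin m ⊕ Fin n, k ≠ l → (k.isLeft == l.isLeft) = true → ∀ u : ℤˣ,
      (α = letter k - ((u : ℤ) : ℝ) • letter l ∨ -α = letter k - ((u : ℤ) : ℝ) • letter l) →
      k.isLeft = sideBool s ∧ l.isLeft = sideBool s := by
    intro k l hkl hs u h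
    have hs' : k.isLeft = l.isLeft := by simpa using hs
    rw [← hs', and_self]
    have h2 : form α α = (if k.isLeft then 1 else -1) * 2 := by
      have : ∀ β : V m n, β = letter k - ((u : ℤ) : ℝ) • letter l →
          form β β = (if k.isLeft then 1 else -1) * 2 := by
        intro β hβ
        rw [hβ, form_sub_right, form_smul_right, form_letter_right, form_letter_right, hs']
        have hu := intUnits_mul_self u
        cases l.isLeft <;> simp [letter, hkl, hkl.symm] <;> linarith
      rcases h with h | h
      · exact this α h
      · rw [← this _ h, form_neg_right, form_neg_left, neg_neg]
    rw [h2] at hpos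
    cases hk : k.isLeft <;> cases hb : sideBool s <;> simp [hk, hb] at hpos ⊢ <;> linarith
  rcases h with ⟨k, l, hkl, hs, h⟩ | ⟨k, hk, h⟩
  · rcases h with h | ⟨hT, h | h⟩
    · have h' : α = letter k - (((1 : ℤˣ) : ℤ) : ℝ) • letter l := by simpa using h
      obtain ⟨h1, h2⟩ := hpair k l hkl hs 1 (Or.inl h')
      exact Or.inl ⟨k, l, hkl, h1, h2, 1, Or.inl rfl, Or.inl h'⟩
    · have h' : α = letter k - (((-1 : ℤˣ) : ℤ) : ℝ) • letter l := by simpa using h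
      obtain ⟨h1, h2⟩ := hpair k l hkl hs (-1) (Or.inl h')
      exact Or.inl ⟨k, l, hkl, h1, h2, -1, Or.inr hT, Or.inl h'⟩
    · have h' : -α = letter k - (((-1 : ℤˣ) : ℤ) : ℝ) • letter l := by
        rw [h, neg_neg]
        simp
      obtain ⟨h1, h2⟩ := hpair k l hkl hs (-1) (Or.inr h')
      exact Or.inl ⟨k, l, hkl, h1, h2, -1, Or.inr hT, Or.inr h'⟩
  · right
    obtain ⟨c, hc, rfl⟩ : ∃ c : ℝ, c ≠ 0 ∧ α = c • letter k := by
      rcases h with h | h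
      · exact ⟨_, hk, h⟩
      · exact ⟨_, neg_ne_zero.2 hk, by rw [h, neg_smul]⟩
    have hside : k.isLeft = sideBool s := by
      rw [form_smul_right, form_letter_right] at hpos
      have := mul_self_pos.2 hc
      cases h1 : k.isLeft <;> cases hb : sideBool s <;> simp [h1, hb, letter] at hpos ⊢ <;>
        linarith
    exact ⟨k, hside, hside ▸ hk, c, hc, rfl⟩

theorem pairReflection_mem {T : SuperType} {s : Side} {k l : Fin m ⊕ Fin n} (hkl : k ≠ l)
    (hk : k.isLeft = sideBool s) (hl : l.isLeft = sideBool s) {u : ℤˣ} (hu : u = 1 ∨ T ≠ .A) :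
    pairReflection k l u ∈ weylGroup T m n s :=
  Subgroup.subset_closure ⟨_, mem_component_of_pair hkl hk hl hu,
    pairReflection_apply hkl (hk.trans hl.symm) u rfl⟩

theorem letterReflection_mem {T : SuperType} {s : Side} {k : Fin m ⊕ Fin n}
    (hk : k.isLeft = sideBool s) (hc : singleCoeff T true (sideBool s) ≠ 0) :
    letterReflection k ∈ weylGroup T m n s :=
  Subgroup.subset_closure ⟨_, mem_component_of_single hk hc, letterReflection_apply hc rfl⟩

/-- The subgroup generated by the reflections is contained in every subgroup that contains the
`pairReflection`s and `letterReflection`s of this side. -/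
theorem weylGroup_le {T : SuperType} {s : Side} {H : Subgroup (V m n ≃ₗ[ℝ] V m n)}
    (hpair : ∀ k l, k ≠ l → k.isLeft = sideBool s → l.isLeft = sideBool s → ∀ u : ℤˣ,
      (u = 1 ∨ T ≠ .A) → pairReflection k l u ∈ H)
    (hsingle : ∀ k, k.isLeft = sideBool s → singleCoeff T true (sideBool s) ≠ 0 →
      letterReflection k ∈ H) : weylGroup T m n s ≤ H := by
  refine (Subgroup.closure_le H).2 ?_
  rintro w ⟨α, hα, hw⟩
  rcases mem_component_cases hα with ⟨k, l, hkl, hk, hl, u, hu, h⟩ | ⟨k, hk, hT, c, hc, h⟩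
  · have : w = pairReflection k l u := by
      refine LinearEquiv.ext fun v => ?_
      rw [hw]
      rcases h with h | h
      · rw [pairReflection_apply hkl (hk.trans hl.symm) u h]
      · rw [pairReflection_apply hkl (hk.trans hl.symm) u h]
        simp only [form_neg_right, form_neg_left, neg_neg, smul_neg, mul_neg, neg_div, neg_smul]
    exact this ▸ hpair k l hkl hk hl u hu
  · have : w = letterReflection k := by
      refine LinearEquiv.ext fun v => ?_
      rw [hw, letterReflection_apply hc h]
    exact this ▸ hsingle k hk hT

end SignedPermutations

section WeylElements

variable {m n : ℕ} {A B : Type}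

/-- The linear map that maps the letter `a : A` to `η a` times the letter `σ a` and fixes the
letters from `B`. -/
def weylElement (E : A ⊕ B ≃ Fin m ⊕ Fin n) (σ : Equiv.Perm A) (η : A → ℤˣ) :
    V m n ≃ₗ[ℝ] V m n :=
  signedPerm (E.permCongr (Equiv.sumCongr σ (Equiv.refl B))) fun k => Sum.elim η 1 (E.symm k)

theorem weylElement_letter_inl (E : A ⊕ B ≃ Fin m ⊕ Fin n) (σ : Equiv.Perm A) (η : A → ℤˣ)
    (a : A) : weylElement E σ η (letter (E (.inl a))) =
      ((η a : ℤ) : ℝ) • letter (E (.inl (σ a))) := by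
  rw [weylElement, signedPerm_letter]
  simp

theorem weylElement_letter_inr (E : A ⊕ B ≃ Fin m ⊕ Fin n) (σ : Equiv.Perm A) (η : A → ℤˣ)
    (b : B) : weylElement E σ η (letter (E (.inr b))) = letter (E (.inr b)) := by
  rw [weylElement, signedPerm_letter]
  simp

theorem weylElement_ext (E : A ⊕ B ≃ Fin m ⊕ Fin n) {w w' : V m n ≃ₗ[ℝ] V m n}
    (hA : ∀ a, w (letter (E (.inl a))) = w' (letter (E (.inl a))))
    (hB : ∀ b, w (letter (E (.inr b))) = w' (letter (E (.inr b)))) : w = w' := by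
  refine letter_ext fun k => ?_
  obtain ⟨k, rfl⟩ := E.surjective k
  rcases k with a | b
  · exact hA a
  · exact hB b

theorem weylElement_mul (E : A ⊕ B ≃ Fin m ⊕ Fin n) (σ σ' : Equiv.Perm A) (η η' : A → ℤˣ) :
    weylElement E σ η * weylElement E σ' η' =
      weylElement E (σ * σ') fun a => η (σ' a) * η' a := by
  refine weylElement_ext E (fun a => ?_) fun b => ?_
  · rw [LinearEquiv.mul_apply, weylElement_letter_inl, map_smul, weylElement_letter_inl,
      weylElement_letter_inl, smul_smul]
    push_cast
    rw [mul_comm]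
    rfl
  · rw [LinearEquiv.mul_apply, weylElement_letter_inr, weylElement_letter_inr,
      weylElement_letter_inr]

theorem weylElement_one (E : A ⊕ B ≃ Fin m ⊕ Fin n) : weylElement E 1 1 = 1 := by
  refine weylElement_ext E (fun a => ?_) fun b => ?_
  · rw [weylElement_letter_inl]
    simp
  · rw [weylElement_letter_inr]
    simp

theorem weylElement_injective (E : A ⊕ B ≃ Fin m ⊕ Fin n) {σ σ' : Equiv.Perm A} {η η' : A → ℤˣ}
    (h : weylElement E σ η = weylElement E σ' η') : σ = σ' ∧ η = η' := by
  have key : ∀ a, σ a = σ' a ∧ η a = η' a := by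
    intro a
    have h1 := congrArg (fun w : V m n ≃ₗ[ℝ] V m n => w (letter (E (.inl a)))) h
    simp only [weylElement_letter_inl] at h1
    have h2 : ∀ k l : Fin m ⊕ Fin n, ∀ u u' : ℤˣ,
        ((u : ℤ) : ℝ) • letter k = ((u' : ℤ) : ℝ) • letter l → k = l ∧ u = u' := by
      intro k l u u' h
      rcases Int.units_eq_one_or u with rfl | rfl <;> rcases Int.units_eq_one_or u' with rfl | rfl
      · exact ⟨letter_injective (by simpa using h), rfl⟩
      · exact absurd (by simpa using h) (letter_ne_neg k l)
      · exact absurd (by simpa using h.symm) (letter_ne_neg l k)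
      · exact ⟨letter_injective (by simpa using h), rfl⟩
    obtain ⟨h3, h4⟩ := h2 _ _ _ _ h1
    exact ⟨Sum.inl_injective (E.injective h3), h4⟩
  exact ⟨Equiv.ext fun a => (key a).1, funext fun a => (key a).2⟩

theorem pairReflection_eq_weylElement [DecidableEq A] [DecidableEq B]
    (E : A ⊕ B ≃ Fin m ⊕ Fin n) (a a' : A)
    (u : ℤˣ) : pairReflection (E (.inl a)) (E (.inl a')) u =
      weylElement E (Equiv.swap a a') fun c => if c = a ∨ c = a' then u else 1 := by
  refine weylElement_ext E (fun c => ?_) fun b => ?_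
  · rw [weylElement_letter_inl, pairReflection, signedPerm_letter, E.injective.swap_apply,
      Function.Injective.swap_apply Sum.inl_injective]
    simp [E.injective.eq_iff]
  · rw [weylElement_letter_inr, pairReflection, signedPerm_letter, E.injective.swap_apply,
      Equiv.swap_apply_of_ne_of_ne (by simp) (by simp)]
    simp [E.injective.eq_iff]

theorem letterReflection_eq_weylElement [DecidableEq A] (E : A ⊕ B ≃ Fin m ⊕ Fin n) (a : A) :
    letterReflection (E (.inl a)) = weylElement E 1 (Pi.mulSingle a (-1)) := by
  refine weylElement_ext E (fun c => ?_) fun b => ?_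
  · rw [weylElement_letter_inl, letterReflection, signedPerm_letter]
    simp [E.injective.eq_iff, Pi.mulSingle_apply]
  · rw [weylElement_letter_inr, letterReflection, signedPerm_letter]
    simp [E.injective.eq_iff]

/-- The homomorphism `η ↦ weylElement E 1 η`. -/
def signHom (E : A ⊕ B ≃ Fin m ⊕ Fin n) : (A → ℤˣ) →* (V m n ≃ₗ[ℝ] V m n) where
  toFun η := weylElement E 1 η
  map_one' := weylElement_one E
  map_mul' η η' := (weylElement_mul E 1 1 η η').symm

variable [Fintype A]

/-- The sign changes that occur in the Weyl group. -/
def Allowed (T : SuperType) (left : Bool) (η : A → ℤˣ) : Prop :=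
  match T, left with
  | .A, _ => η = 1
  | .B, _ => True
  | .D, true => ∏ a, η a = 1
  | .D, false => True

theorem sgn_weylElement [DecidableEq A] [Fintype B] [DecidableEq B] (E : A ⊕ B ≃ Fin m ⊕ Fin n)
    (σ : Equiv.Perm A) (η : A → ℤˣ) :
    sgn (weylElement E σ η) = ((Equiv.Perm.sign σ * ∏ a, η a : ℤˣ) : ℤ) := by
  rw [weylElement, sgn_signedPerm, Equiv.Perm.sign_permCongr]
  have h1 : Equiv.Perm.sign (Equiv.sumCongr σ (Equiv.refl B)) = Equiv.Perm.sign σ := by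
    change Equiv.Perm.sign (Equiv.Perm.sumCongr σ (1 : Equiv.Perm B)) = _
    rw [Equiv.Perm.sign_sumCongr, Equiv.Perm.sign_one, mul_one]
  have h2 : ∏ k, Sum.elim η (1 : B → ℤˣ) (E.symm k) = ∏ a, η a := by
    rw [← E.prod_comp]
    simp
  rw [h1, h2]

theorem allowed_mul {T : SuperType} {left : Bool} {η η' : A → ℤˣ} (h : Allowed T left η)
    (h' : Allowed T left η') (σ : Equiv.Perm A) : Allowed T left fun a => η (σ a) * η' a := by
  cases T
  · simp only [Allowed] at h h' ⊢
    subst h h'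
    rfl
  · trivial
  · cases left
    · trivial
    · simp only [Allowed] at h h' ⊢
      rw [Finset.prod_mul_distrib, h', mul_one, Equiv.prod_comp σ η, h]

/-- The subgroup of the allowed signed permutations. -/
def allowedGroup (T : SuperType) (left : Bool) (E : A ⊕ B ≃ Fin m ⊕ Fin n) :
    Subgroup (V m n ≃ₗ[ℝ] V m n) where
  carrier := {w | ∃ σ η, Allowed T left η ∧ w = weylElement E σ η}
  one_mem' := by
    refine ⟨1, 1, ?_, (weylElement_one E).symm⟩
    cases T <;> cases left <;> simp [Allowed]
  mul_mem' := by
    rintro _ _ ⟨σ, η, h, rfl⟩ ⟨σ', η', h', rfl⟩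
    exact ⟨_, _, allowed_mul h h' σ', weylElement_mul E σ σ' η η'⟩
  inv_mem' := by
    rintro _ ⟨σ, η, h, rfl⟩
    refine ⟨σ⁻¹, fun a => η (σ⁻¹ a) * (1 : A → ℤˣ) a, allowed_mul h ?_ _, ?_⟩
    · cases T <;> cases left <;> simp [Allowed]
    · rw [inv_eq_iff_mul_eq_one, weylElement_mul, ← weylElement_one E]
      congr 1
      · simp
      · funext a
        simp

variable [DecidableEq A]

theorem weylGroup_eq [DecidableEq B] (T : SuperType) (s : Side) (E : A ⊕ B ≃ Fin m ⊕ Fin n)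
    (hA : ∀ a, (E (.inl a)).isLeft = sideBool s) (hB : ∀ b, (E (.inr b)).isLeft ≠ sideBool s) :
    weylGroup T m n s = allowedGroup T (sideBool s) E := by
  have hex : ∀ k, k.isLeft = sideBool s → ∃ a, k = E (.inl a) := by
    intro k hk
    obtain ⟨k, rfl⟩ := E.surjective k
    rcases k with a | b
    · exact ⟨a, rfl⟩
    · exact absurd hk (hB b)
  apply le_antisymm
  · refine weylGroup_le (fun k l hkl hk hl u hu => ?_) fun k hk hc => ?_
    · obtain ⟨a, rfl⟩ := hex k hk
      obtain ⟨a', rfl⟩ := hex l hl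
      have haa : a ≠ a' := fun h => hkl (by rw [h])
      refine ⟨_, _, ?_, pairReflection_eq_weylElement E a a' u⟩
      cases T
      · have : u = 1 := hu.resolve_right (by simp)
        subst this
        simp only [Allowed, ite_self]
        rfl
      · trivial
      · cases sideBool s
        · trivial
        · simp only [Allowed]
          rw [Finset.prod_ite, Finset.prod_const_one, mul_one, Finset.prod_const,
            Finset.filter_or, Finset.filter_eq', Finset.filter_eq']
          simp only [Finset.mem_univ, if_true]
          rw [← Finset.insert_eq, Finset.card_pair haa, Int.units_sq]
    · obtain ⟨a, rfl⟩ := hex k hk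
      refine ⟨_, _, ?_, letterReflection_eq_weylElement E a⟩
      cases T
      · exact absurd rfl hc
      · trivial
      · cases hs : sideBool s
        · trivial
        · rw [hs] at hc
          exact absurd rfl hc
  · have hinj : ∀ {a a' : A}, a ≠ a' → E (.inl a) ≠ E (.inl a') :=
      fun h h' => h (Sum.inl_injective (E.injective h'))
    have hperm : ∀ σ, weylElement E σ 1 ∈ weylGroup T m n s := by
      intro σ
      induction σ using Equiv.Perm.swap_induction_on with
      | one => exact weylElement_one E ▸ one_mem _
      | swap_mul σ a a' haa ih =>
        have h1 := pairReflection_mem (T := T) (hinj haa) (hA a) (hA a') (u := 1) (Or.inl rfl)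
        rw [pairReflection_eq_weylElement] at h1
        have h2 := mul_mem h1 ih
        rw [weylElement_mul] at h2
        convert h2 using 1
        congr 1
        funext c
        simp
    have hsign : ∀ η, Allowed T (sideBool s) η → weylElement E 1 η ∈ weylGroup T m n s := by
      intro η hη
      let H := (weylGroup T m n s).comap (signHom E)
      change η ∈ H
      have hsingle : singleCoeff T true (sideBool s) ≠ 0 → η ∈ H := by
        intro hc
        rw [← Finset.univ_prod_mulSingle η]
        refine Subgroup.prod_mem _ fun a _ => ?_
        rcases Int.units_eq_one_or (η a) with h | h <;> rw [h]
        · rw [Pi.mulSingle_one]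
          exact one_mem _
        · change weylElement E 1 (Pi.mulSingle a (-1)) ∈ weylGroup T m n s
          rw [← letterReflection_eq_weylElement]
          exact letterReflection_mem (hA a) hc
      cases T
      · simp only [Allowed] at hη
        rw [hη]
        exact one_mem _
      · refine hsingle ?_
        cases sideBool s <;> simp [singleCoeff]
      · cases hs : sideBool s
        · refine hsingle ?_
          rw [hs]
          simp [singleCoeff]
        · rw [hs] at hη
          simp only [Allowed] at hη
          by_cases hne : Nonempty A
          · obtain ⟨a₀⟩ := hne
            have h1 : η = ∏ a, (Pi.mulSingle a (η a) * Pi.mulSingle a₀ (η a)) := by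
              rw [Finset.prod_mul_distrib, Finset.univ_prod_mulSingle]
              have := map_prod (MonoidHom.mulSingle (fun _ : A => ℤˣ) a₀) η Finset.univ
              simp only [MonoidHom.mulSingle_apply] at this
              rw [← this, hη, Pi.mulSingle_one, mul_one]
            rw [h1]
            refine Subgroup.prod_mem _ fun a _ => ?_
            rcases Int.units_eq_one_or (η a) with h | h <;> rw [h]
            · rw [Pi.mulSingle_one, Pi.mulSingle_one, mul_one]
              exact one_mem _
            · by_cases ha : a = a₀
              · rw [ha, ← Pi.mulSingle_mul]
                simp
              · have h2 := mul_mem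
                  (pairReflection_mem (T := .D) (hinj ha) (hA a) (hA a₀) (u := 1) (Or.inl rfl))
                  (pairReflection_mem (T := .D) (hinj ha) (hA a) (hA a₀) (u := -1)
                    (Or.inr (by simp)))
                rw [pairReflection_eq_weylElement, pairReflection_eq_weylElement,
                  weylElement_mul, Equiv.swap_mul_self] at h2
                change weylElement E 1 (Pi.mulSingle a (-1) * Pi.mulSingle a₀ (-1)) ∈
                  weylGroup SuperType.D m n s
                convert h2 using 2
                funext c
                by_cases hc : c = a
                · subst hc
                  simp [ha]
                · by_cases hc' : c = a₀
                  · subst hc'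
                    simp [hc]
                  · simp [hc, hc']
          · have : η = 1 := funext fun a => absurd ⟨a⟩ hne
            rw [this]
            exact one_mem _
    rintro _ ⟨σ, η, hη, rfl⟩
    have := mul_mem (hperm σ) (hsign η hη)
    rw [weylElement_mul] at this
    simpa using this

open scoped Classical in
theorem sum_weylGroup [DecidableEq B] {M : Type*} [AddCommMonoid M] (T : SuperType) (s : Side)
    (E : A ⊕ B ≃ Fin m ⊕ Fin n)
    (hA : ∀ a, (E (.inl a)).isLeft = sideBool s) (hB : ∀ b, (E (.inr b)).isLeft ≠ sideBool s)
    (F : (V m n ≃ₗ[ℝ] V m n) → M) :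
    ∑ w : weylGroup T m n s, F w.1 =
      ∑ σ : Equiv.Perm A, ∑ η : A → ℤˣ with Allowed T (sideBool s) η, F (weylElement E σ η) := by
  have hmem : ∀ w, w ∈ weylGroup T m n s ↔
      ∃ σ η, Allowed T (sideBool s) η ∧ w = weylElement E σ η := by
    intro w
    rw [weylGroup_eq T s E hA hB]
    rfl
  rw [← Finset.sum_product']
  symm
  refine Finset.sum_bij (fun p hp => ⟨weylElement E p.1 p.2, (hmem _).2 ⟨p.1, p.2, ?_, rfl⟩⟩)
    (fun _ _ => Finset.mem_univ _) ?_ ?_ fun _ _ => rfl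
  · simpa using hp
  · rintro ⟨σ, η⟩ _ ⟨σ', η'⟩ _ h
    obtain ⟨rfl, rfl⟩ := weylElement_injective E (congrArg Subtype.val h)
    rfl
  · rintro ⟨w, hw⟩ _
    obtain ⟨σ, η, hη, rfl⟩ := (hmem w).1 hw
    exact ⟨(σ, η), by simpa using hη, rfl⟩

end WeylElements

/-! ### The identity and its behaviour under automorphisms of the root system -/

section Transport

variable {m n : ℕ}

/-- The denominator identity for the positive system of `f` and the set `S`. -/
def DenominatorIdentity (T : SuperType) (s : Side) (f : Module.Dual ℝ (V m n))
    (S : Finset (V m n)) : Prop :=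
  weylDenominator T f * e (rho T f) =
    ∑ w : weylGroup T m n s,
      (sgn w.1 : RatFun m n) * act w.1 (e (rho T f) / ∏ β ∈ S, (1 + e (-β)))

theorem act_mul (a b : V m n ≃ₗ[ℝ] V m n) (r : RatFun m n) : act (a * b) r = act a (act b r) := by
  have h : ((act (a * b) : RatFun m n ≃+* RatFun m n) : RatFun m n →+* RatFun m n) =
      (act a : RatFun m n →+* RatFun m n).comp (act b : RatFun m n →+* RatFun m n) := by
    refine IsLocalization.ringHom_ext (nonZeroDivisors (AddMonoidAlgebra ℚ (V m n))) ?_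
    refine AddMonoidAlgebra.ringHom_ext (fun r => ?_) fun v => ?_
    · simp [act]
    · change act (a * b) (e v) = act a (act b (e v))
      rw [act_e, act_e, act_e]
      rfl
  exact congrArg (fun φ : RatFun m n →+* RatFun m n => φ r) h

theorem sgn_conj (g w : V m n ≃ₗ[ℝ] V m n) : sgn (g * w * g⁻¹) = sgn w := by
  have h : LinearEquiv.det (g * w * g⁻¹) = LinearEquiv.det w := by
    rw [map_mul, map_mul, map_inv, mul_comm, inv_mul_cancel_left]
  rw [sgn, sgn, ← LinearEquiv.coe_det, ← LinearEquiv.coe_det, h]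

theorem mem_posEven {T : SuperType} {f : Module.Dual ℝ (V m n)} {α : V m n} :
    α ∈ posEven T f ↔ α ∈ evenRoots T m n ∧ 0 < f α := by
  simp [posEven, posEvenSet]

theorem mem_posOdd {T : SuperType} {f : Module.Dual ℝ (V m n)} {α : V m n} :
    α ∈ posOdd T f ↔ α ∈ oddRoots T m n ∧ 0 < f α := by
  simp [posOdd, posOddSet]

/-- `g` preserves the form and the even and the odd roots. -/
structure IsRootAutomorphism (T : SuperType) (g : V m n ≃ₗ[ℝ] V m n) : Prop where
  form_map : ∀ u v, form (g u) (g v) = form u v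
  even_iff : ∀ α, g α ∈ evenRoots T m n ↔ α ∈ evenRoots T m n
  odd_iff : ∀ α, g α ∈ oddRoots T m n ↔ α ∈ oddRoots T m n

theorem IsRootAutomorphism.inv {T : SuperType} {g : V m n ≃ₗ[ℝ] V m n}
    (hg : IsRootAutomorphism T g) : IsRootAutomorphism T g⁻¹ where
  form_map u v := by
    rw [← hg.form_map]
    congr 1 <;> exact g.apply_symm_apply _
  even_iff α := by
    rw [← hg.even_iff]
    exact iff_of_eq (congrArg (· ∈ evenRoots T m n) (g.apply_symm_apply α))
  odd_iff α := by
    rw [← hg.odd_iff]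
    exact iff_of_eq (congrArg (· ∈ oddRoots T m n) (g.apply_symm_apply α))

theorem IsRootAutomorphism.conj_mem {T : SuperType} {s : Side} {g : V m n ≃ₗ[ℝ] V m n}
    (hg : IsRootAutomorphism T g) {w : V m n ≃ₗ[ℝ] V m n} (hw : w ∈ weylGroup T m n s) :
    g * w * g⁻¹ ∈ weylGroup T m n s := by
  induction hw using Subgroup.closure_induction with
  | mem w h =>
    obtain ⟨α, hα, h⟩ := h
    refine Subgroup.subset_closure ⟨g α, ?_, fun v => ?_⟩
    · rw [mem_component_iff] at hα ⊢
      rwa [hg.even_iff, hg.form_map]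
    · have hv : v = g (g⁻¹ v) := (g.apply_symm_apply v).symm
      change g (w (g⁻¹ v)) = _
      rw [h, map_sub, map_smul, ← hv, hg.form_map, ← hg.form_map (g⁻¹ v), ← hv]
  | one => simp
  | mul x y _ _ hx hy =>
    have := mul_mem hx hy
    rwa [show g * x * g⁻¹ * (g * y * g⁻¹) = g * (x * y) * g⁻¹ by group] at this
  | inv x _ hx =>
    have := inv_mem hx
    rwa [show (g * x * g⁻¹)⁻¹ = g * x⁻¹ * g⁻¹ by group] at this

theorem denominatorIdentity_of_map {T : SuperType} {s : Side} {g : V m n ≃ₗ[ℝ] V m n}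
    (hg : IsRootAutomorphism T g) {f : Module.Dual ℝ (V m n)} {S : Finset (V m n)}
    (h : DenominatorIdentity T s (f ∘ₗ (g⁻¹ : V m n ≃ₗ[ℝ] V m n).toLinearMap)
      (S.map g.toEquiv.toEmbedding)) : DenominatorIdentity T s f S := by
  have hinv : ∀ v, g⁻¹ (g v) = v := g.symm_apply_apply
  have hinv' : ∀ v, g (g⁻¹ v) = v := g.apply_symm_apply
  have hmap : ∀ (F : Finset (V m n)) (α : V m n),
      α ∈ F.map g.toEquiv.toEmbedding ↔ g⁻¹ α ∈ F := by
    intro F α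
    rw [Finset.mem_map]
    constructor
    · rintro ⟨β, hβ, rfl⟩
      change g⁻¹ (g β) ∈ F
      rwa [hinv]
    · exact fun h => ⟨_, h, hinv' α⟩
  have hE : posEven T (f ∘ₗ (g⁻¹ : V m n ≃ₗ[ℝ] V m n).toLinearMap) =
      (posEven T f).map g.toEquiv.toEmbedding := by
    ext α
    rw [hmap, mem_posEven, mem_posEven, hg.inv.even_iff]
    rfl
  have hO : posOdd T (f ∘ₗ (g⁻¹ : V m n ≃ₗ[ℝ] V m n).toLinearMap) =
      (posOdd T f).map g.toEquiv.toEmbedding := by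
    ext α
    rw [hmap, mem_posOdd, mem_posOdd, hg.inv.odd_iff]
    rfl
  have hrho : rho T (f ∘ₗ (g⁻¹ : V m n ≃ₗ[ℝ] V m n).toLinearMap) = g (rho T f) := by
    rw [rho, rho, hE, hO, Finset.sum_map, Finset.sum_map, map_sub, map_smul, map_smul, map_sum,
      map_sum]
    rfl
  have hR : weylDenominator T (f ∘ₗ (g⁻¹ : V m n ≃ₗ[ℝ] V m n).toLinearMap) =
      act g (weylDenominator T f) := by
    rw [weylDenominator, weylDenominator, hE, hO, Finset.prod_map, Finset.prod_map, map_div₀,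
      map_prod, map_prod]
    simp only [map_sub, map_add, map_one, act_e, map_neg]
    rfl
  have hS : ∏ β ∈ S.map g.toEquiv.toEmbedding, (1 + e (-β)) =
      act g (∏ β ∈ S, (1 + e (-β))) := by
    rw [Finset.prod_map, map_prod]
    simp only [map_add, map_one, act_e, map_neg]
    rfl
  rw [DenominatorIdentity, hrho, hR, hS, ← act_e, ← map_mul, ← map_div₀] at h
  refine (act g).injective (h.trans ?_)
  rw [map_sum]
  symm
  refine Finset.sum_bij' (fun w _ => ⟨g * w.1 * g⁻¹, hg.conj_mem w.2⟩)
    (fun w _ => ⟨g⁻¹ * w.1 * g, by simpa using hg.inv.conj_mem w.2⟩)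
    (fun _ _ => Finset.mem_univ _) (fun _ _ => Finset.mem_univ _) ?_ ?_ ?_
  · intro w _
    exact Subtype.ext (by simp [mul_assoc])
  · intro w _
    exact Subtype.ext (by simp [mul_assoc])
  · intro w _
    rw [map_mul, map_intCast, sgn_conj, ← act_mul, ← act_mul, mul_assoc, inv_mul_cancel, mul_one]

end Transport

/-! ### Normalization of the positive system -/

section Normalization

variable {m n : ℕ}

/-- The properties of `f` and `S` that are used in the proof of the identity. -/
structure Admissible (T : SuperType) (f : Module.Dual ℝ (V m n)) (S : Finset (V m n)) : Prop where
  regular : ∀ α ∈ roots T m n, f α ≠ 0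
  mem : ∀ β ∈ S, β ∈ roots T m n
  pos : ∀ β ∈ S, 0 < f β
  orth : ∀ β ∈ S, ∀ β' ∈ S, form β β' = 0
  card : S.card = min m n
  indecomposable : ∀ β ∈ S, ∀ γ ∈ roots T m n, ∀ γ' ∈ roots T m n, 0 < f γ → 0 < f γ' →
    β ≠ γ + γ'

theorem sub_mem_roots (T : SuperType) {k l : Fin m ⊕ Fin n} (hkl : k ≠ l) :
    letter k - letter l ∈ roots T m n := by
  rw [roots, Set.mem_union, mem_evenRoots_iff, mem_oddRoots_iff]
  cases h : k.isLeft == l.isLeft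
  · exact Or.inr (Or.inl ⟨k, l, hkl, h, Or.inl rfl⟩)
  · exact Or.inl (Or.inl ⟨k, l, hkl, h, Or.inl rfl⟩)

theorem add_mem_roots {T : SuperType} (hT : T ≠ .A) {k l : Fin m ⊕ Fin n} (hkl : k ≠ l) :
    letter k + letter l ∈ roots T m n := by
  rw [roots, Set.mem_union, mem_evenRoots_iff, mem_oddRoots_iff]
  cases h : k.isLeft == l.isLeft
  · exact Or.inr (Or.inl ⟨k, l, hkl, h, Or.inr ⟨hT, Or.inl rfl⟩⟩)
  · exact Or.inl (Or.inl ⟨k, l, hkl, h, Or.inr ⟨hT, Or.inl rfl⟩⟩)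

theorem single_mem_roots {T : SuperType} {even : Bool} {k : Fin m ⊕ Fin n}
    (hk : singleCoeff T even k.isLeft ≠ 0) :
    singleCoeff T even k.isLeft • letter k ∈ roots T m n := by
  rw [roots, Set.mem_union, mem_evenRoots_iff, mem_oddRoots_iff]
  cases even
  · exact Or.inr (Or.inr ⟨k, hk, Or.inl rfl⟩)
  · exact Or.inl (Or.inr ⟨k, hk, Or.inl rfl⟩)

theorem singleCoeff_nonneg (T : SuperType) (even left : Bool) : 0 ≤ singleCoeff T even left := by
  cases T <;> cases even <;> cases left <;> simp [singleCoeff]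

theorem form_pair {k l k' l' : Fin m ⊕ Fin n} (a b a' b' : ℝ) :
    form (a • letter k + b • letter l) (a' • letter k' + b' • letter l') =
      (if k'.isLeft then 1 else -1) * a' * (a * (if k' = k then 1 else 0) +
        b * (if k' = l then 1 else 0)) +
      (if l'.isLeft then 1 else -1) * b' * (a * (if l' = k then 1 else 0) +
        b * (if l' = l then 1 else 0)) := by
  rw [form_add_right, form_smul_right, form_smul_right, form_letter_right, form_letter_right]
  simp only [letter, Pi.add_apply, Pi.smul_apply, smul_eq_mul, Pi.single_apply]
  ring

/-- An isotropic root is `± letter k ± letter l` for letters of opposite sides; in type `A` it is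
a difference. -/
theorem exists_of_isotropic {T : SuperType} {β : V m n} (hβ : β ∈ roots T m n)
    (h0 : form β β = 0) : ∃ k l, ∃ u v : ℤˣ, k.isLeft ≠ l.isLeft ∧
      β = ((u : ℤ) : ℝ) • letter k + ((v : ℤ) : ℝ) • letter l ∧ (T = .A → u = 1 ∧ v = -1) := by
  have hmain : ∃ k l, ∃ u v : ℤˣ, k ≠ l ∧
      β = ((u : ℤ) : ℝ) • letter k + ((v : ℤ) : ℝ) • letter l ∧ (T = .A → u = 1 ∧ v = -1) := by
    rw [roots, Set.mem_union, mem_evenRoots_iff, mem_oddRoots_iff] at hβ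
    obtain ⟨b, hb⟩ : ∃ b, RootShape T b β := hβ.elim (fun h => ⟨_, h⟩) fun h => ⟨_, h⟩
    rcases hb with ⟨k, l, hkl, -, h | ⟨hT, h | h⟩⟩ | ⟨k, hk, h⟩
    · exact ⟨k, l, 1, -1, hkl, by simpa [sub_eq_add_neg] using h, fun _ => ⟨rfl, rfl⟩⟩
    · exact ⟨k, l, 1, 1, hkl, by simpa using h, fun h => absurd h hT⟩
    · exact ⟨k, l, -1, -1, hkl, by simpa [add_comm] using h, fun h => absurd h hT⟩
    · exfalso
      have h1 : form β β = (if k.isLeft then 1 else -1) *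
          (singleCoeff T b k.isLeft * singleCoeff T b k.isLeft) := by
        have h2 : form (singleCoeff T b k.isLeft • letter k : V m n)
            (singleCoeff T b k.isLeft • letter k) = (if k.isLeft then 1 else -1) *
              (singleCoeff T b k.isLeft * singleCoeff T b k.isLeft) := by
          rw [form_smul_right, form_letter_right]
          simp [letter]
        rcases h with h | h
        · rw [h, h2]
        · rw [h, form_neg_right, form_neg_left, neg_neg, h2]
      rw [h1] at h0
      rcases mul_eq_zero.1 h0 with h2 | h2
      · split_ifs at h2 <;> norm_num at h2
      · exact hk (mul_self_eq_zero.1 h2)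
  obtain ⟨k, l, u, v, hkl, h, hT⟩ := hmain
  refine ⟨k, l, u, v, fun hs => ?_, h, hT⟩
  rw [h, form_pair, hs] at h0
  have hu := intUnits_mul_self u
  have hv := intUnits_mul_self v
  simp only [hkl, hkl.symm, if_true, if_false] at h0
  split_ifs at h0 <;> nlinarith

theorem exists_of_isotropic_of_ne_zero {T : SuperType} {β : V m n} (hβ : β ∈ roots T m n)
    (h0 : form β β = 0) {k : Fin m ⊕ Fin n} (hk : β k ≠ 0) : ∃ l, ∃ u v : ℤˣ,
      k.isLeft ≠ l.isLeft ∧ β = ((u : ℤ) : ℝ) • letter k + ((v : ℤ) : ℝ) • letter l := by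
  obtain ⟨k', l, u, v, hs, h, -⟩ := exists_of_isotropic hβ h0
  by_cases hkk : k = k'
  · subst hkk
    exact ⟨l, u, v, hs, h⟩
  · by_cases hkl : k = l
    · subst hkl
      exact ⟨k', v, u, hs.symm, by rw [h, add_comm]⟩
    · simp [h, letter, hkk, hkl] at hk

/-- Two elements of `S` with a common letter coincide. -/
theorem eq_of_common_letter {T : SuperType} {f : Module.Dual ℝ (V m n)} {S : Set (V m n)}
    (hmem : ∀ β ∈ S, β ∈ roots T m n) (hpos : ∀ β ∈ S, 0 < f β)
    (horth : ∀ β ∈ S, ∀ β' ∈ S, form β β' = 0) {β β' : V m n} (hβ : β ∈ S) (hβ' : β' ∈ S)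
    {k : Fin m ⊕ Fin n} (hk : β k ≠ 0) (hk' : β' k ≠ 0) : β = β' := by
  obtain ⟨l, u, v, hs, h⟩ :=
    exists_of_isotropic_of_ne_zero (hmem β hβ) (horth β hβ β hβ) hk
  obtain ⟨l', u', v', hs', h'⟩ :=
    exists_of_isotropic_of_ne_zero (hmem β' hβ') (horth β' hβ' β' hβ') hk'
  have h1 := horth β hβ β' hβ'
  have hp := hpos β hβ
  have hp' := hpos β' hβ'
  have hkl : k ≠ l := fun h => hs (by rw [h])
  have hkl' : k ≠ l' := fun h => hs' (by rw [h])
  rw [h, h', form_pair] at h1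
  by_cases hll : l' = l
  · subst hll
    simp only [hkl, hkl.symm, if_true, if_false] at h1
    rw [h] at hp
    rw [h'] at hp'
    rw [map_add, map_smul, map_smul] at hp hp'
    have hside : (if k.isLeft then (1 : ℝ) else -1) = -(if l'.isLeft then 1 else -1) := by
      cases hx : k.isLeft <;> cases hy : l'.isLeft <;> simp_all
    rw [hside] at h1
    rw [h, h']
    rcases Int.units_eq_one_or u with rfl | rfl <;> rcases Int.units_eq_one_or v with rfl | rfl <;>
    rcases Int.units_eq_one_or u' with rfl | rfl <;>
    rcases Int.units_eq_one_or v' with rfl | rfl <;> first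
      | rfl
      | (exfalso; simp at hp hp'; linarith)
      | (exfalso; split_ifs at h1 <;> norm_num at h1)
  · exfalso
    simp only [hkl'.symm, hll, if_true, if_false] at h1
    rcases Int.units_eq_one_or u with rfl | rfl <;>
    rcases Int.units_eq_one_or u' with rfl | rfl <;>
    split_ifs at h1 <;> norm_num at h1

theorem card_of_maximalIsotropic {T : SuperType} {f : Module.Dual ℝ (V m n)} {S : Finset (V m n)}
    (hS : IsMaximalIsotropic T (S : Set (V m n))) (hpos : ∀ β ∈ S, 0 < f β) :
    S.card = min m n := by
  have hmem : ∀ β ∈ S, β ∈ roots T m n := fun β hβ => hS.1 hβ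
  have horth : ∀ β ∈ S, ∀ β' ∈ S, form β β' = 0 := fun β hβ β' hβ' =>
    hS.2.2.prop β (Submodule.subset_span hβ) β' (Submodule.subset_span hβ')
  have hboth : ∀ β : S, ∃ i j, β.1 (.inl i) ≠ 0 ∧ β.1 (.inr j) ≠ 0 := by
    rintro ⟨β, hβ⟩
    obtain ⟨k, l, u, v, hs, h, -⟩ := exists_of_isotropic (hmem β hβ) (horth β hβ β hβ)
    have hkl : k ≠ l := fun h => hs (by rw [h])
    have h1 : β k ≠ 0 := by simp [h, letter, hkl]
    have h2 : β l ≠ 0 := by simp [h, letter, hkl.symm]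
    rcases k with i | j <;> rcases l with i' | j'
    · simp at hs
    · exact ⟨i, j', h1, h2⟩
    · exact ⟨i', j, h2, h1⟩
    · simp at hs
  choose p q hp hq using hboth
  have hpinj : Function.Injective p := fun β β' h => Subtype.ext
    (eq_of_common_letter hmem hpos horth β.2 β'.2 (hp β) (by rw [h]; exact hp β'))
  have hqinj : Function.Injective q := fun β β' h => Subtype.ext
    (eq_of_common_letter hmem hpos horth β.2 β'.2 (hq β) (by rw [h]; exact hq β'))
  have hcard : Fintype.card S = S.card := Fintype.card_coe S
  have hm := Fintype.card_le_of_injective p hpinj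
  have hn := Fintype.card_le_of_injective q hqinj
  rw [hcard, Fintype.card_fin] at hm hn
  refine le_antisymm (le_min hm hn) ?_
  by_contra! hlt
  obtain ⟨i, hi⟩ : ∃ i, i ∉ Set.range p := by
    by_contra! hc
    have := Fintype.card_le_of_surjective p hc
    rw [hcard, Fintype.card_fin] at this
    exact absurd (this.trans_lt hlt) (not_lt.2 (min_le_left _ _))
  obtain ⟨j, hj⟩ : ∃ j, j ∉ Set.range q := by
    by_contra! hc
    have := Fintype.card_le_of_surjective q hc
    rw [hcard, Fintype.card_fin] at this
    exact absurd (this.trans_lt hlt) (not_lt.2 (min_le_right _ _))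
  have hi0 : ∀ β ∈ S, β (.inl i) = 0 := by
    intro β hβ
    by_contra hne
    obtain ⟨l, u, v, hs, h⟩ := exists_of_isotropic_of_ne_zero (hmem β hβ) (horth β hβ β hβ) hne
    have h1 : β (.inl (p ⟨β, hβ⟩)) ≠ 0 := hp ⟨β, hβ⟩
    refine hi ⟨⟨β, hβ⟩, ?_⟩
    generalize p ⟨β, hβ⟩ = i' at h1 ⊢
    by_contra h2
    rcases l with l | l
    · simp at hs
    · simp [h, letter, h2] at h1
  have hj0 : ∀ β ∈ S, β (.inr j) = 0 := by
    intro β hβ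
    by_contra hne
    obtain ⟨l, u, v, hs, h⟩ := exists_of_isotropic_of_ne_zero (hmem β hβ) (horth β hβ β hβ) hne
    have h1 : β (.inr (q ⟨β, hβ⟩)) ≠ 0 := hq ⟨β, hβ⟩
    refine hj ⟨⟨β, hβ⟩, ?_⟩
    generalize q ⟨β, hβ⟩ = j' at h1 ⊢
    by_contra h2
    rcases l with l | l
    · simp [h, letter, h2] at h1
    · simp at hs
  let x : V m n := letter (.inl i) + letter (.inr j)
  have hspan : ∀ k, (∀ β ∈ S, β k = 0) → ∀ y ∈ Submodule.span ℝ (S : Set (V m n)), y k = 0 := by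
    intro k hk y hy
    have : Submodule.span ℝ (S : Set (V m n)) ≤ LinearMap.ker (LinearMap.proj (R := ℝ) k) :=
      Submodule.span_le.2 fun β hβ => hk β hβ
    exact this hy
  have hx : ∀ y ∈ Submodule.span ℝ (S : Set (V m n)), form y x = 0 := by
    intro y hy
    rw [form_add_right, form_letter_right, form_letter_right, hspan _ hi0 y hy,
      hspan _ hj0 y hy]
    simp
  have hxx : form x x = 0 := by
    simp only [x]
    rw [form_add_right, form_letter_right, form_letter_right]
    simp [letter]
  have hle := hS.2.2.le_of_ge
    (y := Submodule.span ℝ (S : Set (V m n)) ⊔ Submodule.span ℝ {x}) (by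
      intro y hy y' hy'
      obtain ⟨a, ha, b, hb, rfl⟩ := Submodule.mem_sup.1 hy
      obtain ⟨a', ha', b', hb', rfl⟩ := Submodule.mem_sup.1 hy'
      obtain ⟨c, rfl⟩ := Submodule.mem_span_singleton.1 hb
      obtain ⟨c', rfl⟩ := Submodule.mem_span_singleton.1 hb'
      rw [form_comm, form_add_right, form_smul_right, form_comm _ a, form_comm _ x,
        form_add_right, form_add_right, form_smul_right, form_smul_right, hxx, hx a ha,
        form_comm x, hx a' ha', hS.2.2.prop a ha a' ha']
      simp) le_sup_left
  have hxmem : x ∈ Submodule.span ℝ (S : Set (V m n)) :=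
    hle (Submodule.mem_sup_right (Submodule.mem_span_singleton_self x))
  have := hspan _ hi0 x hxmem
  simp [x, letter] at this

theorem admissible_of_simpleSystem {T : SuperType} {f : Module.Dual ℝ (V m n)}
    (hf : ∀ α ∈ roots T m n, f α ≠ 0) {P : Set (V m n)} (hP : IsSimpleSystem T f P)
    {S : Finset (V m n)} (hS : IsMaximalIsotropic T (S : Set (V m n)))
    (hSP : (S : Set (V m n)) ⊆ P) : Admissible T f S := by
  have hpos : ∀ β ∈ S, 0 < f β := fun β hβ => (hP.1 (hSP hβ)).elim (fun h => h.2) fun h => h.2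
  refine ⟨hf, fun β hβ => hS.1 hβ, hpos, fun β hβ β' hβ' =>
    hS.2.2.prop β (Submodule.subset_span hβ) β' (Submodule.subset_span hβ'),
    card_of_maximalIsotropic hS hpos, ?_⟩
  rintro β hβ γ hγ γ' hγ' hpγ hpγ' h
  have hli : LinearIndepOn ℝ id P := hP.2.1
  let θ : V m n →ₗ[ℝ] ℝ := (Module.Basis.extend hli).constr ℝ fun _ => (1 : ℝ)
  have hθ : ∀ α ∈ P, θ α = 1 := by
    intro α hα
    have h1 := (Module.Basis.extend hli).constr_basis ℝ (fun _ => (1 : ℝ))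
      ⟨α, hli.subset_extend _ hα⟩
    rwa [Module.Basis.extend_apply_self] at h1
  have hclosure : ∀ α ∈ AddSubmonoid.closure P, α = 0 ∨ 1 ≤ θ α := by
    intro α hα
    induction hα using AddSubmonoid.closure_induction with
    | mem x hx => exact Or.inr (hθ x hx).ge
    | zero => exact Or.inl rfl
    | add x y _ _ hx hy =>
      rcases hx with rfl | hx
      · simpa using hy
      · rcases hy with rfl | hy
        · simpa using Or.inr hx
        · right
          rw [map_add]
          linarith
  have hroot : ∀ α ∈ roots T m n, 0 < f α → 1 ≤ θ α := by
    intro α hα hp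
    refine (hclosure α (hP.2.2 α (hα.elim (fun h => Or.inl ⟨h, hp⟩)
      fun h => Or.inr ⟨h, hp⟩))).resolve_left ?_
    rintro rfl
    simp at hp
  have h1 := hθ β (hSP hβ)
  rw [h, map_add] at h1
  have := hroot γ hγ hpγ
  have := hroot γ' hγ' hpγ'
  linarith

theorem Admissible.map {T : SuperType} {g : V m n ≃ₗ[ℝ] V m n} (hg : IsRootAutomorphism T g)
    {f : Module.Dual ℝ (V m n)} {S : Finset (V m n)} (h : Admissible T f S) :
    Admissible T (f ∘ₗ (g⁻¹ : V m n ≃ₗ[ℝ] V m n).toLinearMap) (S.map g.toEquiv.toEmbedding) := by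
  have hinv : ∀ v, g⁻¹ (g v) = v := g.symm_apply_apply
  have hroot : ∀ α, α ∈ roots T m n → g⁻¹ α ∈ roots T m n := fun α hα =>
    hα.elim (fun h => Or.inl ((hg.inv.even_iff α).2 h)) fun h => Or.inr ((hg.inv.odd_iff α).2 h)
  have hroot' : ∀ α, α ∈ roots T m n → g α ∈ roots T m n := fun α hα =>
    hα.elim (fun h => Or.inl ((hg.even_iff α).2 h)) fun h => Or.inr ((hg.odd_iff α).2 h)
  have hfg : ∀ v, (f ∘ₗ (g⁻¹ : V m n ≃ₗ[ℝ] V m n).toLinearMap) v = f (g⁻¹ v) := fun _ => rfl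
  have hmem : ∀ β ∈ S.map g.toEquiv.toEmbedding, ∃ β' ∈ S, β = g β' := by
    intro β hβ
    obtain ⟨β', hβ', rfl⟩ := Finset.mem_map.1 hβ
    exact ⟨β', hβ', rfl⟩
  refine ⟨fun α hα => h.regular _ (hroot α hα), ?_, ?_, ?_, by rw [Finset.card_map, h.card], ?_⟩
  · intro β hβ
    obtain ⟨β', hβ', rfl⟩ := hmem β hβ
    exact hroot' _ (h.mem _ hβ')
  · intro β hβ
    obtain ⟨β', hβ', rfl⟩ := hmem β hβ
    rw [hfg, hinv]
    exact h.pos _ hβ'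
  · intro β hβ γ hγ
    obtain ⟨β', hβ', rfl⟩ := hmem β hβ
    obtain ⟨γ', hγ', rfl⟩ := hmem γ hγ
    rw [hg.form_map]
    exact h.orth _ hβ' _ hγ'
  · intro β hβ γ hγ γ' hγ' hpγ hpγ' heq
    obtain ⟨β', hβ', rfl⟩ := hmem β hβ
    refine h.indecomposable β' hβ' _ (hroot γ hγ) _ (hroot γ' hγ') hpγ hpγ' ?_
    rw [← map_add, ← heq, hinv]

/-- The positive system is in standard position: the letters and their sums are positive as far as
they are (multiples of) roots, and the elements of `S` are differences of letters. -/
structure Normalized (T : SuperType) (f : Module.Dual ℝ (V m n)) (S : Finset (V m n)) : Prop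
    extends Admissible T f S where
  diff : ∀ β ∈ S, ∃ k l, k.isLeft ≠ l.isLeft ∧ β = letter k - letter l
  add_pos : T ≠ .A → ∀ k l, k ≠ l → 0 < f (letter k) + f (letter l)
  single_pos : ∀ even k, singleCoeff T even k.isLeft ≠ 0 → 0 < f (letter k)

/-- The sign change of letters. -/
def signChange (η : Fin m ⊕ Fin n → ℤˣ) : V m n ≃ₗ[ℝ] V m n := signedPerm 1 η

theorem signChange_letter (η : Fin m ⊕ Fin n → ℤˣ) (k : Fin m ⊕ Fin n) :
    signChange η (letter k) = ((η k : ℤ) : ℝ) • letter k := signedPerm_letter 1 η k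

theorem signChange_inv (η : Fin m ⊕ Fin n → ℤˣ) :
    (signChange η : V m n ≃ₗ[ℝ] V m n)⁻¹ = signChange η := by
  rw [inv_eq_iff_mul_eq_one, signChange, signedPerm_mul, mul_one, ← signedPerm_one]
  congr 1
  funext k
  simp

theorem rootShape_signChange {T : SuperType} (hT : T ≠ .A) (η : Fin m ⊕ Fin n → ℤˣ) {even : Bool}
    {α : V m n} (h : RootShape T even α) : RootShape T even (signChange η α) := by
  rcases h with ⟨k, l, hkl, hs, h⟩ | ⟨k, hk, h⟩
  · have h' : ∃ u v : ℤˣ, α = ((u : ℤ) : ℝ) • letter k + ((v : ℤ) : ℝ) • letter l := by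
      rcases h with h | ⟨-, h | h⟩
      · exact ⟨1, -1, by simpa [sub_eq_add_neg] using h⟩
      · exact ⟨1, 1, by simpa using h⟩
      · exact ⟨-1, -1, by simpa [add_comm] using h⟩
    obtain ⟨u, v, rfl⟩ := h'
    rw [map_add, map_smul, map_smul, signChange_letter, signChange_letter, smul_smul, smul_smul,
      ← Int.cast_mul, ← Int.cast_mul, ← Units.val_mul, ← Units.val_mul]
    rcases Int.units_eq_one_or (u * η k) with hu | hu <;>
    rcases Int.units_eq_one_or (v * η l) with hv | hv <;> rw [hu, hv]
    · exact Or.inl ⟨k, l, hkl, hs, Or.inr ⟨hT, Or.inl (by simp)⟩⟩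
    · exact Or.inl ⟨k, l, hkl, hs, Or.inl (by simp [sub_eq_add_neg])⟩
    · refine Or.inl ⟨l, k, hkl.symm, by rwa [Bool.beq_comm], Or.inl ?_⟩
      simp [sub_eq_add_neg, add_comm]
    · exact Or.inl ⟨k, l, hkl, hs, Or.inr ⟨hT, Or.inr (by simp [add_comm])⟩⟩
  · refine Or.inr ⟨k, hk, ?_⟩
    rcases Int.units_eq_one_or (η k) with hu | hu <;> rcases h with h | h <;> rw [h] <;>
      simp [signChange_letter, hu]

theorem isRootAutomorphism_signChange {T : SuperType} (hT : T ≠ .A) (η : Fin m ⊕ Fin n → ℤˣ) :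
    IsRootAutomorphism T (signChange η : V m n ≃ₗ[ℝ] V m n) := by
  have hself : ∀ v : V m n, signChange η (signChange η v) = v := by
    intro v
    have := (signChange η : V m n ≃ₗ[ℝ] V m n).symm_apply_apply v
    change (signChange η)⁻¹ (signChange η v) = v at this
    rwa [signChange_inv] at this
  have hshape : ∀ even (α : V m n), RootShape T even (signChange η α) ↔ RootShape T even α :=
    fun even α => ⟨fun h => by
      have := rootShape_signChange hT η h
      rwa [hself] at this, rootShape_signChange hT η⟩
  refine ⟨fun u v => ?_, fun α => ?_, fun α => ?_⟩
  · rw [form_eq_sum, form_eq_sum]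
    refine Finset.sum_congr rfl fun k _ => ?_
    have : ∀ v : V m n, signChange η v k = ((η k : ℤ) : ℝ) * v k := fun v => rfl
    rw [this, this]
    linear_combination ((if k.isLeft then 1 else -1) * u k * v k) * intUnits_mul_self (η k)
  · rw [mem_evenRoots_iff, mem_evenRoots_iff, hshape]
  · rw [mem_oddRoots_iff, mem_oddRoots_iff, hshape]

theorem Admissible.sub_ne {T : SuperType} {f : Module.Dual ℝ (V m n)} {S : Finset (V m n)}
    (h : Admissible T f S) {k l : Fin m ⊕ Fin n} (hkl : k ≠ l) : f (letter k) ≠ f (letter l) := by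
  have := h.regular _ (sub_mem_roots T hkl)
  rwa [map_sub, sub_ne_zero] at this

theorem map_signChange_inv (f : Module.Dual ℝ (V m n)) (η : Fin m ⊕ Fin n → ℤˣ)
    (k : Fin m ⊕ Fin n) :
    (f ∘ₗ ((signChange η)⁻¹ : V m n ≃ₗ[ℝ] V m n).toLinearMap) (letter k) =
      ((η k : ℤ) : ℝ) * f (letter k) := by
  rw [signChange_inv]
  change f (signChange η (letter k)) = _
  rw [signChange_letter, map_smul, smul_eq_mul]

theorem denominatorIdentity_of_nonneg {T : SuperType} (hT : T ≠ .A) {s : Side}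
    (hN : ∀ (f : Module.Dual ℝ (V m n)) (S : Finset (V m n)), Admissible T f S →
      (∀ k, 0 ≤ f (letter k)) → DenominatorIdentity T s f S)
    {f : Module.Dual ℝ (V m n)} {S : Finset (V m n)} (h : Admissible T f S) :
    DenominatorIdentity T s f S := by
  classical
  let η : Fin m ⊕ Fin n → ℤˣ := fun k => if 0 ≤ f (letter k) then 1 else -1
  have hg := isRootAutomorphism_signChange (m := m) (n := n) hT η
  refine denominatorIdentity_of_map hg (hN _ _ (h.map hg) fun k => ?_)
  rw [map_signChange_inv]
  by_cases hk : 0 ≤ f (letter k)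
  · simp [η, hk]
  · simpa [η, hk] using (not_le.1 hk).le

theorem Admissible.add_pos_of_nonneg {T : SuperType} (hT : T ≠ .A) {f : Module.Dual ℝ (V m n)}
    {S : Finset (V m n)} (h : Admissible T f S) (h0 : ∀ k, 0 ≤ f (letter k))
    {k l : Fin m ⊕ Fin n} (hkl : k ≠ l) : 0 < f (letter k) + f (letter l) := by
  refine lt_of_le_of_ne (add_nonneg (h0 k) (h0 l)) (Ne.symm ?_)
  rw [← map_add]
  exact h.regular _ (add_mem_roots hT hkl)

theorem Admissible.single_pos_of_nonneg {T : SuperType} {f : Module.Dual ℝ (V m n)}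
    {S : Finset (V m n)} (h : Admissible T f S) (h0 : ∀ k, 0 ≤ f (letter k))
    {even : Bool} {k : Fin m ⊕ Fin n} (hk : singleCoeff T even k.isLeft ≠ 0) :
    0 < f (letter k) := by
  refine lt_of_le_of_ne (h0 k) fun h' => h.regular _ (single_mem_roots hk) ?_
  rw [map_smul, ← h', smul_zero]

/-- If the letters are non-negative, an element of `S` is a difference or a sum of letters. -/
theorem Admissible.diff_or_add {T : SuperType} {f : Module.Dual ℝ (V m n)}
    {S : Finset (V m n)} (h : Admissible T f S) (h0 : ∀ k, 0 ≤ f (letter k)) {β : V m n}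
    (hβ : β ∈ S) : (∃ k l, k.isLeft ≠ l.isLeft ∧ β = letter k - letter l) ∨
      ∃ k l, k.isLeft = true ∧ l.isLeft = false ∧ β = letter k + letter l := by
  obtain ⟨k, l, u, v, hs, heq, -⟩ := exists_of_isotropic (h.mem β hβ) (h.orth β hβ β hβ)
  rcases Int.units_eq_one_or u with rfl | rfl <;> rcases Int.units_eq_one_or v with rfl | rfl
  · right
    cases hk : k.isLeft
    · exact ⟨l, k, (Bool.eq_not_of_ne hs.symm).trans (by rw [hk]; rfl), hk,
        by simpa [add_comm] using heq⟩
    · exact ⟨k, l, hk, (Bool.eq_not_of_ne hs.symm).trans (by rw [hk]; rfl), by simpa using heq⟩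
  · exact Or.inl ⟨k, l, hs, by simpa [sub_eq_add_neg] using heq⟩
  · exact Or.inl ⟨l, k, hs.symm, by simpa [sub_eq_add_neg, add_comm] using heq⟩
  · exfalso
    have := h.pos β hβ
    rw [heq] at this
    simp at this
    linarith [h0 k, h0 l]

/-- In type `D`, if a sum of letters lies in `S`, then the `ε` in it is the smallest letter. -/
theorem Admissible.lt_of_add_mem {f : Module.Dual ℝ (V m n)} {S : Finset (V m n)}
    (h : Admissible .D f S) (h0 : ∀ k, 0 ≤ f (letter k)) {k l : Fin m ⊕ Fin n}
    (hk : k.isLeft = true) (hl : l.isLeft = false) (hβ : letter k + letter l ∈ S)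
    {j : Fin m ⊕ Fin n} (hj : j ≠ k) : f (letter k) < f (letter j) := by
  have hkl : k ≠ l := fun h' => by simp [h', hl] at hk
  have hlc : singleCoeff .D true l.isLeft = 2 := by
    rw [hl]
    rfl
  have hlpos : 0 < f (letter l) := h.single_pos_of_nonneg h0 (even := true) (by simp [hlc])
  have hkl' : f (letter k) < f (letter l) := by
    by_contra! hle
    have hlt := lt_of_le_of_ne hle (h.sub_ne hkl.symm)
    refine h.indecomposable _ hβ (letter k - letter l) (sub_mem_roots _ hkl)
      (singleCoeff .D true l.isLeft • letter l) (single_mem_roots (by simp [hlc])) ?_ ?_ ?_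
    · rw [map_sub]
      linarith
    · rw [hlc, map_smul, smul_eq_mul]
      linarith
    · rw [hlc]
      module
  by_contra! hle
  have hlt := lt_of_le_of_ne hle (h.sub_ne hj)
  have hjl : l ≠ j := by
    rintro rfl
    linarith
  refine h.indecomposable _ hβ (letter l - letter j) (sub_mem_roots _ hjl) (letter k + letter j)
    (add_mem_roots (by simp) hj.symm) ?_ ?_ (by abel)
  · rw [map_sub]
    linarith
  · rw [map_add]
    exact h.add_pos_of_nonneg (by simp) h0 hj.symm

theorem denominatorIdentity_of_normalized {T : SuperType} {s : Side}
    (hN : ∀ (f : Module.Dual ℝ (V m n)) (S : Finset (V m n)), Normalized T f S →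
      DenominatorIdentity T s f S)
    {f : Module.Dual ℝ (V m n)} {S : Finset (V m n)} (h : Admissible T f S) :
    DenominatorIdentity T s f S := by
  classical
  cases T
  · refine hN f S ⟨h, fun β hβ => ?_, fun h => absurd rfl h, ?_⟩
    · obtain ⟨k, l, u, v, hs, heq, hT⟩ := exists_of_isotropic (h.mem β hβ) (h.orth β hβ β hβ)
      obtain ⟨rfl, rfl⟩ := hT rfl
      exact ⟨k, l, hs, by simpa [sub_eq_add_neg] using heq⟩
    · intro even k hk
      cases even <;> exact absurd rfl hk
  · refine denominatorIdentity_of_nonneg (by simp) (fun f S h h0 => ?_) h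
    refine hN f S ⟨h, fun β hβ => ?_, fun hT k l hkl => h.add_pos_of_nonneg hT h0 hkl,
      fun even k hk => h.single_pos_of_nonneg h0 hk⟩
    refine (h.diff_or_add h0 hβ).resolve_right ?_
    rintro ⟨k, l, hk, hl, rfl⟩
    have hkc : singleCoeff .B true k.isLeft = 1 := by
      rw [hk]
      rfl
    have hlc : singleCoeff .B false l.isLeft = 1 := by
      rw [hl]
      rfl
    have hkr := single_mem_roots (T := .B) (even := true) (k := k) (by simp [hkc])
    have hlr := single_mem_roots (T := .B) (even := false) (k := l) (by simp [hlc])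
    rw [hkc, one_smul] at hkr
    rw [hlc, one_smul] at hlr
    exact h.indecomposable _ hβ _ hkr _ hlr
      (h.single_pos_of_nonneg h0 (even := true) (by simp [hkc]))
      (h.single_pos_of_nonneg h0 (even := false) (by simp [hlc])) rfl
  · refine denominatorIdentity_of_nonneg (by simp) (fun f S h h0 => ?_) h
    by_cases hex : ∃ k l, k.isLeft = true ∧ l.isLeft = false ∧ letter k + letter l ∈ S
    · obtain ⟨k, l, hk, hl, hβ⟩ := hex
      have hkl : k ≠ l := fun h' => by simp [h', hl] at hk
      let η : Fin m ⊕ Fin n → ℤˣ := fun j => if j = k then -1 else 1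
      have hηk : η k = -1 := by simp [η]
      have hη : ∀ j, j ≠ k → η j = 1 := fun j hj => by simp [η, hj]
      have hg := isRootAutomorphism_signChange (m := m) (n := n) (T := .D) (by simp) η
      have hmin := fun j (hj : j ≠ k) => h.lt_of_add_mem h0 hk hl hβ hj
      refine denominatorIdentity_of_map hg (hN _ _ ⟨h.map hg, ?_, ?_, ?_⟩)
      · intro β hβ'
        obtain ⟨γ, hγ, rfl⟩ := Finset.mem_map.1 hβ'
        change ∃ k l : Fin m ⊕ Fin n, k.isLeft ≠ l.isLeft ∧ signChange η γ = letter k - letter l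
        by_cases hγk : γ k = 0
        · rcases h.diff_or_add h0 hγ with ⟨a, b, hs, rfl⟩ | ⟨a, b, ha, hb, rfl⟩
          · have hab : a ≠ b := fun h => hs (by rw [h])
            have hak : a ≠ k := by
              rintro rfl
              simp [letter, hab] at hγk
            have hbk : b ≠ k := by
              rintro rfl
              simp [letter, hab.symm] at hγk
            refine ⟨a, b, hs, ?_⟩
            rw [map_sub, signChange_letter, signChange_letter, hη a hak, hη b hbk]
            simp
          · have hab : a ≠ b := fun h => by simp [h, hb] at ha
            have hak : a ≠ k := by
              rintro rfl
              simp [letter, hab] at hγk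
            exact absurd (h.lt_of_add_mem h0 ha hb hγ hak.symm) (hmin a hak).not_gt
        · have : γ = letter k + letter l :=
            eq_of_common_letter (S := (S : Set (V m n))) h.mem h.pos h.orth hγ hβ hγk
              (by simp [letter, hkl])
          refine ⟨l, k, by simp [hk, hl], ?_⟩
          rw [this, map_add, signChange_letter, signChange_letter, hηk, hη l hkl.symm]
          simp [sub_eq_add_neg, add_comm]
      · intro _ a b hab
        rw [map_signChange_inv, map_signChange_inv]
        by_cases hak : a = k
        · subst hak
          rw [hηk, hη b hab.symm]
          simpa using hmin b hab.symm
        · by_cases hbk : b = k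
          · subst hbk
            rw [hηk, hη a hak]
            simpa using hmin a hak
          · rw [hη a hak, hη b hbk]
            simpa using h.add_pos_of_nonneg (by simp) h0 hab
      · intro even a ha
        have hak : a ≠ k := by
          rintro rfl
          rw [hk] at ha
          cases even <;> exact ha rfl
        rw [map_signChange_inv, hη a hak]
        simpa using h.single_pos_of_nonneg h0 ha
    · refine hN f S ⟨h, fun β hβ => ?_, fun hT k l hkl => h.add_pos_of_nonneg hT h0 hkl,
        fun even k hk => h.single_pos_of_nonneg h0 hk⟩
      refine (h.diff_or_add h0 hβ).resolve_right ?_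
      rintro ⟨k, l, hk, hl, rfl⟩
      exact hex ⟨k, l, hk, hl, hβ⟩

end Normalization

/-! ### The positive roots, `ρ` and the denominator in standard position -/

section PositiveRoots

variable {m n : ℕ}

/-- Whether the sums of two letters are roots. -/
def hasSums : SuperType → Bool
  | .A => false
  | _ => true

theorem hasSums_iff {T : SuperType} : hasSums T = true ↔ T ≠ .A := by
  cases T <;> simp [hasSums]

/-- The pairs of letters `(k, l)` with `k` below `l`, on the same side (`even = true`), resp. on
opposite sides. -/
def IsBelow (f : Module.Dual ℝ (V m n)) (even : Bool) (k l : Fin m ⊕ Fin n) : Prop :=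
  f (letter k) < f (letter l) ∧ (k.isLeft == l.isLeft) = even

noncomputable instance (f : Module.Dual ℝ (V m n)) (even : Bool) (k l : Fin m ⊕ Fin n) :
    Decidable (IsBelow f even k l) := inferInstanceAs (Decidable (_ ∧ _))

theorem letter_apply (k l : Fin m ⊕ Fin n) : (letter k : V m n) l = if l = k then 1 else 0 :=
  Pi.single_apply k 1 l

theorem sum_letter (k : Fin m ⊕ Fin n) : ∑ l, (letter k : V m n) l = 1 := by
  simp [letter_apply]

theorem letter_sub_inj {k l k' l' : Fin m ⊕ Fin n} (hkl : k ≠ l)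
    (h : (letter l - letter k : V m n) = letter l' - letter k') : k = k' ∧ l = l' := by
  have h1 := congrFun h l
  simp only [Pi.sub_apply, letter_apply, hkl.symm, if_true, if_false] at h1
  have hl : l = l' := by
    by_contra hne
    rw [if_neg hne] at h1
    split_ifs at h1 <;> norm_num at h1
  subst hl
  exact ⟨letter_injective (sub_right_injective h), rfl⟩

theorem letter_add_inj {k l k' l' : Fin m ⊕ Fin n} (hkl : k ≠ l)
    (h : (letter l + letter k : V m n) = letter l' + letter k') :
    (k = k' ∧ l = l') ∨ (k = l' ∧ l = k') := by
  have h1 := congrFun h l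
  simp only [Pi.add_apply, letter_apply, hkl.symm, if_true, if_false] at h1
  by_cases hl : l = l'
  · subst hl
    exact Or.inl ⟨letter_injective (add_right_injective _ h), rfl⟩
  · by_cases hl' : l = k'
    · subst hl'
      rw [add_comm (letter l')] at h
      exact Or.inr ⟨letter_injective (add_right_injective _ h), rfl⟩
    · simp [hl, hl'] at h1

theorem letter_add_ne_smul {k l j : Fin m ⊕ Fin n} (hkl : k ≠ l) (c : ℝ) :
    (letter l + letter k : V m n) ≠ c • letter j := by
  intro h
  have h1 := congrFun h l
  have h2 := congrFun h k
  simp only [Pi.add_apply, Pi.smul_apply, letter_apply, hkl, hkl.symm, if_true, if_false,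
    smul_eq_mul] at h1 h2
  by_cases hl : l = j
  · rw [if_neg fun h => hkl (h.trans hl.symm)] at h2
    simp at h2
  · simp [hl] at h1

/-- A product over the positive even, resp. odd roots. -/
@[to_additive]
theorem prod_posRoots {M : Type*} [CommMonoid M] {T : SuperType} {f : Module.Dual ℝ (V m n)}
    {S : Finset (V m n)} (h : Normalized T f S) (even : Bool) {R : Finset (V m n)}
    (hR : ∀ α, α ∈ R ↔ RootShape T even α ∧ 0 < f α) (F : V m n → M) :
    ∏ α ∈ R, F α = (∏ k, ∏ l, if IsBelow f even k l then F (letter l - letter k) *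
        (if hasSums T then F (letter l + letter k) else 1) else 1) *
      ∏ k, if singleCoeff T even k.isLeft ≠ 0 then F (singleCoeff T even k.isLeft • letter k)
        else 1 := by
  classical
  let Q : Finset ((Fin m ⊕ Fin n) × (Fin m ⊕ Fin n)) :=
    Finset.univ.filter fun p => IsBelow f even p.1 p.2
  have hQ : ∀ p, p ∈ Q ↔ IsBelow f even p.1 p.2 := fun p => by simp [Q]
  have hQne : ∀ p ∈ Q, p.1 ≠ p.2 := by
    intro p hp he
    have := ((hQ p).1 hp).1
    rw [he] at this
    exact lt_irrefl _ this
  let D := Q.image fun p => (letter p.2 - letter p.1 : V m n)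
  let P := if hasSums T then Q.image fun p => (letter p.2 + letter p.1 : V m n) else ∅
  let U := (Finset.univ.filter fun k : Fin m ⊕ Fin n => singleCoeff T even k.isLeft ≠ 0).image
    fun k => (singleCoeff T even k.isLeft • letter k : V m n)
  have hRU : R = D ∪ P ∪ U := by
    ext α
    rw [hR]
    simp only [Finset.mem_union, D, U, Finset.mem_image, hQ]
    constructor
    · rintro ⟨⟨k, l, hkl, hs, rfl | ⟨hT, rfl | rfl⟩⟩ | ⟨k, hk, rfl | rfl⟩, hp⟩
      · refine Or.inl (Or.inl ⟨(l, k), ⟨?_, by rwa [Bool.beq_comm]⟩, rfl⟩)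
        rw [map_sub] at hp
        linarith
      · refine Or.inl (Or.inr ?_)
        rw [show P = _ from if_pos (hasSums_iff.2 hT), Finset.mem_image]
        rcases (h.sub_ne hkl).lt_or_gt with hlt | hlt
        · exact ⟨(k, l), (hQ _).2 ⟨hlt, hs⟩, add_comm _ _⟩
        · exact ⟨(l, k), (hQ _).2 ⟨hlt, by rwa [Bool.beq_comm]⟩, rfl⟩
      · have := h.add_pos hT k l hkl
        rw [map_neg, map_add] at hp
        linarith
      · exact Or.inr ⟨k, by simpa using hk, rfl⟩
      · have h1 := h.single_pos even k hk
        have h2 := lt_of_le_of_ne (singleCoeff_nonneg T even k.isLeft) hk.symm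
        have := mul_pos h2 h1
        rw [map_neg, map_smul, smul_eq_mul] at hp
        linarith
    · rintro ((⟨⟨k, l⟩, ⟨hlt, hs⟩, rfl⟩ | hα) | ⟨k, hk, rfl⟩)
      · have hkl : l ≠ k := by
          rintro rfl
          exact lt_irrefl _ hlt
        refine ⟨Or.inl ⟨l, k, hkl, by rwa [Bool.beq_comm], Or.inl rfl⟩, ?_⟩
        rw [map_sub]
        exact sub_pos.2 hlt
      · by_cases hT : hasSums T = true
        · rw [show P = _ from if_pos hT, Finset.mem_image] at hα
          obtain ⟨⟨k, l⟩, hkl, rfl⟩ := hα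
          have hne := hQne _ hkl
          obtain ⟨hlt, hs⟩ := (hQ _).1 hkl
          refine ⟨Or.inl ⟨l, k, hne.symm, by rwa [Bool.beq_comm],
            Or.inr ⟨hasSums_iff.1 hT, Or.inl rfl⟩⟩, ?_⟩
          rw [map_add]
          exact h.add_pos (hasSums_iff.1 hT) l k hne.symm
        · rw [show P = ∅ from if_neg hT] at hα
          simp at hα
      · have hk' : singleCoeff T even k.isLeft ≠ 0 := by simpa using hk
        refine ⟨Or.inr ⟨k, hk', Or.inl rfl⟩, ?_⟩
        rw [map_smul, smul_eq_mul]
        exact mul_pos (lt_of_le_of_ne (singleCoeff_nonneg T even k.isLeft) hk'.symm)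
          (h.single_pos even k hk')
  have hPmem : ∀ α ∈ P, ∃ p ∈ Q, α = letter p.2 + letter p.1 := by
    intro α hα
    by_cases hT : hasSums T = true
    · rw [show P = _ from if_pos hT, Finset.mem_image] at hα
      obtain ⟨p, hp, rfl⟩ := hα
      exact ⟨p, hp, rfl⟩
    · rw [show P = ∅ from if_neg hT] at hα
      simp at hα
  have hDsum : ∀ α ∈ D, ∑ l, α l = 0 := by
    intro α hα
    obtain ⟨p, -, rfl⟩ := Finset.mem_image.1 hα
    simp only [Pi.sub_apply, Finset.sum_sub_distrib, sum_letter, sub_self]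
  have hDP : Disjoint D P := by
    rw [Finset.disjoint_left]
    intro α hα hα'
    obtain ⟨p, -, rfl⟩ := hPmem α hα'
    have := hDsum _ hα
    simp only [Pi.add_apply, Finset.sum_add_distrib, sum_letter] at this
    norm_num at this
  have hU : Disjoint (D ∪ P) U := by
    rw [Finset.disjoint_left]
    intro α hα hα'
    obtain ⟨k, hk, rfl⟩ := Finset.mem_image.1 hα'
    rcases Finset.mem_union.1 hα with hα | hα
    · have := hDsum _ hα
      simp only [Pi.smul_apply, smul_eq_mul, ← Finset.mul_sum, sum_letter, mul_one] at this
      simp [this] at hk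
    · obtain ⟨p, hp, he⟩ := hPmem _ hα
      exact letter_add_ne_smul (hQne p hp) _ he.symm
  rw [hRU, Finset.prod_union hU, Finset.prod_union hDP]
  have e1 : ∏ α ∈ D, F α = ∏ k, ∏ l, if IsBelow f even k l then F (letter l - letter k) else 1 := by
    rw [Finset.prod_image, ← Fintype.prod_prod_type'
      (f := fun k l => if IsBelow f even k l then F (letter l - letter k) else 1),
      Finset.prod_filter]
    intro p hp p' hp' he
    obtain ⟨h1, h2⟩ := letter_sub_inj (hQne p hp) he
    exact Prod.ext h1 h2
  have e2 : ∏ α ∈ P, F α = ∏ k, ∏ l, if IsBelow f even k l then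
      (if hasSums T then F (letter l + letter k) else 1) else 1 := by
    by_cases hT : hasSums T = true
    · rw [show P = _ from if_pos hT, Finset.prod_image]
      · simp only [hT, if_true]
        rw [← Fintype.prod_prod_type'
          (f := fun k l => if IsBelow f even k l then F (letter l + letter k) else 1),
          Finset.prod_filter]
      · intro p hp p' hp' he
        rcases letter_add_inj (hQne p hp) he with ⟨h1, h2⟩ | ⟨h1, h2⟩
        · exact Prod.ext h1 h2
        · have h3 := ((hQ p).1 hp).1
          have h4 := ((hQ p').1 hp').1
          rw [← h1, ← h2] at h4
          exact absurd h3 h4.not_gt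
    · rw [show P = ∅ from if_neg hT]
      simp [hT]
  have e3 : ∏ α ∈ U, F α = ∏ k, if singleCoeff T even k.isLeft ≠ 0 then
      F (singleCoeff T even k.isLeft • letter k) else 1 := by
    rw [Finset.prod_image, Finset.prod_filter]
    intro k hk k' hk' he
    have hk0 : singleCoeff T even k.isLeft ≠ 0 := by simpa using hk
    by_contra hne
    have := congrFun he k
    simp [letter_apply, hne] at this
    exact hk0 this
  rw [e1, e2, e3, ← Finset.prod_mul_distrib]
  congr 1
  refine Finset.prod_congr rfl fun k _ => ?_
  rw [← Finset.prod_mul_distrib]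
  refine Finset.prod_congr rfl fun l _ => ?_
  split_ifs <;> simp

/-- The number of letters below `l`, on the same side (`even = true`), resp. on the opposite
side. -/
noncomputable def countBelow (f : Module.Dual ℝ (V m n)) (even : Bool) (l : Fin m ⊕ Fin n) : ℕ :=
  (Finset.univ.filter fun k => IsBelow f even k l).card

/-- The number of letters on the same side as `k`, resp. on the opposite side. -/
def sideCount (even : Bool) (k : Fin m ⊕ Fin n) : ℕ :=
  (Finset.univ.filter fun l : Fin m ⊕ Fin n => (l.isLeft == k.isLeft) = even).card

/-- The part of twice the coefficient of `letter k` in `ρ` that does not depend on `f`. -/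
noncomputable def rhoShift (T : SuperType) (k : Fin m ⊕ Fin n) : ℝ :=
  if hasSums T then singleCoeff T true k.isLeft - singleCoeff T false k.isLeft
  else 1 - sideCount true k + sideCount false k

theorem mem_posEven_iff {T : SuperType} {f : Module.Dual ℝ (V m n)} (α : V m n) :
    α ∈ posEven T f ↔ RootShape T true α ∧ 0 < f α := by
  rw [mem_posEven, mem_evenRoots_iff]

theorem mem_posOdd_iff {T : SuperType} {f : Module.Dual ℝ (V m n)} (α : V m n) :
    α ∈ posOdd T f ↔ RootShape T false α ∧ 0 < f α := by
  rw [mem_posOdd, mem_oddRoots_iff]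

theorem sum_posRoots_eq {T : SuperType} {f : Module.Dual ℝ (V m n)}
    {S : Finset (V m n)} (h : Normalized T f S) (even : Bool) {R : Finset (V m n)}
    (hR : ∀ α, α ∈ R ↔ RootShape T even α ∧ 0 < f α) :
    ∑ α ∈ R, α = ∑ l, (2 * countBelow f even l + (if hasSums T then
      singleCoeff T even l.isLeft else (if even then 1 else 0) - sideCount even l)) •
        letter l := by
  have hcount : ∑ k, ∑ l, (if IsBelow f even k l then (letter l : V m n) else 0) =
      ∑ l, (countBelow f even l : ℝ) • letter l := by
    rw [Finset.sum_comm]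
    refine Finset.sum_congr rfl fun l _ => ?_
    rw [Finset.sum_ite, Finset.sum_const_zero, add_zero, Finset.sum_const, countBelow,
      Nat.cast_smul_eq_nsmul]
  rw [sum_posRoots h even hR fun α => α]
  by_cases hT : hasSums T = true
  · simp only [hT, if_true]
    have h1 : ∀ k l : Fin m ⊕ Fin n, (if IsBelow f even k l then
        (letter l - letter k + (letter l + letter k) : V m n) else 0) =
        (2 : ℝ) • if IsBelow f even k l then (letter l : V m n) else 0 := by
      intro k l
      split_ifs
      · module
      · simp
    have h2 : ∀ k : Fin m ⊕ Fin n, (if singleCoeff T even k.isLeft ≠ 0 then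
        singleCoeff T even k.isLeft • (letter k : V m n) else 0) =
        singleCoeff T even k.isLeft • letter k := by
      intro k
      split_ifs with h
      · rfl
      · rw [not_not.1 h, zero_smul]
    simp only [h1, h2, ← Finset.smul_sum, hcount]
    rw [Finset.smul_sum, ← Finset.sum_add_distrib]
    exact Finset.sum_congr rfl fun l _ => by module
  · have hT0 : ∀ b, singleCoeff T even b = 0 := by
      cases T
      · intro b
        cases even <;> cases b <;> rfl
      · exact absurd rfl hT
      · exact absurd rfl hT
    simp only [hT, hT0, ne_eq, not_true_eq_false, if_false, Bool.false_eq_true,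
      Finset.sum_const_zero, add_zero]
    have h1 : ∀ k l : Fin m ⊕ Fin n, (if IsBelow f even k l then
        (letter l - letter k : V m n) else 0) =
        (if IsBelow f even k l then (letter l : V m n) else 0) -
        if IsBelow f even k l then (letter k : V m n) else 0 := by
      intro k l
      split_ifs <;> simp
    simp only [h1, Finset.sum_sub_distrib, hcount]
    rw [← Finset.sum_sub_distrib]
    refine Finset.sum_congr rfl fun l _ => ?_
    rw [Finset.sum_ite, Finset.sum_const_zero, add_zero, Finset.sum_const,
      ← Nat.cast_smul_eq_nsmul ℝ, ← sub_smul]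
    congr 1
    have h2 : (Finset.univ.filter fun k : Fin m ⊕ Fin n => (k.isLeft == l.isLeft) = even) =
        (Finset.univ.filter fun k => IsBelow f even k l) ∪
        ((Finset.univ.filter fun k => IsBelow f even l k) ∪ if even then {l} else ∅) := by
      ext k
      simp only [Finset.mem_filter, Finset.mem_univ, true_and, Finset.mem_union]
      constructor
      · intro hk
        by_cases hkl : k = l
        · subst hkl
          have : even = true := by simpa using hk.symm
          simp [this]
        · rcases (h.sub_ne hkl).lt_or_gt with hlt | hlt
          · exact Or.inl ⟨hlt, hk⟩
          · exact Or.inr (Or.inl ⟨hlt, by rwa [Bool.beq_comm]⟩)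
      · rintro (hk | hk | hk)
        · exact hk.2
        · rw [Bool.beq_comm]
          exact hk.2
        · cases even
          · simp at hk
          · have : k = l := by simpa using hk
            simp [this]
    have h3 : sideCount even l = countBelow f even l +
        ((Finset.univ.filter fun k => IsBelow f even l k).card + if even then 1 else 0) := by
      rw [sideCount, h2, Finset.card_union_of_disjoint, Finset.card_union_of_disjoint, countBelow]
      · cases even <;> simp
      · rw [Finset.disjoint_left]
        intro k hk hk'
        cases even
        · simp at hk'
        · have : k = l := by simpa using hk'
          simp [this, IsBelow] at hk
      · rw [Finset.disjoint_left]
        intro k hk hk'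
        have hlt := ((Finset.mem_filter.1 hk).2).1
        rcases Finset.mem_union.1 hk' with hk' | hk'
        · exact absurd ((Finset.mem_filter.1 hk').2).1 hlt.not_gt
        · cases even
          · simp at hk'
          · have : k = l := by simpa using hk'
            rw [this] at hlt
            exact lt_irrefl _ hlt
    rw [h3]
    push_cast
    ring

theorem rho_eq {T : SuperType} {f : Module.Dual ℝ (V m n)} {S : Finset (V m n)}
    (h : Normalized T f S) : rho T f = ∑ l, ((countBelow f true l : ℝ) - countBelow f false l +
      rhoShift T l / 2) • letter l := by
  rw [rho, sum_posRoots_eq h true mem_posEven_iff, sum_posRoots_eq h false mem_posOdd_iff,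
    ← smul_sub, ← Finset.sum_sub_distrib, Finset.smul_sum]
  refine Finset.sum_congr rfl fun l _ => ?_
  rw [← sub_smul, smul_smul, rhoShift]
  congr 1
  by_cases hT : hasSums T = true <;> simp only [hT, if_true, if_false, Bool.false_eq_true] <;> ring

/-- `e^v` in type `A` and `e^v + e^{-v}` in types `B` and `D`. -/
noncomputable def zeta (T : SuperType) (v : V m n) : RatFun m n :=
  if hasSums T then ecosh v else e v

/-- The contribution of the letter `k` to `R e^ρ`. -/
noncomputable def singleFactor (T : SuperType) (k : Fin m ⊕ Fin n) : RatFun m n :=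
  e ((rhoShift T k / 2) • letter k) *
    ((if singleCoeff T true k.isLeft ≠ 0 then 1 - e (-(singleCoeff T true k.isLeft • letter k))
      else 1) /
    if singleCoeff T false k.isLeft ≠ 0 then 1 + e (-(singleCoeff T false k.isLeft • letter k))
      else 1)

theorem even_pair_factor (T : SuperType) (v w : V m n) :
    (1 - e (-(w - v))) * (if hasSums T then 1 - e (-(w + v)) else 1) =
      (zeta T w - zeta T v) * e (-w) := by
  rw [zeta, zeta]
  split_ifs
  · rw [ecosh, ecosh, neg_sub, neg_add, e_sub, e_add, e_neg, e_neg]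
    field_simp [e_ne_zero]
    ring
  · rw [neg_sub, e_sub, e_neg]
    field_simp [e_ne_zero]

theorem odd_pair_factor (T : SuperType) (v w : V m n) :
    (1 + e (-(w - v))) * (if hasSums T then 1 + e (-(w + v)) else 1) =
      (zeta T w + zeta T v) * e (-w) := by
  rw [zeta, zeta]
  split_ifs
  · rw [ecosh, ecosh, neg_sub, neg_add, e_sub, e_add, e_neg, e_neg]
    field_simp [e_ne_zero]
    ring
  · rw [neg_sub, e_sub, e_neg]
    field_simp [e_ne_zero]

theorem prod_ite_e_neg (f : Module.Dual ℝ (V m n)) (even : Bool) (Z : V m n → V m n → RatFun m n) :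
    (∏ k : Fin m ⊕ Fin n, ∏ l : Fin m ⊕ Fin n, if IsBelow f even k l then
      Z (letter k) (letter l) * e (-letter l) else 1) =
    (∏ k : Fin m ⊕ Fin n, ∏ l : Fin m ⊕ Fin n, if IsBelow f even k l then
      Z (letter k) (letter l) else 1) *
      ∏ l : Fin m ⊕ Fin n, e (-((countBelow f even l : ℝ) • letter l)) := by
  have h1 : ∀ l : Fin m ⊕ Fin n, e (-((countBelow f even l : ℝ) • letter l)) =
      ∏ k, if IsBelow f even k l then e (-letter l : V m n) else 1 := by
    intro l
    rw [Finset.prod_ite, Finset.prod_const_one, mul_one, Finset.prod_const, ← smul_neg,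
      e_natCast_smul, countBelow]
  simp only [h1]
  rw [Finset.prod_comm (f := fun l k => if IsBelow f even k l then e (-letter l : V m n) else 1),
    ← Finset.prod_mul_distrib]
  refine Finset.prod_congr rfl fun k _ => ?_
  rw [← Finset.prod_mul_distrib]
  refine Finset.prod_congr rfl fun l _ => ?_
  split_ifs <;> simp

theorem weylDenominator_mul_e_rho {T : SuperType} {f : Module.Dual ℝ (V m n)} {S : Finset (V m n)}
    (h : Normalized T f S) : weylDenominator T f * e (rho T f) =
      (∏ k : Fin m ⊕ Fin n, ∏ l : Fin m ⊕ Fin n, if IsBelow f true k l then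
        zeta T (letter l) - zeta T (letter k) else 1) /
      (∏ k : Fin m ⊕ Fin n, ∏ l : Fin m ⊕ Fin n, if IsBelow f false k l then
        zeta T (letter l) + zeta T (letter k) else 1) * ∏ k, singleFactor T k := by
  rw [weylDenominator, prod_posRoots h true mem_posEven_iff (fun α => 1 - e (-α)),
    prod_posRoots h false mem_posOdd_iff (fun α => 1 + e (-α)), rho_eq h, e_sum]
  simp only [even_pair_factor, odd_pair_factor]
  rw [prod_ite_e_neg f true fun v w => zeta T w - zeta T v,
    prod_ite_e_neg f false fun v w => zeta T w + zeta T v]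
  have h1 : ∀ l : Fin m ⊕ Fin n, e (((countBelow f true l : ℝ) - countBelow f false l +
      rhoShift T l / 2) • letter l : V m n) = e (-((countBelow f false l : ℝ) • letter l)) /
      e (-((countBelow f true l : ℝ) • letter l)) * e ((rhoShift T l / 2) • letter l) := by
    intro l
    rw [← e_sub, ← e_add]
    congr 1
    module
  simp only [h1, singleFactor, Finset.prod_mul_distrib, Finset.prod_div_distrib]
  have h2 : ∀ even : Bool, ∏ l : Fin m ⊕ Fin n,
      e (-((countBelow f even l : ℝ) • letter l) : V m n) ≠ 0 :=
    fun even => Finset.prod_ne_zero_iff.2 fun l _ => e_ne_zero _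
  have h3 := h2 true
  have h4 := h2 false
  field_simp

end PositiveRoots

/-! ### The matching of the letters -/

section Matching

variable {m n : ℕ}

/-- The letters of the side of the Weyl group are indexed by `κ ⊕ μ`, those of the other side by
`κ`, such that the letter `b : κ` of the first side is adjacent to the letter `b` of the second
side, and `S` consists of the differences of these pairs. -/
structure IsMatching {κ μ : Type} [Fintype κ] (s : Side) (f : Module.Dual ℝ (V m n))
    (S : Finset (V m n)) (E : (κ ⊕ μ) ⊕ κ ≃ Fin m ⊕ Fin n) : Prop where
  isLeft_inl : ∀ a, (E (.inl a)).isLeft = sideBool s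
  isLeft_inr : ∀ b, (E (.inr b)).isLeft ≠ sideBool s
  adjacent : ∀ b c, c ≠ E (.inl (.inl b)) → c ≠ E (.inr b) →
    (f (letter c) < f (letter (E (.inl (.inl b)))) ↔ f (letter c) < f (letter (E (.inr b))))
  prod_eq : ∀ F : V m n → RatFun m n, ∏ β ∈ S, F β = ∏ b,
    F (if f (letter (E (.inr b))) < f (letter (E (.inl (.inl b)))) then
      letter (E (.inl (.inl b))) - letter (E (.inr b))
      else letter (E (.inr b)) - letter (E (.inl (.inl b))))

theorem Normalized.adjacent {T : SuperType} {f : Module.Dual ℝ (V m n)} {S : Finset (V m n)}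
    (h : Normalized T f S) {k l : Fin m ⊕ Fin n} (hS : letter k - letter l ∈ S)
    {c : Fin m ⊕ Fin n} (hk : c ≠ k) (hl : c ≠ l) :
    f (letter c) < f (letter k) ↔ f (letter c) < f (letter l) := by
  have hpos := h.pos _ hS
  rw [map_sub, sub_pos] at hpos
  refine ⟨fun hlt => ?_, fun hlt => hlt.trans hpos⟩
  by_contra! hle
  have hlt' := lt_of_le_of_ne hle (h.sub_ne hl.symm)
  refine h.indecomposable _ hS (letter k - letter c) (sub_mem_roots T hk.symm)
    (letter c - letter l) (sub_mem_roots T hl) ?_ ?_ (by abel)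
  · rw [map_sub]
    linarith
  · rw [map_sub]
    linarith

theorem card_not_side (b : Bool) :
    Fintype.card {k : Fin m ⊕ Fin n // ¬k.isLeft = b} = if b then n else m := by
  rw [Fintype.card_subtype, Finset.card_filter, Fintype.sum_sum_type]
  cases b <;> simp

theorem IsLargest.card_le {T : SuperType} {s : Side} (hs : IsLargest T m n s) :
    (if sideBool s then n else m) = min m n := by
  cases T <;> cases s <;> simp only [IsLargest, sideBool] at hs ⊢ <;> simp <;> omega

theorem exists_matching {T : SuperType} {s : Side} (hs : IsLargest T m n s)
    {f : Module.Dual ℝ (V m n)} {S : Finset (V m n)} (h : Normalized T f S) :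
    ∃ (κ μ : Type) (_ : Fintype κ) (_ : Fintype μ) (_ : DecidableEq κ) (_ : DecidableEq μ)
      (E : (κ ⊕ μ) ⊕ κ ≃ Fin m ⊕ Fin n), IsMatching s f S E := by
  classical
  let κ := {k : Fin m ⊕ Fin n // ¬k.isLeft = sideBool s}
  let L := {k : Fin m ⊕ Fin n // k.isLeft = sideBool s}
  have hcommon : ∀ {β β' : V m n}, β ∈ S → β' ∈ S → ∀ {k}, β k ≠ 0 → β' k ≠ 0 → β = β' :=
    fun hβ hβ' => eq_of_common_letter (S := (S : Set (V m n))) h.mem h.pos h.orth hβ hβ'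
  have hq : ∀ β : S, ∃ b : κ, β.1 b.1 ≠ 0 := by
    rintro ⟨β, hβ⟩
    obtain ⟨k, l, hkl, rfl⟩ := h.diff β hβ
    have hne : k ≠ l := fun h => hkl (by rw [h])
    by_cases hk : k.isLeft = sideBool s
    · exact ⟨⟨l, fun hl => hkl (hk.trans hl.symm)⟩, by simp [letter_apply, hne.symm]⟩
    · exact ⟨⟨k, hk⟩, by simp [letter_apply, hne]⟩
  choose q hq using hq
  have hqinj : Function.Injective q := fun β β' he =>
    Subtype.ext (hcommon β.2 β'.2 (hq β) (by rw [he]; exact hq β'))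
  have hqsurj : Function.Surjective q := by
    refine ((Fintype.bijective_iff_injective_and_card q).2 ⟨hqinj, ?_⟩).2
    rw [Fintype.card_coe, h.card, card_not_side, hs.card_le]
  have hφ : ∀ b : κ, ∃ a : L, letter a.1 - letter b.1 ∈ S ∨ letter b.1 - letter a.1 ∈ S := by
    intro b
    obtain ⟨β, rfl⟩ := hqsurj b
    obtain ⟨k, l, hkl, he⟩ := h.diff β.1 β.2
    have h1 := hq β
    have h2 : (q β).1 = k ∨ (q β).1 = l := by
      by_contra! hc
      rw [he] at h1
      simp [letter_apply, hc.1, hc.2] at h1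
    have hside : ∀ a b : Fin m ⊕ Fin n, a.isLeft ≠ b.isLeft → b.isLeft ≠ sideBool s →
        a.isLeft = sideBool s := by
      intro a b hab hb
      cases h1 : a.isLeft <;> cases h2 : b.isLeft <;> cases h3 : sideBool s <;> simp_all
    rcases h2 with h2 | h2
    · have hmem : letter (q β).1 - letter l ∈ S := h2.symm ▸ he ▸ β.2
      exact ⟨⟨l, hside l k hkl.symm (h2 ▸ (q β).2)⟩, Or.inr hmem⟩
    · have hmem : letter k - letter (q β).1 ∈ S := h2.symm ▸ he ▸ β.2
      exact ⟨⟨k, hside k l hkl (h2 ▸ (q β).2)⟩, Or.inl hmem⟩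
  choose φ hφ using hφ
  have hne : ∀ (a : L) (b : κ), a.1 ≠ b.1 := fun a b he => b.2 (he ▸ a.2)
  let B : κ → V m n := fun b => if f (letter b.1) < f (letter (φ b).1) then
    letter (φ b).1 - letter b.1 else letter b.1 - letter (φ b).1
  have hB : ∀ b, B b ∈ S := by
    intro b
    rcases hφ b with hb | hb
    · have := h.pos _ hb
      rw [map_sub, sub_pos] at this
      simpa only [B, this, if_true] using hb
    · have := h.pos _ hb
      rw [map_sub, sub_pos] at this
      simpa only [B, this.not_gt, if_false] using hb
  have hBb : ∀ b, B b b.1 ≠ 0 := by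
    intro b
    simp only [B]
    split_ifs <;> simp [letter_apply, (hne (φ b) b).symm]
  have hBa : ∀ b, B b (φ b).1 ≠ 0 := by
    intro b
    simp only [B]
    split_ifs <;> simp [letter_apply, hne (φ b) b]
  have hBinj : Function.Injective B := by
    intro b b' he
    by_contra hbb
    have h1 := hBb b
    rw [he] at h1
    refine h1 ?_
    have h2 : b.1 ≠ b'.1 := fun h => hbb (Subtype.ext h)
    simp only [B]
    split_ifs <;> simp [letter_apply, (hne (φ b') b).symm, h2]
  have hφinj : Function.Injective φ := fun b b' he =>
    hBinj (hcommon (hB b) (hB b') (hBa b) (by rw [he]; exact hBa b'))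
  let μ := {a : L // a ∉ Set.range φ}
  let E₀ : κ ⊕ μ ≃ L := ((Equiv.ofInjective φ hφinj).sumCongr (Equiv.refl μ)).trans
    (Equiv.Set.sumCompl (Set.range φ))
  let E : (κ ⊕ μ) ⊕ κ ≃ Fin m ⊕ Fin n := (E₀.sumCongr (Equiv.refl κ)).trans
    (Equiv.sumCompl fun k : Fin m ⊕ Fin n => k.isLeft = sideBool s)
  have hEr : ∀ b, E (.inr b) = b.1 := fun b => rfl
  have hEl : ∀ a, E (.inl a) = (E₀ a).1 := fun a => rfl
  have hEφ : ∀ b, E (.inl (.inl b)) = (φ b).1 := fun b => rfl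
  refine ⟨κ, μ, inferInstance, inferInstance, inferInstance, inferInstance, E, ?_, ?_, ?_, ?_⟩
  · intro a
    rw [hEl]
    exact (E₀ a).2
  · intro b
    exact b.2
  · intro b c hc hc'
    rw [hEφ] at hc ⊢
    rw [hEr] at hc' ⊢
    rcases hφ b with hb | hb
    · exact h.adjacent hb hc hc'
    · exact (h.adjacent hb hc' hc).symm
  · intro F
    symm
    refine Finset.prod_bij (fun b _ => B b) (fun b _ => hB b) (fun _ _ _ _ he => hBinj he)
      (fun β hβ => ?_) fun _ _ => rfl
    exact ⟨q ⟨β, hβ⟩, Finset.mem_univ _, hcommon (hB _) hβ (hBb _) (hq ⟨β, hβ⟩)⟩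

end Matching

/-! ### Both sides of the identity in terms of the matching -/

section Comparison

theorem act_letterFactor {m n : ℕ} {κ μ : Type} [Fintype μ] (h : κ ⊕ μ → ℝ) (t : ℝ) (y : κ → V m n)
    (w : V m n ≃ₗ[ℝ] V m n)
    (hw : ∀ b, w (y b) = y b) (a : κ ⊕ μ) (v : V m n) :
    act w (letterFactor h t y a v) = letterFactor h t y a (w v) := by
  rcases a with b | j
  · simp [letterFactor, act_e, hw]
  · simp [letterFactor, act_e]

theorem E_inl_ne {m n : ℕ} {κ μ : Type} (E : (κ ⊕ μ) ⊕ κ ≃ Fin m ⊕ Fin n) (a : κ ⊕ μ) (b : κ) :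
    E (.inl a) ≠ E (.inr b) := fun h => Sum.inl_ne_inr (E.injective h)

variable {m n : ℕ} {κ μ : Type} [Fintype κ]
  {s : Side} {T : SuperType} {f : Module.Dual ℝ (V m n)} {S : Finset (V m n)}
  {E : (κ ⊕ μ) ⊕ κ ≃ Fin m ⊕ Fin n}

theorem below_eq_sum {ι : Type*} [Fintype ι] (h : ι → ℝ) (t : ℝ) :
    below h t = ∑ i, if h i < t then 1 else 0 := Finset.card_filter _ _

theorem below_sum [Fintype μ] (h : κ ⊕ μ → ℝ) (t : ℝ) :
    below h t = below (fun b => h (.inl b)) t + below (fun j => h (.inr j)) t := by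
  simp only [below_eq_sum, Fintype.sum_sum_type]

theorem IsMatching.isBelow_inl_inl (hM : IsMatching s f S E) (even : Bool) (a a' : κ ⊕ μ) :
    IsBelow f even (E (.inl a)) (E (.inl a')) ↔
      f (letter (E (.inl a))) < f (letter (E (.inl a'))) ∧ even = true := by
  simp [IsBelow, hM.isLeft_inl, eq_comm]

theorem IsMatching.isBelow_inr_inr (hM : IsMatching s f S E) (even : Bool) (b b' : κ) :
    IsBelow f even (E (.inr b)) (E (.inr b')) ↔
      f (letter (E (.inr b))) < f (letter (E (.inr b'))) ∧ even = true := by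
  have : ((E (.inr b)).isLeft == (E (.inr b')).isLeft) = true := by
    have h1 := hM.isLeft_inr b
    have h2 := hM.isLeft_inr b'
    rw [Bool.eq_not_of_ne h1, Bool.eq_not_of_ne h2, beq_self_eq_true]
  rw [IsBelow, this, eq_comm (a := true)]

theorem IsMatching.isBelow_inl_inr (hM : IsMatching s f S E) (even : Bool) (a : κ ⊕ μ) (b : κ) :
    IsBelow f even (E (.inl a)) (E (.inr b)) ↔
      f (letter (E (.inl a))) < f (letter (E (.inr b))) ∧ even = false := by
  have : ((E (.inl a)).isLeft == (E (.inr b)).isLeft) = false := by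
    rw [beq_eq_false_iff_ne, hM.isLeft_inl]
    exact (hM.isLeft_inr b).symm
  rw [IsBelow, this, eq_comm (a := false)]

theorem IsMatching.isBelow_inr_inl (hM : IsMatching s f S E) (even : Bool) (a : κ ⊕ μ) (b : κ) :
    IsBelow f even (E (.inr b)) (E (.inl a)) ↔
      f (letter (E (.inr b))) < f (letter (E (.inl a))) ∧ even = false := by
  have : ((E (.inr b)).isLeft == (E (.inl a)).isLeft) = false := by
    rw [beq_eq_false_iff_ne, hM.isLeft_inl]
    exact hM.isLeft_inr b
  rw [IsBelow, this, eq_comm (a := false)]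

theorem countBelow_eq_sum [Fintype μ] (f : Module.Dual ℝ (V m n)) (E : (κ ⊕ μ) ⊕ κ ≃ Fin m ⊕ Fin n)
    (even : Bool) (l : Fin m ⊕ Fin n) :
    countBelow f even l = (∑ a, if IsBelow f even (E (.inl a)) l then 1 else 0) +
      ∑ b, if IsBelow f even (E (.inr b)) l then 1 else 0 := by
  rw [countBelow, Finset.card_filter, ← E.sum_comp, Fintype.sum_sum_type]

theorem IsMatching.countBelow_inl [Fintype μ] (hM : IsMatching s f S E) (a : κ ⊕ μ) :
    countBelow f true (E (.inl a)) =
      below (fun a => f (letter (E (.inl a)))) (f (letter (E (.inl a)))) ∧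
    countBelow f false (E (.inl a)) =
      below (fun b => f (letter (E (.inr b)))) (f (letter (E (.inl a)))) := by
  simp [countBelow_eq_sum f E, hM.isBelow_inl_inl, hM.isBelow_inr_inl, below_eq_sum]

theorem IsMatching.countBelow_inr [Fintype μ] (hM : IsMatching s f S E) (b : κ) :
    countBelow f true (E (.inr b)) =
      below (fun b => f (letter (E (.inr b)))) (f (letter (E (.inr b)))) ∧
    countBelow f false (E (.inr b)) =
      below (fun a => f (letter (E (.inl a)))) (f (letter (E (.inr b)))) := by
  simp [countBelow_eq_sum f E, hM.isBelow_inl_inr, hM.isBelow_inr_inr, below_eq_sum]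

theorem not_lt_iff_of_ne {a b : ℝ} (h : a ≠ b) : ¬a < b ↔ b < a :=
  ⟨fun h' => lt_of_le_of_ne (not_lt.1 h') h.symm, fun h' => h'.not_gt⟩

/-- The letters of a pair lie on the same side of any further letter. -/
theorem IsMatching.gt_iff (hM : IsMatching s f S E) (h : Normalized T f S) (b : κ)
    {c : Fin m ⊕ Fin n} (hc : c ≠ E (.inl (.inl b))) (hc' : c ≠ E (.inr b)) :
    f (letter (E (.inr b))) < f (letter c) ↔ f (letter (E (.inl (.inl b)))) < f (letter c) := by
  rw [← not_lt_iff_of_ne (h.sub_ne hc), ← not_lt_iff_of_ne (h.sub_ne hc'), hM.adjacent b c hc hc']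

theorem IsMatching.below_inr (hM : IsMatching s f S E) (h : Normalized T f S) (j : μ) :
    below (fun b => f (letter (E (.inr b)))) (f (letter (E (.inl (.inr j))))) =
      below (fun b => f (letter (E (.inl (.inl b))))) (f (letter (E (.inl (.inr j))))) := by
  rw [below_eq_sum, below_eq_sum]
  refine Finset.sum_congr rfl fun b _ => ?_
  exact if_congr (hM.gt_iff h b (by simp [E.injective.eq_iff]) (E_inl_ne E _ _)) rfl rfl

theorem IsMatching.below_inl (hM : IsMatching s f S E) (h : Normalized T f S) (b : κ) :
    below (fun b => f (letter (E (.inr b)))) (f (letter (E (.inl (.inl b))))) =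
      below (fun b => f (letter (E (.inl (.inl b))))) (f (letter (E (.inl (.inl b))))) +
      if f (letter (E (.inr b))) < f (letter (E (.inl (.inl b)))) then 1 else 0 := by
  classical
  have key : ∀ b', (if f (letter (E (.inr b'))) < f (letter (E (.inl (.inl b)))) then 1 else 0) =
      (if f (letter (E (.inl (.inl b')))) < f (letter (E (.inl (.inl b)))) then 1 else 0) +
      if b' = b then (if f (letter (E (.inr b))) < f (letter (E (.inl (.inl b)))) then 1 else 0)
        else 0 := by
    intro b'
    by_cases hb : b' = b
    · subst hb
      simp
    · rw [if_neg hb, add_zero]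
      exact if_congr (hM.gt_iff h b' (by simp [E.injective.eq_iff, Ne.symm hb])
        (E_inl_ne E _ _)) rfl rfl
  rw [below_eq_sum, below_eq_sum, Finset.sum_congr rfl fun b' _ => key b', Finset.sum_add_distrib,
    Finset.sum_ite_eq' Finset.univ b, if_pos (Finset.mem_univ b)]

theorem IsMatching.below_partner (hM : IsMatching s f S E) (h : Normalized T f S) (b : κ) :
    below (fun b => f (letter (E (.inl (.inl b))))) (f (letter (E (.inr b)))) =
      below (fun b => f (letter (E (.inr b)))) (f (letter (E (.inr b)))) +
      if f (letter (E (.inl (.inl b)))) < f (letter (E (.inr b))) then 1 else 0 := by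
  classical
  have key : ∀ b', (if f (letter (E (.inl (.inl b')))) < f (letter (E (.inr b))) then 1 else 0) =
      (if f (letter (E (.inr b'))) < f (letter (E (.inr b))) then 1 else 0) +
      if b' = b then (if f (letter (E (.inl (.inl b)))) < f (letter (E (.inr b))) then 1 else 0)
        else 0 := by
    intro b'
    by_cases hb : b' = b
    · subst hb
      simp
    · rw [if_neg hb, add_zero]
      exact if_congr (hM.gt_iff h b' (E_inl_ne E _ _).symm
        (by simp [E.injective.eq_iff, Ne.symm hb])).symm rfl rfl
  rw [below_eq_sum, below_eq_sum, Finset.sum_congr rfl fun b' _ => key b', Finset.sum_add_distrib,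
    Finset.sum_ite_eq' Finset.univ b, if_pos (Finset.mem_univ b)]

theorem IsMatching.below_unmatched [Fintype μ] (hM : IsMatching s f S E) (b : κ) :
    below (fun j => f (letter (E (.inl (.inr j))))) (f (letter (E (.inr b)))) =
      below (fun j => f (letter (E (.inl (.inr j))))) (f (letter (E (.inl (.inl b))))) := by
  rw [below_eq_sum, below_eq_sum]
  refine Finset.sum_congr rfl fun j _ => ?_
  exact if_congr (hM.adjacent b _ (by simp [E.injective.eq_iff]) (E_inl_ne E _ _)).symm rfl rfl

theorem IsMatching.partner_lt_iff (hM : IsMatching s f S E) (h : Normalized T f S) (b b' : κ) :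
    f (letter (E (.inr b))) < f (letter (E (.inr b'))) ↔
      f (letter (E (.inl (.inl b)))) < f (letter (E (.inl (.inl b')))) := by
  by_cases hb : b = b'
  · subst hb
    simp
  · rw [hM.gt_iff h b (E_inl_ne E _ _).symm (by simp [E.injective.eq_iff, Ne.symm hb]),
      hM.adjacent b' _ (by simp [E.injective.eq_iff, hb]) (E_inl_ne E _ _)]

/-- `e^ρ / ∏ (1 + e^{-β})` as a product of functions of one letter. -/
theorem IsMatching.e_rho_div [Fintype μ] (hM : IsMatching s f S E) (h : Normalized T f S) {t : ℝ}
    (hinl : ∀ a, rhoShift T (E (.inl a)) = 2 * t)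
    (hinr : ∀ b, rhoShift T (E (.inr b)) = 2 * (1 - t)) :
    e (rho T f) / ∏ β ∈ S, (1 + e (-β)) =
      ∏ a, letterFactor (fun a => f (letter (E (.inl a)))) t (fun b => letter (E (.inr b))) a
        (letter (E (.inl a))) := by
  let ht : κ ⊕ μ → ℝ := fun a => f (letter (E (.inl a)))
  let θ : κ → ℝ := fun b =>
    if f (letter (E (.inr b))) < f (letter (E (.inl (.inl b)))) then 1 else 0
  have hrho : rho T f =
      ∑ b, (exponent ht t (.inl b) - θ b) • (letter (E (.inl (.inl b))) - letter (E (.inr b))) +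
      ∑ j, exponent ht t (.inr j) • letter (E (.inl (.inr j))) := by
    rw [rho_eq h, ← E.sum_comp, Fintype.sum_sum_type, Fintype.sum_sum_type]
    simp only [(hM.countBelow_inl _).1, (hM.countBelow_inl _).2, (hM.countBelow_inr _).1,
      (hM.countBelow_inr _).2, hinl, hinr, below_sum (fun a => f (letter (E (.inl a)))),
      hM.below_inr h, hM.below_inl h, hM.below_partner h, hM.below_unmatched]
    rw [add_right_comm, ← Finset.sum_add_distrib]
    congr 1
    · refine Finset.sum_congr rfl fun b _ => ?_
      rw [show ∀ (c : ℝ) (x y : V m n), c • (x - y) = c • x + (-c) • y by intros; module]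
      have hne := h.sub_ne (E_inl_ne E (.inl b) b)
      congr 2
      · simp only [exponent, θ, ht]
        push_cast
        split_ifs <;> ring
      · simp only [exponent, θ, ht]
        push_cast
        rcases hne.lt_or_gt with hlt | hlt
        · simp only [hlt, hlt.not_gt, if_true, if_false]
          ring
        · simp only [hlt, hlt.not_gt, if_true, if_false]
          ring
    · refine Finset.sum_congr rfl fun j _ => ?_
      congr 1
      simp only [exponent, ht]
      push_cast
      ring
  rw [hM.prod_eq, hrho, e_add, e_sum, e_sum, Fintype.prod_sum_type, mul_div_right_comm,
    ← Finset.prod_div_distrib]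
  congr 1
  refine Finset.prod_congr rfl fun b _ => ?_
  simp only [letterFactor, Sum.elim_inl, θ]
  have h1 := one_add_e_ne_zero (letter (E (.inl (.inl b))) - letter (E (.inr b)) : V m n)
  split_ifs with hlt
  · have h2 := one_add_e_ne_zero (-(letter (E (.inl (.inl b))) - letter (E (.inr b))) : V m n)
    rw [div_eq_div_iff h2 h1, sub_smul, one_smul, e_sub, e_neg]
    field_simp [e_ne_zero]
    ring
  · rw [sub_zero, neg_sub]

theorem IsMatching.weylDenominator_mul_e_rho [Fintype μ] (hM : IsMatching s f S E)
    (h : Normalized T f S) :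
    weylDenominator T f * e (rho T f) =
      (orderedDiff (fun a => f (letter (E (.inl a)))) (fun a => zeta T (letter (E (.inl a)))) *
        orderedDiff (fun b => f (letter (E (.inl (.inl b)))))
          (fun b => zeta T (letter (E (.inr b)))) /
        ∏ a, ∏ b, (zeta T (letter (E (.inl a))) + zeta T (letter (E (.inr b))))) *
      ((∏ a, singleFactor T (E (.inl a))) * ∏ b, singleFactor T (E (.inr b))) := by
  rw [WeylDenominator.weylDenominator_mul_e_rho h]
  congr 1
  · congr 1
    · rw [← E.prod_comp, Fintype.prod_sum_type]
      simp only [← E.prod_comp (fun l => if IsBelow _ _ _ l then _ else _),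
        Fintype.prod_sum_type (α₁ := κ ⊕ μ) (α₂ := κ), hM.isBelow_inl_inl, hM.isBelow_inl_inr,
        hM.isBelow_inr_inl, hM.isBelow_inr_inr, and_true, and_false, if_false,
        Finset.prod_const_one, mul_one, one_mul,
        Bool.true_eq_false, hM.partner_lt_iff h]
      rfl
    · rw [← E.prod_comp, Fintype.prod_sum_type]
      simp only [← E.prod_comp (fun l => if IsBelow _ _ _ l then _ else _),
        Fintype.prod_sum_type (α₁ := κ ⊕ μ) (α₂ := κ), hM.isBelow_inl_inl, hM.isBelow_inl_inr,
        hM.isBelow_inr_inl, hM.isBelow_inr_inr, and_true, and_false, if_false,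
        Finset.prod_const_one, mul_one, one_mul,
        Bool.false_eq_true]
      rw [Finset.prod_comm (s := (Finset.univ : Finset κ)), ← Finset.prod_mul_distrib]
      refine Finset.prod_congr rfl fun a _ => ?_
      rw [← Finset.prod_mul_distrib]
      refine Finset.prod_congr rfl fun b _ => ?_
      rcases (h.sub_ne (E_inl_ne E a b)).lt_or_gt with hlt | hlt
      · simp [hlt, hlt.not_gt, add_comm]
      · simp [hlt, hlt.not_gt]
  · rw [← E.prod_comp, Fintype.prod_sum_type]

open scoped Classical in
theorem IsMatching.sum_eq [Fintype μ] [DecidableEq κ] [DecidableEq μ] (hM : IsMatching s f S E)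
    (h : Normalized T f S) {t : ℝ}
    (hinl : ∀ a, rhoShift T (E (.inl a)) = 2 * t)
    (hinr : ∀ b, rhoShift T (E (.inr b)) = 2 * (1 - t)) :
    ∑ w : weylGroup T m n s,
        (sgn w.1 : RatFun m n) * act w.1 (e (rho T f) / ∏ β ∈ S, (1 + e (-β))) =
      ∑ σ : Equiv.Perm (κ ⊕ μ), ((Equiv.Perm.sign σ : ℤ) : RatFun m n) *
        ∑ η : κ ⊕ μ → ℤˣ with Allowed T (sideBool s) η, ((∏ a, η a : ℤˣ) : ℤ) *
          ∏ a, letterFactor (fun a => f (letter (E (.inl a)))) t (fun b => letter (E (.inr b))) a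
            (((η a : ℤ) : ℝ) • letter (E (.inl (σ a)))) := by
  rw [hM.e_rho_div h hinl hinr, sum_weylGroup T s E hM.isLeft_inl hM.isLeft_inr fun w =>
    (sgn w : RatFun m n) * act w (∏ a, letterFactor (fun a => f (letter (E (.inl a)))) t
      (fun b => letter (E (.inr b))) a (letter (E (.inl a))))]
  refine Finset.sum_congr rfl fun σ _ => ?_
  rw [Finset.mul_sum]
  refine Finset.sum_congr rfl fun η _ => ?_
  rw [sgn_weylElement, Units.val_mul, Int.cast_mul, mul_assoc, map_prod]
  congr 2
  refine Finset.prod_congr rfl fun a _ => ?_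
  rw [act_letterFactor _ _ _ _ (weylElement_letter_inr E σ η), weylElement_letter_inl]

end Comparison

/-! ### The identity for normalized positive systems -/

theorem coeff_chebyshevLike_succ {R : Type*} [CommRing R] (a : R) (b : R[X])
    (hb : b.natDegree ≤ 1) (k : ℕ) :
    (chebyshevLike (C a) b (k + 2)).coeff (k + 1) = a - b.coeff 1 := by
  induction k with
  | zero => simp [chebyshevLike]
  | succ k ih =>
    rw [chebyshevLike, coeff_sub, coeff_X_mul, ih, coeff_eq_zero_of_natDegree_lt
      ((natDegree_chebyshevLike a b hb k).trans_lt (by omega)), sub_zero]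

theorem two_mul_sum_filter_prod_eq_one {A R : Type*} [Fintype A] [DecidableEq A] [CommRing R]
    (j : A) (F : (A → ℤˣ) → R) (hF : ∀ η, F (Pi.mulSingle j (-1) * η) = F η) :
    2 * ∑ η with ∏ a, η a = 1, F η = ∑ η, F η := by
  rw [← Finset.sum_filter_add_sum_filter_not Finset.univ (fun η : A → ℤˣ => ∏ a, η a = 1), two_mul]
  congr 1
  refine Finset.sum_equiv (Equiv.mulLeft (Pi.mulSingle j (-1))) (fun η => ?_) fun η _ => (hF η).symm
  have h1 : ∏ a, (Pi.mulSingle j (-1) * η : A → ℤˣ) a = -∏ a, η a := by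
    simp only [Pi.mul_apply, Finset.prod_mul_distrib, Finset.prod_pi_mulSingle', Finset.mem_univ,
      if_true, neg_one_mul]
  simp only [Finset.mem_filter, Finset.mem_univ, true_and, Equiv.coe_mulLeft, h1]
  rcases Int.units_eq_one_or (∏ a, η a) with h | h <;> simp [h]

theorem intCast_prod_units {A R : Type*} [Fintype A] [CommRing R] (η : A → ℤˣ) :
    (((∏ a, η a : ℤˣ) : ℤ) : R) = ∏ a, if η a = 1 then 1 else -1 := by
  rw [Units.coe_prod, Int.cast_prod]
  refine Finset.prod_congr rfl fun a _ => ?_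
  rcases Int.units_eq_one_or (η a) with h | h <;> simp [h, show (-1 : ℤˣ) ≠ 1 by decide]

section Singles

variable {m n : ℕ}

theorem singleFactor_B (k : Fin m ⊕ Fin n) : singleFactor .B k =
    e ((2⁻¹ : ℝ) • letter k) - e (-((2⁻¹ : ℝ) • letter k)) := by
  have h1 := e_half_mul_self (letter k : V m n)
  have h2 := one_add_e_ne_zero (letter k : V m n)
  have h0 := e_ne_zero ((2⁻¹ : ℝ) • letter k : V m n)
  rcases k with i | j
  · simp only [singleFactor, rhoShift, hasSums, singleCoeff, Sum.isLeft_inl, if_true, ne_eq,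
      one_ne_zero, not_false_eq_true, not_true_eq_false, if_false, one_smul, sub_zero, div_one,
      one_div, e_neg]
    rw [← h1]
    generalize e ((2⁻¹ : ℝ) • letter (.inl i) : V m n) = p at h0
    field_simp
  · simp only [singleFactor, rhoShift, hasSums, singleCoeff, Sum.isLeft_inr, if_true, ne_eq,
      one_ne_zero, not_false_eq_true, OfNat.ofNat_ne_zero, one_smul, e_neg, two_smul, e_add]
    norm_num only
    rw [one_div]
    rw [← h1] at h2 ⊢
    generalize e ((2⁻¹ : ℝ) • letter (.inr j) : V m n) = p at h0 h2
    have h3 : 1 + p ^ 2 ≠ 0 := by rwa [sq]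
    rw [show 1 + (p * p)⁻¹ = (1 + p * p) / (p * p) by field_simp; ring]
    field_simp
    ring

theorem singleFactor_D_inl (i : Fin m) : singleFactor .D (.inl i : Fin m ⊕ Fin n) = 1 := by
  simp [singleFactor, rhoShift, hasSums, singleCoeff, e_zero]

theorem singleFactor_D_inr (j : Fin n) : singleFactor .D (.inr j : Fin m ⊕ Fin n) =
    e (letter (.inr j)) - e (-letter (.inr j)) := by
  have h0 := e_ne_zero (letter (.inr j) : V m n)
  simp only [singleFactor, rhoShift, hasSums, singleCoeff, Sum.isLeft_inr, if_true, ne_eq,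
      not_true_eq_false, not_false_eq_true, OfNat.ofNat_ne_zero, if_false, sub_zero, div_one,
      e_neg, two_smul, e_add, div_self, one_smul]
  field_simp

end Singles

section Cases

theorem Normalized.height_injective {m n : ℕ} {κ μ : Type} {T : SuperType}
    {f : Module.Dual ℝ (V m n)} {S : Finset (V m n)} (h : Normalized T f S)
    (E : (κ ⊕ μ) ⊕ κ ≃ Fin m ⊕ Fin n) :
    Function.Injective fun a => f (letter (E (.inl a))) := by
  intro a a' haa
  by_contra hne
  exact h.sub_ne (k := E (.inl a)) (l := E (.inl a')) (by simpa using hne) haa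

variable {m n : ℕ} {κ μ : Type} [Fintype κ] [Fintype μ]
  {s : Side} {T : SuperType} {f : Module.Dual ℝ (V m n)} {S : Finset (V m n)}
  {E : (κ ⊕ μ) ⊕ κ ≃ Fin m ⊕ Fin n}

theorem IsMatching.rhoShift_A (hM : IsMatching s f S E) :
    (∀ a, rhoShift .A (E (.inl a)) = 2 * ((1 - Fintype.card μ) / 2)) ∧
      ∀ b, rhoShift .A (E (.inr b)) = 2 * (1 - (1 - Fintype.card μ) / 2) := by
  have hcount : ∀ (even : Bool) (k : Fin m ⊕ Fin n), sideCount even k =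
      (∑ a, if ((E (.inl a)).isLeft == k.isLeft) = even then 1 else 0) +
        ∑ b, if ((E (.inr b)).isLeft == k.isLeft) = even then 1 else 0 := by
    intro even k
    rw [sideCount, Finset.card_filter, ← E.sum_comp, Fintype.sum_sum_type]
  have hr : ∀ b, (E (.inr b)).isLeft = !sideBool s := fun b => Bool.eq_not_of_ne (hM.isLeft_inr b)
  constructor
  · intro a
    simp only [rhoShift, hasSums, hcount, hM.isLeft_inl, hr]
    cases sideBool s <;> simp <;> ring
  · intro b
    simp only [rhoShift, hasSums, hcount, hM.isLeft_inl, hr]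
    cases sideBool s <;> simp <;> ring

theorem IsMatching.denominatorIdentity_A (hM : IsMatching s f S E) (h : Normalized .A f S) :
    DenominatorIdentity .A s f S := by
  classical
  have hshift := hM.rhoShift_A
  have hx : Function.Injective fun a => (letter (E (.inl a)) : V m n) :=
    letter_injective.comp (E.injective.comp Sum.inl_injective)
  have hy : Function.Injective fun b => (letter (E (.inr b)) : V m n) :=
    letter_injective.comp (E.injective.comp Sum.inr_injective)
  rw [DenominatorIdentity, hM.sum_eq h hshift.1 hshift.2, hM.weylDenominator_mul_e_rho h]
  have hsingle : ∀ k : Fin m ⊕ Fin n, singleFactor .A k = e ((rhoShift .A k / 2) • letter k) := by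
    intro k
    simp [singleFactor, singleCoeff]
  have hfilter : (Finset.univ.filter fun η : κ ⊕ μ → ℤˣ => Allowed .A (sideBool s) η) = {1} := by
    ext η
    simp only [Finset.mem_filter, Finset.mem_univ, true_and, Finset.mem_singleton]
    rfl
  simp only [hfilter, Finset.sum_singleton, Pi.one_apply, Finset.prod_const_one, Units.val_one,
    Int.cast_one, one_mul, one_smul]
  rw [sum_perm_letterFactor _ (h.height_injective E) _ (fun a => letter (E (.inl a))) hx _ hy,
    mul_comm]
  simp only [hsingle, hshift.1, hshift.2, zeta, hasSums, Bool.false_eq_true, if_false]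
  congr 2
  · refine Finset.prod_congr rfl fun a _ => ?_
    congr 2
    ring
  · refine Finset.prod_congr rfl fun b _ => ?_
    congr 2
    ring

/-- The sum over all sign changes and permutations, where a sign change of one letter contributes
the factor `c`. -/
theorem IsMatching.sum_signedPerm [DecidableEq κ] [DecidableEq μ] (hM : IsMatching s f S E)
    (h : Normalized T f S) (hT : T ≠ .A) (t : ℝ) (c a : RatFun m n) (b : (RatFun m n)[X])
    (hb : b.natDegree ≤ 1) (hbμ : b.natDegree ≤ Fintype.card μ) (τ : V m n → RatFun m n)
    (hτ : ∀ v, e (t • v) + c * e (-(t • v)) = τ v * a)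
    (hτ' : ∀ v, e ((t - 1) • v) + c * e (-((t - 1) • v)) = τ v * b.eval (ecosh v))
    (hinl : ∀ i, τ (letter (E (.inl i))) = singleFactor T (E (.inl i)))
    (hinr : ∀ l, e (-(t • letter (E (.inr l)))) * (e (letter (E (.inr l))) * a +
      b.eval (-ecosh (letter (E (.inr l))))) = singleFactor T (E (.inr l))) :
    ∑ σ : Equiv.Perm (κ ⊕ μ), ((Equiv.Perm.sign σ : ℤ) : RatFun m n) *
        ∑ η : κ ⊕ μ → ℤˣ, ∏ i, (if η i = 1 then 1 else c) *
          letterFactor (fun a => f (letter (E (.inl a)))) t (fun b => letter (E (.inr b))) i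
            (((η i : ℤ) : ℝ) • letter (E (.inl (σ i)))) =
      weylDenominator T f * e (rho T f) * ∏ j : μ, (chebyshevLike (C a) b
        (below (fun j => f (letter (E (.inl (.inr j))))) (f (letter (E (.inl (.inr j))))) + 1)).coeff
          (below (fun j => f (letter (E (.inl (.inr j))))) (f (letter (E (.inl (.inr j)))))) := by
  rw [sum_signedPerm_letterFactor _ (h.height_injective E) t (fun a => letter (E (.inl a)))
    (letter_injective.comp (E.injective.comp Sum.inl_injective)) (fun _ _ _ => letter_ne_neg _ _)
    (fun b => letter (E (.inr b))) (letter_injective.comp (E.injective.comp Sum.inr_injective))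
    (fun _ _ _ => letter_ne_neg _ _)
    c a b hb hbμ τ hτ hτ', hM.weylDenominator_mul_e_rho h]
  simp only [hinl, hinr, zeta, hasSums_iff.2 hT, if_true]
  ring

/-- The case where all sign changes occur in the Weyl group. -/
theorem IsMatching.denominatorIdentity_of_allowed (hM : IsMatching s f S E)
    (h : Normalized T f S) (hT : T ≠ .A)
    (hall : ∀ η : κ ⊕ μ → ℤˣ, Allowed T (sideBool s) η) (t : ℝ) (b : RatFun m n)
    (hshift : ∀ a, rhoShift T (E (.inl a)) = 2 * t)
    (hshift' : ∀ b, rhoShift T (E (.inr b)) = 2 * (1 - t))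
    (hτ' : ∀ v : V m n, e ((t - 1) • v) - e (-((t - 1) • v)) = (e (t • v) - e (-(t • v))) * b)
    (hinl : ∀ i, e (t • letter (E (.inl i))) - e (-(t • letter (E (.inl i)))) =
      singleFactor T (E (.inl i)))
    (hinr : ∀ l, e (-(t • letter (E (.inr l)))) * (e (letter (E (.inr l))) + b) =
      singleFactor T (E (.inr l))) :
    DenominatorIdentity T s f S := by
  classical
  have hsum := hM.sum_signedPerm h hT t (-1) 1 (C b) (by simp) (by simp)
    (fun v => e (t • v) - e (-(t • v))) (fun v => by ring)
    (fun v => by rw [eval_C, ← hτ']; ring) hinl (fun l => by rw [eval_C, mul_one, hinr])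
  rw [DenominatorIdentity, hM.sum_eq h hshift hshift']
  have hcoeff : ∀ k, (chebyshevLike (C (1 : RatFun m n)) (C b) (k + 1)).coeff k = 1 := by
    rintro (_ | k)
    · simp [chebyshevLike]
    · rw [coeff_chebyshevLike_succ _ _ (by simp), coeff_C_succ, sub_zero]
  simp only [hcoeff, Finset.prod_const_one, mul_one] at hsum
  rw [← hsum]
  simp only [hall, Finset.filter_true, intCast_prod_units, Finset.prod_mul_distrib]

theorem IsMatching.denominatorIdentity_B (hM : IsMatching s f S E) (h : Normalized .B f S) :
    DenominatorIdentity .B s f S := by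
  have hshift : ∀ k : Fin m ⊕ Fin n, rhoShift .B k = 1 := by
    intro k
    rcases k with i | j <;> simp [rhoShift, hasSums, singleCoeff] <;> norm_num
  refine hM.denominatorIdentity_of_allowed h (by simp) (fun _ => trivial) 2⁻¹ (-1)
    (fun a => by rw [hshift]; norm_num) (fun b => by rw [hshift]; norm_num) (fun v => ?_)
    (fun i => (singleFactor_B _).symm) fun l => ?_
  · rw [show ((2⁻¹ : ℝ) - 1) • v = -((2⁻¹ : ℝ) • v) by module, neg_neg]
    ring
  · rw [singleFactor_B, ← e_half_mul_self (letter (E (.inr l))), e_neg]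
    have h0 := e_ne_zero ((2⁻¹ : ℝ) • letter (E (.inr l)) : V m n)
    generalize e ((2⁻¹ : ℝ) • letter (E (.inr l)) : V m n) = p at h0
    field_simp
    ring

theorem IsMatching.denominatorIdentity_D_del (hM : IsMatching .del f S E)
    (h : Normalized .D f S) : DenominatorIdentity .D .del f S := by
  have hl : ∀ a, ∃ j, E (.inl a) = .inr j := fun a =>
    Sum.isRight_iff.1 (by simpa [sideBool] using hM.isLeft_inl a)
  have hr : ∀ b, ∃ i, E (.inr b) = .inl i := fun b =>
    Sum.isLeft_iff.1 (by simpa [sideBool] using hM.isLeft_inr b)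
  refine hM.denominatorIdentity_of_allowed h (by simp) (fun _ => trivial) 1 0
    (fun a => ?_) (fun b => ?_) (fun v => by simp) (fun a => ?_) fun b => ?_
  · obtain ⟨j, hj⟩ := hl a
    simp [hj, rhoShift, hasSums, singleCoeff]
  · obtain ⟨i, hi⟩ := hr b
    simp [hi, rhoShift, hasSums, singleCoeff]
  · obtain ⟨j, hj⟩ := hl a
    rw [hj, singleFactor_D_inr, one_smul]
  · obtain ⟨i, hi⟩ := hr b
    rw [hi, singleFactor_D_inl, one_smul, add_zero, mul_comm, e_mul_neg]

theorem IsMatching.nonempty_of_lt (hM : IsMatching .eps f S E) (hmn : n < m) : Nonempty μ := by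
  by_contra hμ
  rw [not_nonempty_iff] at hμ
  have h1 := Fintype.card_congr E
  have h2 : Fintype.card κ ≤ n := by
    have := Fintype.card_le_of_injective
      (fun b : κ => (⟨E (.inr b), hM.isLeft_inr b⟩ : {k : Fin m ⊕ Fin n // ¬k.isLeft = true}))
      (fun b b' hb => Sum.inr_injective (E.injective (congrArg Subtype.val hb)))
    rwa [card_not_side] at this
  simp at h1
  omega

theorem IsMatching.denominatorIdentity_D_eps (hM : IsMatching .eps f S E)
    (h : Normalized .D f S) (hmn : n < m) : DenominatorIdentity .D .eps f S := by
  classical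
  have hl : ∀ a, ∃ i, E (.inl a) = .inl i := fun a =>
    Sum.isLeft_iff.1 (by simpa [sideBool] using hM.isLeft_inl a)
  have hr : ∀ b, ∃ j, E (.inr b) = .inr j := fun b =>
    Sum.isRight_iff.1 (by simpa [sideBool] using hM.isLeft_inr b)
  have hμ := hM.nonempty_of_lt hmn
  obtain ⟨j₀, hj₀⟩ := Finite.exists_min fun j : μ => f (letter (E (.inl (.inr j))))
  have hbelow : below (fun j => f (letter (E (.inl (.inr j)))))
      (f (letter (E (.inl (.inr j₀))))) = 0 := by
    simpa [below] using hj₀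
  have hsum := hM.sum_signedPerm h (by simp) 0 1 2 X natDegree_X_le
    (natDegree_X_le.trans Fintype.card_pos) (fun _ => 1)
    (fun v => by simp [e_zero]; norm_num) (fun v => by simp [ecosh]; ring)
    (fun a => by obtain ⟨i, hi⟩ := hl a; rw [hi, singleFactor_D_inl])
    (fun b => by
      obtain ⟨j, hj⟩ := hr b
      rw [hj, singleFactor_D_inr, zero_smul, neg_zero, e_zero, eval_X, ecosh]
      ring)
  have hcoeff : ∏ j : μ, (chebyshevLike (C (2 : RatFun m n)) X
      (below (fun j => f (letter (E (.inl (.inr j))))) (f (letter (E (.inl (.inr j))))) + 1)).coeff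
        (below (fun j => f (letter (E (.inl (.inr j))))) (f (letter (E (.inl (.inr j)))))) = 2 := by
    rw [Finset.prod_eq_single j₀ (fun j _ hj => ?_) (by simp), hbelow]
    · simp only [chebyshevLike, coeff_C_zero]
    · have hpos : 0 < below (fun j => f (letter (E (.inl (.inr j)))))
          (f (letter (E (.inl (.inr j))))) :=
        Finset.card_pos.2 ⟨j₀, by
          simpa using lt_of_le_of_ne (hj₀ j) (h.sub_ne (by simpa using hj.symm))⟩
      obtain ⟨k, hk⟩ := Nat.exists_eq_succ_of_ne_zero hpos.ne'
      rw [hk, Nat.succ_eq_add_one, coeff_chebyshevLike_succ _ _ natDegree_X_le, coeff_X_one]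
      norm_num
  rw [hcoeff] at hsum
  rw [DenominatorIdentity, hM.sum_eq h (t := 0)
    (fun a => by obtain ⟨i, hi⟩ := hl a; simp [hi, rhoShift, hasSums, singleCoeff])
    (fun b => by obtain ⟨j, hj⟩ := hr b; simp [hj, rhoShift, hasSums, singleCoeff])]
  have h2 : (2 : RatFun m n) ≠ 0 := by
    have := e_add_e_ne_zero (0 : V m n) 0
    rwa [e_zero, one_add_one_eq_two] at this
  refine mul_left_cancel₀ h2 ?_
  rw [mul_comm, ← hsum, Finset.mul_sum]
  refine Finset.sum_congr rfl fun σ _ => ?_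
  rw [mul_left_comm]
  congr 1
  simp only [ite_self, one_mul]
  rw [← two_mul_sum_filter_prod_eq_one (Sum.inr j₀ : κ ⊕ μ) _ fun η => ?_]
  · congr 1
    refine Finset.sum_congr (Finset.filter_congr fun _ _ => Iff.rfl) fun η hη => ?_
    have : ∏ a, η a = 1 := (Finset.mem_filter.1 hη).2
    rw [this, Units.val_one, Int.cast_one, one_mul]
  · refine Finset.prod_congr rfl fun a _ => ?_
    by_cases ha : a = .inr j₀
    · subst ha
      simp [letterFactor, exponent, hbelow]
    · simp [Pi.mulSingle_eq_of_ne ha]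

end Cases

theorem denominatorIdentity_of_isLargest {m n : ℕ} {T : SuperType} {s : Side}
    (hs : IsLargest T m n s) {f : Module.Dual ℝ (V m n)} {S : Finset (V m n)}
    (h : Normalized T f S) : DenominatorIdentity T s f S := by
  obtain ⟨κ, μ, _, _, _, _, E, hM⟩ := exists_matching hs h
  cases T
  · exact hM.denominatorIdentity_A h
  · exact hM.denominatorIdentity_B h
  · cases s
    · exact hM.denominatorIdentity_D_eps h hs
    · exact hM.denominatorIdentity_D_del h

end WeylDenominator

open WeylDenominator

theorem mainTheorem1 (T : SuperType) (m n : ℕ) (hm : 1 ≤ m) (hn : 1 ≤ n)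
    (s : Side) (hs : IsLargest T m n s)
    (f : Module.Dual ℝ (V m n)) (hf : ∀ α ∈ roots T m n, f α ≠ 0)
    (P : Set (V m n)) (hP : IsSimpleSystem T f P)
    (S : Finset (V m n)) (hS : IsMaximalIsotropic T (S : Set (V m n)))
    (hSP : (S : Set (V m n)) ⊆ P) :
    weylDenominator T f * e (rho T f) =
      ∑ w : weylGroup T m n s,
        (sgn w.1 : RatFun m n) * act w.1 (e (rho T f) / ∏ β ∈ S, (1 + e (-β))) :=
  denominatorIdentity_of_normalized (fun _ _ h => denominatorIdentity_of_isLargest hs h)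
    (admissible_of_simpleSystem hf hP hS hSP)
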